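/- Let $\mathbb S^d$ be the unit sphere of $\mathbb R^{d+1}$ and put $\langle x,y\rangle=-x_0y_0+x_1y_1+\dots+x_dy_d$, $\mathcal B=\{x\in\mathbb S^d:\langle x,x\rangle\le 0,\ x_0\ge 0\}$ and $\mathcal S=\{x\in\mathcal B:\langle x,x\rangle=0\}$, so that $\mathcal B$ is a spherical cap bounded by the $(d-1)$-sphere $\mathcal S$. A spherical polytope is a set $\mathcal K\cap\mathbb S^d$, where $\mathcal K\subset\mathbb R^{d+1}$ is a pointed polyhedral cone; its faces are the intersections with supporting hyperplanes of $\mathcal K$ (together with the empty face and the polytope itself). A face $F$ is tangent to $\mathcal S$ if $F\cap\mathcal B$ is a single point, and this point lies on $\mathcal S$ and in the relative interior of $F$. A $d$-polytope $P$ is $k$-scribable if there is a spherical polytope in $\mathbb S^d$ with face lattice isomorphic to that of $P$, all of whose $k$-dimensional faces are tangent to $\mathcal S$. A stacked $d$-polytope is a polytope in $\mathbb R^d$ obtained from a $d$-simplex by repeatedly stacking vertices onto facets, where stacking onto a simplicial facet $F$ of $P$ replaces $P$ by $\operatorname{conv}(P\cup\{p\})$ for a point $p$ that lies beyond $F$ and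 beneath all other facets of $P$. **Theorem.** Let $d\ge 3$. For every $0\le k\le d-3$ there is a stacked $d$-polytope that is not $k$-scribable. However, every stacked $d$-polytope is $(d-1)$-scribable (circumscribable) and $(d-2)$-scribable (ridge-scribable). -/

import Mathlib

namespace Scribability

/-- Euclidean space of dimension `d`. -/
abbrev E (d : ℕ) : Type := EuclideanSpace ℝ (Fin d)

/-! ### Euclidean polytopes and stacking -/

/-- The face lattice of a (compact convex) polytope `P`, ordered by inclusion: the intersections of
`P` with its supporting hyperplanes, together with the improper faces `∅` and `P`. -/
def polytopeFaces {d : ℕ} (P : Set (E d)) : Set (Set (E d)) :=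
  {F | IsExposed ℝ P F}

/-- `F` is a facet of the `d`-dimensional polytope `P`: a nonempty face of dimension `d - 1`. -/
def IsFacet {d : ℕ} (P F : Set (E d)) : Prop :=
  F ∈ polytopeFaces P ∧ F.Nonempty ∧ Module.finrank ℝ (vectorSpan ℝ F) + 1 = d

/-- `F` is a facet of `P` that is a `(d - 1)`-simplex. -/
def IsSimplicialFacet {d : ℕ} (P F : Set (E d)) : Prop :=
  IsFacet P F ∧ ∃ w : Fin d → E d, AffineIndependent ℝ w ∧ F = convexHull ℝ (Set.range w)

/-- `p` lies beyond the facet `F` of `P`: strictly on the other side from `P` of the supporting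
hyperplane `{l = c}` that defines `F`. -/
def IsBeyond {d : ℕ} (P F : Set (E d)) (p : E d) : Prop :=
  ∃ (l : StrongDual ℝ (E d)) (c : ℝ),
    (∀ x ∈ P, l x ≤ c) ∧ F = {x ∈ P | l x = c} ∧ c < l p

/-- `p` lies beneath the facet `G` of `P`: strictly on the same side as `P` of the supporting
hyperplane `{l = c}` that defines `G`. -/
def IsBeneath {d : ℕ} (P G : Set (E d)) (p : E d) : Prop :=
  ∃ (l : StrongDual ℝ (E d)) (c : ℝ),
    (∀ x ∈ P, l x ≤ c) ∧ G = {x ∈ P | l x = c} ∧ l p < c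

/-- Stacked `d`-polytopes: obtained from a `d`-simplex by repeatedly stacking a vertex onto a
simplicial facet. Stacking `p` onto the facet `F` of `P` replaces `P` by the convex hull of
`P ∪ {p}`, where `p` is beyond `F` and beneath every other facet of `P`. (All points outside `P`
and close enough to the barycenter of `F` are of this kind, and all points of this kind give the
same combinatorial type.) -/
inductive IsStacked {d : ℕ} : Set (E d) → Prop
  | simplex (v : Fin (d + 1) → E d) (hv : AffineIndependent ℝ v) :
      IsStacked (convexHull ℝ (Set.range v))
  | stack (P F : Set (E d)) (p : E d) (hP : IsStacked P) (hF : IsSimplicialFacet P F)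
      (hp : IsBeyond P F p) (hp' : ∀ G, IsFacet P G → G ≠ F → IsBeneath P G p) :
      IsStacked (convexHull ℝ (insert p P))

/-! ### Spherical polytopes, as pointed polyhedral cones in Lorentzian space -/

/-- The Lorentzian scalar product `-x₀y₀ + x₁y₁ + ⋯ + x_d y_d` on `ℝ^(d+1)`. -/
def lorentz {d : ℕ} (x y : E (d + 1)) : ℝ :=
  -(x 0 * y 0) + ∑ i : Fin d, x i.succ * y i.succ

/-- The spherical cap `𝓑`: the points of the unit sphere of `ℝ^(d+1)` in the light cone. -/
def lightCap (d : ℕ) : Set (E (d + 1)) :=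
  {x | ‖x‖ = 1 ∧ lorentz x x ≤ 0 ∧ 0 ≤ x 0}

/-- The boundary `𝓢` of the spherical cap `𝓑`, a `(d - 1)`-sphere. -/
def lightSphere (d : ℕ) : Set (E (d + 1)) :=
  {x | ‖x‖ = 1 ∧ lorentz x x = 0 ∧ 0 ≤ x 0}

/-- `K` is a pointed polyhedral cone: the conical hull of finitely many vectors, containing no
nontrivial linear subspace. The spherical polytopes in the unit sphere of `ℝ^(d+1)` are exactly the
sets `K ∩ {‖x‖ = 1}` for such `K`. -/
def IsPointedPolyhedral {d : ℕ} (K : PointedCone ℝ (E (d + 1))) : Prop :=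
  (∃ V : Finset (E (d + 1)), K = PointedCone.hull ℝ (V : Set (E (d + 1)))) ∧
    ∀ x ∈ K, -x ∈ K → x = 0

/-- The face lattice of a pointed polyhedral cone `K` (equivalently, of the corresponding spherical
polytope), ordered by inclusion: the intersections of `K` with its supporting linear hyperplanes,
together with `{0}` (which represents the empty face) and `K`. -/
def coneFaces {d : ℕ} (K : PointedCone ℝ (E (d + 1))) : Set (Set (E (d + 1))) :=
  {F | ∃ l : StrongDual ℝ (E (d + 1)), (∀ x ∈ K, l x ≤ 0) ∧ F = {x | x ∈ K ∧ l x = 0}}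

/-- The face `F`, given as a cone, is tangent to `𝓢`: it meets the cap `𝓑` in a single point, this
point lies on `𝓢`, and it is in the relative interior of `F`. -/
def IsTangent {d : ℕ} (F : Set (E (d + 1))) : Prop :=
  ∃ t ∈ lightSphere d, t ∈ intrinsicInterior ℝ F ∧ F ∩ lightCap d = {t}

/-- The spherical polytope given by `K` is `k`-scribed: each of its `k`-faces (whose cones span
linear subspaces of dimension `k + 1`) is tangent to `𝓢`. -/
def IsScribed {d : ℕ} (k : ℕ) (K : PointedCone ℝ (E (d + 1))) : Prop :=
  ∀ F ∈ coneFaces K, Module.finrank ℝ (Submodule.span ℝ F) = k + 1 → IsTangent F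

/-- The `d`-polytope `P` (or rather its combinatorial type) is `k`-scribable: some spherical
polytope with an isomorphic face lattice is `k`-scribed. -/
def IsScribable {d : ℕ} (k : ℕ) (P : Set (E d)) : Prop :=
  ∃ K : PointedCone ℝ (E (d + 1)), IsPointedPolyhedral K ∧
    Nonempty (polytopeFaces P ≃o coneFaces K) ∧ IsScribed k K

end Scribability

/-!
A stacked polytope is encoded by the sets of vertices of its facets: stacking a vertex onto a
facet `F` replaces `F` by the sets `insert n (F.erase i)`, `i ∈ F` (`StackedComplex`). A
configuration of vectors together with functionals that define the facets is a realization of such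
a complex (`Realizes`). The faces of the cone, and of the polytope, that it spans are then known
(`Realizes.nonempty_coneFaces_iso`, `Realizes.nonempty_polytopeFaces_iso`), and each stacked
polytope comes with a realization of its complex (`IsStacked.exists_realizes`), so that
scribability depends on the complex only (`Realizes.isScribable`).

Scribed realizations are constructed by induction on the complex, in terms of the Lorentzian
normals `N F` of the facets. The facet `F` cuts a cap with pole `N F` off the light sphere, or is
tangent to the sphere if `N F` is light-like.

* For facets tangent to the sphere, all normals have to be light-like. A stronger statement is
  suited for induction: for each set `A` of facets there is a realization in which exactly the
  facets in `A` have space-like normals, and the caps are pairwise disjoint. To stack onto `F`,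
  start from a realization for `A ∪ {F}` and choose each new normal in the plane of `N F` and a
  neighboring normal, either light-like or a small perturbation of this choice
  (`HasDisjointCaps.stack`).
* A ridge is tangent to the sphere if the caps of the two facets that contain it touch each other;
  the point of contact is `N F + N G`. The cap of `F` is touched by its neighbors in `d` points
  that are conformally equivalent to the vertices of a regular simplex. Hence there are `d`
  mutually touching caps inside the cap of `F`, the `i`-th of which touches it in the `i`-th of
  these points only. They are the caps of the new facets, and satisfy the same condition
  (`HasTangentCaps.stack`).

For `k ≤ d - 3`, stacking onto four facets of a simplex gives a polytope that is not
`k`-scribable. Assume that it is, fix a face with vertex set `F₀` of cardinality `k`, common to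
all facets considered, and let `L` be its linear span. A `k`-face with one more vertex `x` is
tangent to the sphere in a light-like vector that is orthogonal to `L` and, modulo `L`, a positive
multiple of `x` (`IsFaceMap.exists_tangent_point`). So modulo `L` the configuration is
*inscribed*: all vertices are light-like. It consists of a simplex of dimension `d - k ≥ 3` with
vertices `t a`, and points stacked onto the facets opposite to `t 0`, `t 1`, `t 2`, `t 3`. If
`d - k > 3`, the excess dimensions are disposed of by discarding the components along the other `t a`,
which does not make a stacked point time-like. There remain an ideal tetrahedron, whose dihedral
angles `α`, `β`, `γ` agree on opposite edges and sum to `π`, and a tetrahedron on each of its four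
faces; the dihedral angles at a face of the latter sum to at least `π`. Convexity makes the angles
at each of the six edges sum to less than `π`. In total, the sum of all these angles is at least
`2π + 4π` and less than `6π` (`four_stacked_contradiction`, `stacked_cone_contradiction`).
-/

namespace Scribability

/-! ### Boundary complexes of stacked polytopes -/

/-- The facets obtained from `𝓕` by stacking a new vertex `n` onto the facet `F`. -/
def stackComplex (n : ℕ) (𝓕 : Finset (Finset ℕ)) (F : Finset ℕ) : Finset (Finset ℕ) :=
  𝓕.erase F ∪ F.image (fun i => insert n (F.erase i))

/-- `StackedComplex d n 𝓕`: the finsets in `𝓕` are the vertex sets of the facets of a stacked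
`d`-polytope with vertices `0, …, n - 1`, numbered in the order of stacking. -/
inductive StackedComplex (d : ℕ) : ℕ → Finset (Finset ℕ) → Prop
  | simplex : StackedComplex d (d + 1) ((Finset.range (d + 1)).image (Finset.range (d + 1)).erase)
  | stack (n : ℕ) (𝓕 : Finset (Finset ℕ)) (F : Finset ℕ) (h : StackedComplex d n 𝓕)
      (hF : F ∈ 𝓕) : StackedComplex d (n + 1) (stackComplex n 𝓕 F)

/-- `G` is the facet adjacent to `F` along the ridge opposite to the vertex `i` of `F`. -/
structure IsNeighbor (𝓕 : Finset (Finset ℕ)) (F : Finset ℕ) (i : ℕ) (G : Finset ℕ) : Prop where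
  mem : G ∈ 𝓕
  notMem : i ∉ G
  subset : F.erase i ⊆ G

/-- The combinatorial properties of the boundary complex of a simplicial `d`-polytope that are
needed: it is pure, and each ridge is in exactly two facets. -/
structure IsPseudomanifold (d n : ℕ) (𝓕 : Finset (Finset ℕ)) : Prop where
  nonempty : 𝓕.Nonempty
  lt : ∀ F ∈ 𝓕, ∀ i ∈ F, i < n
  card : ∀ F ∈ 𝓕, F.card = d
  exists_neighbor : ∀ F ∈ 𝓕, ∀ i ∈ F, ∃ G, IsNeighbor 𝓕 F i G
  eq_or_eq : ∀ F ∈ 𝓕, ∀ i ∈ F, ∀ G, IsNeighbor 𝓕 F i G →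
    ∀ H ∈ 𝓕, F.erase i ⊆ H → H = F ∨ H = G

theorem mem_stackComplex {n : ℕ} {𝓕 : Finset (Finset ℕ)} {F H : Finset ℕ} :
    H ∈ stackComplex n 𝓕 F ↔ (H ≠ F ∧ H ∈ 𝓕) ∨ ∃ i ∈ F, insert n (F.erase i) = H := by
  simp [stackComplex]

theorem IsNeighbor.ne {𝓕 : Finset (Finset ℕ)} {F G : Finset ℕ} {i : ℕ}
    (h : IsNeighbor 𝓕 F i G) (hi : i ∈ F) : G ≠ F := by
  rintro rfl; exact h.notMem hi

namespace IsPseudomanifold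

variable {d n : ℕ} {𝓕 : Finset (Finset ℕ)}

theorem notMem (h : IsPseudomanifold d n 𝓕) {F : Finset ℕ} (hF : F ∈ 𝓕) : n ∉ F :=
  fun hn => lt_irrefl _ (h.lt F hF n hn)

theorem neighbor_unique (h : IsPseudomanifold d n 𝓕) {F G G' : Finset ℕ} {i : ℕ} (hF : F ∈ 𝓕)
    (hi : i ∈ F) (hG : IsNeighbor 𝓕 F i G) (hG' : IsNeighbor 𝓕 F i G') : G' = G :=
  (h.eq_or_eq F hF i hi G hG G' hG'.mem hG'.subset).resolve_left (hG'.ne hi)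

/-- Being adjacent is symmetric. -/
theorem neighbor_symm (h : IsPseudomanifold d n 𝓕) {F G : Finset ℕ} {i : ℕ} (hF : F ∈ 𝓕)
    (hi : i ∈ F) (hG : IsNeighbor 𝓕 F i G) :
    ∃ j ∈ G, j ∉ F ∧ G.erase j = F.erase i ∧ IsNeighbor 𝓕 G j F := by
  have hc := h.card F hF
  have hcG := h.card G hG.mem
  have h1 : (F.erase i).card + 1 = d := by rw [Finset.card_erase_add_one hi, hc]
  obtain ⟨j, hj, hjF⟩ : ∃ j ∈ G, j ∉ F.erase i := by
    by_contra! hcon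
    have := Finset.card_le_card (show G ⊆ F.erase i from hcon)
    omega
  have hjF' : j ∉ F := fun hj' => hjF (Finset.mem_erase.2 ⟨fun e => hG.notMem (e ▸ hj), hj'⟩)
  have heq : F.erase i = G.erase j := by
    apply Finset.eq_of_subset_of_card_le
    · intro x hx
      exact Finset.mem_erase.2 ⟨fun e => hjF (e ▸ hx), hG.subset hx⟩
    · have := Finset.card_erase_add_one hj
      omega
  exact ⟨j, hj, hjF', heq.symm, hF, hjF', heq ▸ Finset.erase_subset _ _⟩

theorem exists_mem_notMem (h : IsPseudomanifold d n 𝓕) {F G : Finset ℕ} (hF : F ∈ 𝓕)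
    (hG : G ∈ 𝓕) (hne : G ≠ F) : ∃ j ∈ G, j ∉ F := by
  by_contra! hcon
  exact hne (Finset.eq_of_subset_of_card_le hcon (by rw [h.card F hF, h.card G hG]))

theorem neighbor_ne_neighbor {F G G' : Finset ℕ} {i j : ℕ} (hij : i ≠ j)
    (hi : i ∈ F) (hG : IsNeighbor 𝓕 F i G) (hG' : IsNeighbor 𝓕 F j G') : G ≠ G' := by
  rintro rfl
  exact hG.notMem (hG'.subset (Finset.mem_erase.2 ⟨hij, hi⟩))

theorem simplex :
    IsPseudomanifold d (d + 1) ((Finset.range (d + 1)).image (Finset.range (d + 1)).erase) := by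
  refine ⟨by simp, ?_, ?_, ?_, ?_⟩
  · simp only [Finset.mem_image]
    rintro F ⟨j, hj, rfl⟩ i hi
    exact Finset.mem_range.1 (Finset.mem_of_mem_erase hi)
  · simp only [Finset.mem_image]
    rintro F ⟨j, hj, rfl⟩
    simp [Finset.card_erase_of_mem hj]
  · simp only [Finset.mem_image]
    rintro F ⟨j, hj, rfl⟩ i hi
    refine ⟨(Finset.range (d + 1)).erase i,
      Finset.mem_image_of_mem _ (Finset.mem_of_mem_erase hi), by simp, ?_⟩
    exact Finset.erase_subset_erase _ (Finset.erase_subset _ _)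
  · simp only [Finset.mem_image]
    rintro F ⟨j, hj, rfl⟩ i hi G hG H ⟨k, hk, rfl⟩ hH
    obtain ⟨m, hm, rfl⟩ := Finset.mem_image.1 hG.mem
    have hmi : m = i := by
      by_contra hne
      exact hG.notMem (Finset.mem_erase.2 ⟨fun e => hne e.symm, Finset.mem_of_mem_erase hi⟩)
    subst hmi
    by_cases hkj : k = j
    · exact .inl (by rw [hkj])
    · by_cases hki : k = m
      · exact .inr (by rw [hki])
      · exact absurd (hH (Finset.mem_erase.2 ⟨hki, Finset.mem_erase.2 ⟨hkj, hk⟩⟩)) (by simp)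

/-- The neighbors of a new facet along the ridge opposite to the new vertex. -/
theorem neighbor_new_base (h : IsPseudomanifold d n 𝓕) {F G : Finset ℕ} {i : ℕ} (hF : F ∈ 𝓕)
    (hi : i ∈ F) (hG : IsNeighbor 𝓕 F i G) :
    IsNeighbor (stackComplex n 𝓕 F) (insert n (F.erase i)) n G := by
  refine ⟨mem_stackComplex.2 (.inl ⟨hG.ne hi, hG.mem⟩), h.notMem hG.mem, ?_⟩
  rw [Finset.erase_insert (fun hn => h.notMem hF (Finset.mem_of_mem_erase hn))]
  exact hG.subset

/-- The neighbors of a new facet along the ridges containing the new vertex. -/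
theorem neighbor_new_new (h : IsPseudomanifold d n 𝓕) {F : Finset ℕ} {i j : ℕ} (hF : F ∈ 𝓕)
    (hj : j ∈ F.erase i) :
    IsNeighbor (stackComplex n 𝓕 F) (insert n (F.erase i)) j (insert n (F.erase j)) := by
  have hjn : j ≠ n := fun e => h.notMem hF (e ▸ Finset.mem_of_mem_erase hj)
  refine ⟨mem_stackComplex.2 (.inr ⟨j, Finset.mem_of_mem_erase hj, rfl⟩), by simp [hjn], ?_⟩
  intro x hx
  simp only [Finset.mem_erase, Finset.mem_insert] at hx ⊢
  tauto

/-- The neighbors of an old facet along the ridges it shared with the stacked facet. -/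
theorem neighbor_old_new (h : IsPseudomanifold d n 𝓕) {F H : Finset ℕ} {i j : ℕ}
    (hH : H ∈ 𝓕) (hj : j ∈ H) (hi : i ∈ F) (hjF : j ∉ F)
    (hij : H.erase j = F.erase i) :
    IsNeighbor (stackComplex n 𝓕 F) H j (insert n (F.erase i)) := by
  have hjn : j ≠ n := fun e => h.notMem hH (e ▸ hj)
  refine ⟨mem_stackComplex.2 (.inr ⟨i, hi, rfl⟩), by simp [hjn, hjF], ?_⟩
  rw [hij]; exact Finset.subset_insert _ _

theorem neighbor_old_old {F H G : Finset ℕ} {j : ℕ} (hGF : G ≠ F)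
    (hG : IsNeighbor 𝓕 H j G) : IsNeighbor (stackComplex n 𝓕 F) H j G :=
  ⟨mem_stackComplex.2 (.inl ⟨hGF, hG.mem⟩), hG.notMem, hG.subset⟩

theorem erase_insert_erase (h : IsPseudomanifold d n 𝓕) {F : Finset ℕ} (hF : F ∈ 𝓕) (i : ℕ) :
    (insert n (F.erase i)).erase n = F.erase i :=
  Finset.erase_insert (fun hn => h.notMem hF (Finset.mem_of_mem_erase hn))

theorem stack (h : IsPseudomanifold d n 𝓕) (hd : 2 ≤ d) {F : Finset ℕ} (hF : F ∈ 𝓕) :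
    IsPseudomanifold d (n + 1) (stackComplex n 𝓕 F) := by
  have hn := h.notMem hF
  have hcF := h.card F hF
  have mem_new : ∀ i ∈ F, insert n (F.erase i) ∈ stackComplex n 𝓕 F := fun i hi =>
    mem_stackComplex.2 (.inr ⟨i, hi, rfl⟩)
  -- A subset of the vertices that avoids `n` and lies in a new facet lies in `F`.
  have erase_sub : ∀ S : Finset ℕ, ∀ k, n ∉ S → S ⊆ insert n (F.erase k) → S ⊆ F.erase k := by
    intro S k hS hk x hx
    have := hk hx
    rw [Finset.mem_insert] at this
    exact this.resolve_left (fun e => hS (e ▸ hx))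
  -- distinct new facets share only one ridge with `F`
  have ridge_unique : ∀ i ∈ F, ∀ k ∈ F, F.erase i ⊆ F.erase k → k = i := by
    intro i hi k hk hs
    by_contra hne
    exact absurd (hs (Finset.mem_erase.2 ⟨hne, hk⟩)) (by simp)
  refine ⟨?_, ?_, ?_, ?_, ?_⟩
  · obtain ⟨i, hi⟩ : F.Nonempty := Finset.card_pos.1 (by omega)
    exact ⟨_, mem_new i hi⟩
  · intro H hH i hi
    obtain ⟨-, hH⟩ | ⟨k, hk, rfl⟩ := mem_stackComplex.1 hH
    · exact (h.lt H hH i hi).trans (Nat.lt_succ_self n)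
    · obtain rfl | hi := Finset.mem_insert.1 hi
      · exact Nat.lt_succ_self _
      · exact (h.lt F hF i (Finset.mem_of_mem_erase hi)).trans (Nat.lt_succ_self n)
  · intro H hH
    obtain ⟨-, hH⟩ | ⟨k, hk, rfl⟩ := mem_stackComplex.1 hH
    · exact h.card H hH
    · rw [Finset.card_insert_of_notMem (fun hm => hn (Finset.mem_of_mem_erase hm)),
        Finset.card_erase_add_one hk, hcF]
  · intro H hH' j hj
    obtain ⟨hHF, hH⟩ | ⟨k, hk, rfl⟩ := mem_stackComplex.1 hH'
    · obtain ⟨G, hG⟩ := h.exists_neighbor H hH j hj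
      by_cases hGF : G = F
      · subst hGF
        obtain ⟨i, hi, hiH, hij, -⟩ := h.neighbor_symm hH hj hG
        exact ⟨_, h.neighbor_old_new hH hj hi hG.notMem hij.symm⟩
      · exact ⟨G, neighbor_old_old hGF hG⟩
    · obtain rfl | hj := Finset.mem_insert.1 hj
      · obtain ⟨G, hG⟩ := h.exists_neighbor F hF k hk
        exact ⟨G, h.neighbor_new_base hF hk hG⟩
      · exact ⟨_, h.neighbor_new_new hF hj⟩
  · intro H hH' j hj G hG X hX hsub
    -- it suffices to exhibit one facet that is the only possible second one
    suffices hkey : ∃ G', ∀ X ∈ stackComplex n 𝓕 F, H.erase j ⊆ X → X = H ∨ X = G' by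
      obtain ⟨G', hG'⟩ := hkey
      have hGG' : G = G' := (hG' G hG.mem hG.subset).resolve_left (hG.ne hj)
      exact hGG' ▸ hG' X hX hsub
    clear hG G hsub hX X
    obtain ⟨hHF, hH⟩ | ⟨k, hk, rfl⟩ := mem_stackComplex.1 hH'
    · have hnH := h.notMem hH
      obtain ⟨G, hG⟩ := h.exists_neighbor H hH j hj
      by_cases hGF : G = F
      · subst hGF
        obtain ⟨i, hi, hiH, hij, -⟩ := h.neighbor_symm hH hj hG
        refine ⟨insert n (G.erase i), fun X hX hsub => ?_⟩
        obtain ⟨hXF, hX⟩ | ⟨k, hk, rfl⟩ := mem_stackComplex.1 hX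
        · exact .inl ((h.eq_or_eq H hH j hj G hG X hX hsub).resolve_right hXF)
        · have := erase_sub _ k (fun hm => hnH (Finset.mem_of_mem_erase hm)) hsub
          rw [← hij] at this
          exact .inr (by rw [ridge_unique i hi k hk this])
      · refine ⟨G, fun X hX hsub => ?_⟩
        obtain ⟨hXF, hX⟩ | ⟨k, hk, rfl⟩ := mem_stackComplex.1 hX
        · exact h.eq_or_eq H hH j hj G hG X hX hsub
        · have := erase_sub _ k (fun hm => hnH (Finset.mem_of_mem_erase hm)) hsub
          have := h.eq_or_eq H hH j hj G hG F hF (this.trans (Finset.erase_subset _ _))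
          rcases this with e | e
          · exact absurd e.symm hHF
          · exact absurd e.symm hGF
    · obtain rfl | hj := Finset.mem_insert.1 hj
      · obtain ⟨G, hG⟩ := h.exists_neighbor F hF k hk
        refine ⟨G, fun X hX hsub => ?_⟩
        rw [h.erase_insert_erase hF] at hsub
        obtain ⟨hXF, hX⟩ | ⟨m, hm, rfl⟩ := mem_stackComplex.1 hX
        · exact .inr ((h.eq_or_eq F hF k hk G hG X hX hsub).resolve_left hXF)
        · have := erase_sub _ m (fun hm => hn (Finset.mem_of_mem_erase hm)) hsub
          exact .inl (by rw [ridge_unique k hk m hm this])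
      · refine ⟨insert n (F.erase j), fun X hX hsub => ?_⟩
        have hjn : j ≠ n := fun e => hn (e ▸ Finset.mem_of_mem_erase hj)
        have hnX : n ∈ X := hsub (by simp [hjn.symm])
        obtain ⟨hXF, hX⟩ | ⟨m, hm, rfl⟩ := mem_stackComplex.1 hX
        · exact absurd hnX (h.notMem hX)
        · by_cases hmk : m = k
          · exact .inl (by rw [hmk])
          · by_cases hmj : m = j
            · exact .inr (by rw [hmj])
            · have hmn : m ≠ n := fun e => hn (e ▸ hm)
              have := hsub (show m ∈ _ by simp [hmk, hmj, hm])
              simp [hmn] at this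

end IsPseudomanifold

theorem StackedComplex.isPseudomanifold {d n : ℕ} {𝓕 : Finset (Finset ℕ)} (hd : 2 ≤ d)
    (h : StackedComplex d n 𝓕) : IsPseudomanifold d n 𝓕 := by
  induction h with
  | simplex => exact .simplex
  | stack n 𝓕 F h hF ih => exact ih.stack hd hF

/-- Extend facet-indexed data `old` to the facets created by stacking the vertex `n` onto `F`;
the new facet that misses the vertex `i` of `F` gets `new i`. -/
def stackExtend {X : Type*} (n : ℕ) (F : Finset ℕ) (old : Finset ℕ → X) (new : ℕ → X)
    (H : Finset ℕ) : X :=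
  if n ∈ H then new ((F \ H).sup id) else old H

theorem stackExtend_old {X : Type*} {n : ℕ} {F H : Finset ℕ} {old : Finset ℕ → X} {new : ℕ → X}
    (hn : n ∉ H) : stackExtend n F old new H = old H := by
  simp [stackExtend, hn]

theorem stackExtend_new {X : Type*} {n i : ℕ} {F : Finset ℕ} {old : Finset ℕ → X} {new : ℕ → X}
    (hn : n ∉ F) (hi : i ∈ F) : stackExtend n F old new (insert n (F.erase i)) = new i := by
  have h : F \ insert n (F.erase i) = {i} := by
    ext x
    simp only [Finset.mem_sdiff, Finset.mem_insert, Finset.mem_erase, Finset.mem_singleton]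
    constructor
    · rintro ⟨hx, h⟩
      tauto
    · rintro rfl
      refine ⟨hi, ?_⟩
      rintro (h | h)
      · exact hn (h ▸ hi)
      · exact h.1 rfl
  simp [stackExtend, h]

/-! ### Realizations of boundary complexes by vector configurations -/

/-- The vectors `v 0, …, v (n - 1)` span a `(d + 1)`-dimensional cone whose facets are spanned by
the members of `𝓕`; the functional `l F` is nonpositive on the cone and vanishes exactly on the
facet `F`. By `complete` there are no other facets. -/
structure Realizes {W : Type*} [AddCommGroup W] [Module ℝ W] (n : ℕ) (𝓕 : Finset (Finset ℕ))
    (v : ℕ → W) (l : Finset ℕ → W →ₗ[ℝ] ℝ) : Prop where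
  zero : ∀ F ∈ 𝓕, ∀ i ∈ F, l F (v i) = 0
  neg : ∀ F ∈ 𝓕, ∀ i < n, i ∉ F → l F (v i) < 0
  indep : ∀ F ∈ 𝓕, LinearIndepOn ℝ v (F : Set ℕ)
  complete : ∀ m : W →ₗ[ℝ] ℝ, (∀ i < n, m (v i) ≤ 0) → (∃ i < n, m (v i) ≠ 0) →
    ∃ F ∈ 𝓕, ∀ i < n, m (v i) = 0 → i ∈ F

namespace Realizes

variable {W : Type*} [AddCommGroup W] [Module ℝ W] {d n : ℕ} {𝓕 : Finset (Finset ℕ)}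
  {v : ℕ → W} {l : Finset ℕ → W →ₗ[ℝ] ℝ}

theorem nonpos (h : Realizes n 𝓕 v l) {F : Finset ℕ} (hF : F ∈ 𝓕) {i : ℕ} (hi : i < n) :
    l F (v i) ≤ 0 := by
  by_cases hiF : i ∈ F
  · exact (h.zero F hF i hiF).le
  · exact (h.neg F hF i hi hiF).le

theorem _root_.LinearIndepOn.exists_functional {v : ℕ → W} {F : Finset ℕ}
    (h : LinearIndepOn ℝ v (F : Set ℕ)) (f : ℕ → ℝ) : ∃ m : W →ₗ[ℝ] ℝ, ∀ i ∈ F, m (v i) = f i := by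
  let b := Module.Basis.extend h.id_image
  have hb : ∀ i ∈ F, ∃ k, b k = v i := fun i hi =>
    ⟨⟨v i, h.id_image.subset_extend _ ⟨i, hi, rfl⟩⟩, by
      simp [b, Module.Basis.extend_apply_self]⟩
  classical
  refine ⟨b.constr ℝ fun k => if hk : ∃ i ∈ F, v i = b k then f hk.choose else 0, fun i hi => ?_⟩
  obtain ⟨k, hk⟩ := hb i hi
  have hex : ∃ i ∈ F, v i = b k := ⟨i, hi, hk.symm⟩
  rw [← hk, Module.Basis.constr_basis, dif_pos hex,
    h.injOn hex.choose_spec.1 hi (hex.choose_spec.2.trans hk)]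

theorem exists_notMem (hc : IsPseudomanifold d n 𝓕) (hd : 2 ≤ d) {F : Finset ℕ} (hF : F ∈ 𝓕) :
    ∃ j < n, j ∉ F := by
  obtain ⟨i, hi⟩ : F.Nonempty := Finset.card_pos.1 (by rw [hc.card F hF]; omega)
  obtain ⟨G, hG⟩ := hc.exists_neighbor F hF i hi
  obtain ⟨j, hj, hjF⟩ := hc.exists_mem_notMem hF hG.mem (hG.ne hi)
  exact ⟨j, hc.lt G hG.mem j hj, hjF⟩

theorem finrank_span (h : Realizes n 𝓕 v l) {F S : Finset ℕ} (hF : F ∈ 𝓕) (hS : S ⊆ F) :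
    Module.finrank ℝ (Submodule.span ℝ (v '' (S : Set ℕ))) = S.card := by
  have hi : LinearIndepOn ℝ v (S : Set ℕ) := (h.indep F hF).mono (by exact_mod_cast hS)
  rw [Set.image_eq_range]
  exact (finrank_span_eq_card (R := ℝ) hi).trans (by simp)

/-- The hyperplane of a facet is spanned by the vertices of the facet. -/
theorem ker_eq_span [FiniteDimensional ℝ W] (h : Realizes n 𝓕 v l) (hc : IsPseudomanifold d n 𝓕)
    (hd : 2 ≤ d) (hW : Module.finrank ℝ W = d + 1) {F : Finset ℕ} (hF : F ∈ 𝓕) :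
    LinearMap.ker (l F) = Submodule.span ℝ (v '' (F : Set ℕ)) := by
  symm
  apply Submodule.eq_of_le_of_finrank_le
  · rw [Submodule.span_le]
    rintro _ ⟨i, hi, rfl⟩
    exact h.zero F hF i hi
  · rw [h.finrank_span hF subset_rfl, hc.card F hF]
    obtain ⟨j, hj, hjF⟩ := exists_notMem hc hd hF
    have h1 : l F ≠ 0 := fun h0 => by
      have := h.neg F hF j hj hjF
      simp [h0] at this
    have := Module.Dual.finrank_ker_add_one_of_ne_zero (f := l F) h1
    omega

theorem exists_coeff [FiniteDimensional ℝ W] (h : Realizes n 𝓕 v l) (hc : IsPseudomanifold d n 𝓕)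
    (hd : 2 ≤ d) (hW : Module.finrank ℝ W = d + 1) {F : Finset ℕ} (hF : F ∈ 𝓕) {x : W}
    (hx : l F x = 0) : ∃ c : ℕ → ℝ, x = ∑ i ∈ F, c i • v i := by
  have : x ∈ Submodule.span ℝ (v '' (F : Set ℕ)) := by
    rw [← h.ker_eq_span hc hd hW hF]; exact hx
  obtain ⟨c, hc⟩ := (Submodule.mem_span_image_finset_iff_exists_fun' ℝ).1 this
  exact ⟨c, hc.symm⟩

/-- A functional that vanishes on a facet is a multiple of the functional of the facet. -/
theorem eq_smul [FiniteDimensional ℝ W] (h : Realizes n 𝓕 v l) (hc : IsPseudomanifold d n 𝓕)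
    (hd : 2 ≤ d) (hW : Module.finrank ℝ W = d + 1) {F : Finset ℕ} (hF : F ∈ 𝓕)
    {m : W →ₗ[ℝ] ℝ} (hm : ∀ i ∈ F, m (v i) = 0) {j : ℕ} (hj : j < n) (hjF : j ∉ F) (x : W) :
    m x = m (v j) / l F (v j) * l F x := by
  have hlj := (h.neg F hF j hj hjF).ne
  have hx : l F (x - (l F x / l F (v j)) • v j) = 0 := by
    simp [div_mul_cancel₀ _ hlj]
  obtain ⟨c, hcx⟩ := h.exists_coeff hc hd hW hF hx
  have hm0 : m (x - (l F x / l F (v j)) • v j) = 0 := by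
    rw [hcx, map_sum]
    exact Finset.sum_eq_zero fun i hi => by rw [map_smul, hm i hi, smul_zero]
  rw [map_sub, map_smul, smul_eq_mul, sub_eq_zero] at hm0
  rw [hm0]; ring

theorem apply_neighbor (h : Realizes n 𝓕 v l) {F G : Finset ℕ} {i : ℕ} (hi : i ∈ F)
    (hG : IsNeighbor 𝓕 F i G) (c : ℕ → ℝ) : l G (∑ k ∈ F, c k • v k) = c i * l G (v i) := by
  rw [map_sum, Finset.sum_eq_single_of_mem i hi]
  · simp
  · intro k hk hki
    rw [map_smul, h.zero G hG.mem k (hG.subset (Finset.mem_erase.2 ⟨hki, hk⟩)), smul_zero]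

/-- A point of the hyperplane of a facet that is beneath all adjacent facets is in the relative
interior of the facet. -/
theorem exists_pos_coeff [FiniteDimensional ℝ W] (h : Realizes n 𝓕 v l)
    (hc : IsPseudomanifold d n 𝓕) (hd : 2 ≤ d) (hW : Module.finrank ℝ W = d + 1) {F : Finset ℕ}
    (hF : F ∈ 𝓕) {x : W} (hx : l F x = 0)
    (hG : ∀ i ∈ F, ∃ G, IsNeighbor 𝓕 F i G ∧ l G x < 0) :
    ∃ c : ℕ → ℝ, (∀ i ∈ F, 0 < c i) ∧ x = ∑ i ∈ F, c i • v i := by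
  obtain ⟨c, hcx⟩ := h.exists_coeff hc hd hW hF hx
  refine ⟨c, fun i hi => ?_, hcx⟩
  obtain ⟨G, hG, hlt⟩ := hG i hi
  rw [hcx, h.apply_neighbor hi hG] at hlt
  have := h.neg G hG.mem i (hc.lt F hF i hi) hG.notMem
  nlinarith

/-- A point beyond `F` and beneath the neighbors of `F` is a positive combination of the vertices
of `F` minus a positive multiple of any other vertex. -/
theorem exists_eq_sub [FiniteDimensional ℝ W] (h : Realizes n 𝓕 v l)
    (hc : IsPseudomanifold d n 𝓕) (hd : 2 ≤ d) (hW : Module.finrank ℝ W = d + 1) {F : Finset ℕ}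
    (hF : F ∈ 𝓕) {p : W} (hp : 0 < l F p)
    (hG : ∀ i ∈ F, ∃ G, IsNeighbor 𝓕 F i G ∧ l G p < 0) {j : ℕ} (hj : j < n) (hjF : j ∉ F) :
    ∃ c : ℕ → ℝ, ∃ s : ℝ, (∀ i ∈ F, 0 < c i) ∧ 0 < s ∧ p = ∑ i ∈ F, c i • v i - s • v j := by
  have hlj := h.neg F hF j hj hjF
  set s := - l F p / l F (v j) with hs
  have hspos : 0 < s := div_pos_of_neg_of_neg (by linarith) hlj
  obtain ⟨c, hc0, hcx⟩ := h.exists_pos_coeff hc hd hW hF (x := p + s • v j)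
    (by rw [map_add, map_smul, smul_eq_mul, hs, div_mul_cancel₀ _ hlj.ne]; ring)
    (fun i hi => by
      obtain ⟨G, hG, hlt⟩ := hG i hi
      refine ⟨G, hG, ?_⟩
      have := h.nonpos hG.mem hj
      rw [map_add, map_smul, smul_eq_mul]
      nlinarith)
  exact ⟨c, s, hc0, hspos, by rw [← hcx]; abel⟩

/-- A point beyond `F` and beneath the neighbors of `F` is beneath all facets but `F`. -/
theorem beneath_of_neighbors [FiniteDimensional ℝ W] (h : Realizes n 𝓕 v l)
    (hc : IsPseudomanifold d n 𝓕) (hd : 2 ≤ d) (hW : Module.finrank ℝ W = d + 1) {F : Finset ℕ}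
    (hF : F ∈ 𝓕) {p : W} (hp : 0 < l F p)
    (hG : ∀ i ∈ F, ∃ G, IsNeighbor 𝓕 F i G ∧ l G p < 0) {H : Finset ℕ} (hH : H ∈ 𝓕)
    (hHF : H ≠ F) : l H p < 0 := by
  obtain ⟨j, hj, hjF⟩ := hc.exists_mem_notMem hF hH hHF
  obtain ⟨i, hi, hiH⟩ := hc.exists_mem_notMem hH hF hHF.symm
  obtain ⟨c, s, hc0, -, rfl⟩ := h.exists_eq_sub hc hd hW hF hp hG (hc.lt H hH j hj) hjF
  rw [map_sub, map_smul, h.zero H hH j hj, map_sum, smul_zero, sub_zero]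
  refine Finset.sum_neg' (fun k hk => ?_) ⟨i, hi, ?_⟩
  · rw [map_smul, smul_eq_mul]
    exact mul_nonpos_of_nonneg_of_nonpos (hc0 k hk).le (h.nonpos hH (hc.lt F hF k hk))
  · rw [map_smul, smul_eq_mul]
    exact mul_neg_of_pos_of_neg (hc0 i hi) (h.neg H hH i (hc.lt F hF i hi) hiH)

/-- Stacking a vertex `p` beyond the facet `F` and beneath its neighbors. -/
theorem stack [FiniteDimensional ℝ W] (h : Realizes n 𝓕 v l)
    (hc : IsPseudomanifold d n 𝓕) (hd : 2 ≤ d) (hW : Module.finrank ℝ W = d + 1) {F : Finset ℕ}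
    (hF : F ∈ 𝓕) {p : W} (hp : 0 < l F p)
    (hG : ∀ i ∈ F, ∃ G, IsNeighbor 𝓕 F i G ∧ l G p < 0) {l' : Finset ℕ → W →ₗ[ℝ] ℝ}
    (hold : ∀ H ∈ 𝓕, l' H = l H)
    (hnew : ∀ i ∈ F, ∃ G, IsNeighbor 𝓕 F i G ∧ ∃ a > (0 : ℝ), ∃ b > (0 : ℝ),
      l' (insert n (F.erase i)) = a • l F + b • l G ∧ l' (insert n (F.erase i)) p = 0) :
    Realizes (n + 1) (stackComplex n 𝓕 F) (Function.update v n p) l' := by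
  have hnF := hc.notMem hF
  have hlt : ∀ i < n, Function.update v n p i = v i := fun i hi => by simp [hi.ne]
  have hbeneath : ∀ H ∈ 𝓕, H ≠ F → l H p < 0 := fun H hH hHF =>
    h.beneath_of_neighbors hc hd hW hF hp hG hH hHF
  refine ⟨?_, ?_, ?_, ?_⟩
  · intro H hH j hj
    obtain ⟨-, hH⟩ | ⟨i, hi, rfl⟩ := mem_stackComplex.1 hH
    · rw [hold H hH, hlt j (hc.lt H hH j hj), h.zero H hH j hj]
    · obtain ⟨G, hG, a, -, b, -, h1, h2⟩ := hnew i hi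
      obtain rfl | hj := Finset.mem_insert.1 hj
      · simpa using h2
      · have hjF := Finset.mem_of_mem_erase hj
        rw [hlt j (hc.lt F hF j hjF), h1]
        simp [h.zero F hF j hjF, h.zero G hG.mem j (hG.subset hj)]
  · intro H hH' j hj hjH
    obtain ⟨hHF, hH⟩ | ⟨i, hi, rfl⟩ := mem_stackComplex.1 hH'
    · rw [hold H hH]
      obtain hj | rfl := Nat.lt_succ_iff_lt_or_eq.1 hj
      · rw [hlt j hj]; exact h.neg H hH j hj hjH
      · simpa using hbeneath H hH hHF
    · obtain ⟨G, hG, a, ha, b, hb, h1, h2⟩ := hnew i hi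
      obtain hj | rfl := Nat.lt_succ_iff_lt_or_eq.1 hj
      · rw [hlt j hj, h1]
        simp only [LinearMap.add_apply, LinearMap.smul_apply, smul_eq_mul]
        have hjF : j ∉ F.erase i := fun hm => hjH (Finset.mem_insert_of_mem hm)
        by_cases hji : j = i
        · subst hji
          have h3 := h.zero F hF j hi
          have h4 := h.neg G hG.mem j hj hG.notMem
          nlinarith
        · have h3 := h.neg F hF j hj (fun hm => hjF (Finset.mem_erase.2 ⟨hji, hm⟩))
          have h4 := h.nonpos hG.mem hj
          nlinarith
      · simp at hjH
  · intro H hH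
    obtain ⟨-, hH⟩ | ⟨i, hi, rfl⟩ := mem_stackComplex.1 hH
    · refine (linearIndepOn_congr fun j hj => ?_).1 (h.indep H hH)
      rw [hlt j (hc.lt H hH j hj)]
    · have hni : n ∉ ((F.erase i : Finset ℕ) : Set ℕ) := by simp [hnF]
      rw [Finset.coe_insert, linearIndepOn_insert hni]
      have hE : Function.update v n p '' ((F.erase i : Finset ℕ) : Set ℕ)
          = v '' ((F.erase i : Finset ℕ) : Set ℕ) := by
        apply Set.image_congr
        intro j hj
        exact hlt j (hc.lt F hF j (Finset.mem_of_mem_erase hj))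
      refine ⟨?_, ?_⟩
      · refine (linearIndepOn_congr fun j hj => ?_).1
          ((h.indep F hF).mono (Finset.coe_subset.2 (Finset.erase_subset i F)))
        rw [hlt j (hc.lt F hF j (Finset.mem_of_mem_erase hj))]
      · rw [hE, Function.update_self]
        intro hmem
        have : Submodule.span ℝ (v '' ((F.erase i : Finset ℕ) : Set ℕ)) ≤ LinearMap.ker (l F) := by
          rw [Submodule.span_le]
          rintro _ ⟨j, hj, rfl⟩
          exact h.zero F hF j (Finset.mem_of_mem_erase hj)
        exact hp.ne' (this hmem)
  · intro m hm hne
    have hm' : ∀ i < n, m (v i) ≤ 0 := fun i hi => hlt i hi ▸ hm i (hi.trans (Nat.lt_succ_self n))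
    have hmp : m p ≤ 0 := by simpa using hm n (Nat.lt_succ_self n)
    obtain ⟨j, hj, hjF⟩ := exists_notMem hc hd hF
    -- `m` does not vanish on all vertices of `F`
    have hF0 : ∃ i ∈ F, m (v i) ≠ 0 := by
      by_contra! hcon
      have hmul := h.eq_smul hc hd hW hF hcon hj hjF
      have hlj := h.neg F hF j hj hjF
      have h0 : m (v j) / l F (v j) = 0 := by
        have h1 : 0 ≤ m (v j) / l F (v j) := div_nonneg_of_nonpos (hm' j hj) hlj.le
        have h2 := hmul p
        by_contra hne
        have : 0 < m (v j) / l F (v j) := lt_of_le_of_ne h1 (Ne.symm hne)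
        nlinarith
      obtain ⟨i, hi, hne⟩ := hne
      apply hne
      rw [hmul, h0, zero_mul]
    by_cases hp0 : m p = 0
    · have key : ∀ k < n, m (v k) = 0 → k ∈ F := by
        intro k hk hk0
        by_contra hkF
        obtain ⟨c, s, hc0, -, hps⟩ := h.exists_eq_sub hc hd hW hF hp hG hk hkF
        obtain ⟨i, hi, hmi⟩ := hF0
        have hlt : m (∑ i ∈ F, c i • v i) < 0 := by
          rw [map_sum]
          refine Finset.sum_neg' (fun k hk => ?_) ⟨i, hi, ?_⟩
          · rw [map_smul, smul_eq_mul]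
            exact mul_nonpos_of_nonneg_of_nonpos (hc0 k hk).le (hm' k (hc.lt F hF k hk))
          · rw [map_smul, smul_eq_mul]
            exact mul_neg_of_pos_of_neg (hc0 i hi)
              (lt_of_le_of_ne (hm' i (hc.lt F hF i hi)) hmi)
        rw [hps, map_sub, map_smul, hk0, smul_zero, sub_zero] at hp0
        exact hlt.ne hp0
      obtain ⟨i, hi, hmi⟩ := hF0
      refine ⟨_, mem_stackComplex.2 (.inr ⟨i, hi, rfl⟩), fun k hk hk0 => ?_⟩
      obtain hk | rfl := Nat.lt_succ_iff_lt_or_eq.1 hk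
      · rw [hlt k hk] at hk0
        refine Finset.mem_insert_of_mem (Finset.mem_erase.2 ⟨?_, key k hk hk0⟩)
        rintro rfl
        exact hmi hk0
      · exact Finset.mem_insert_self _ _
    · obtain ⟨i, hi, hmi⟩ := hF0
      obtain ⟨G, hG, hsub⟩ := h.complete m hm' ⟨i, hc.lt F hF i hi, hmi⟩
      have hnot : ∀ k < n + 1, m (Function.update v n p k) = 0 → k < n := by
        intro k hk hk0
        refine (Nat.lt_succ_iff_lt_or_eq.1 hk).resolve_right ?_
        rintro rfl
        exact hp0 (by simpa using hk0)
      by_cases hGF : G = F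
      · subst hGF
        refine ⟨_, mem_stackComplex.2 (.inr ⟨i, hi, rfl⟩), fun k hk hk0 => ?_⟩
        have hkn := hnot k hk hk0
        rw [hlt k hkn] at hk0
        refine Finset.mem_insert_of_mem (Finset.mem_erase.2 ⟨?_, hsub k hkn hk0⟩)
        rintro rfl
        exact hmi hk0
      · refine ⟨G, mem_stackComplex.2 (.inl ⟨hGF, hG⟩), fun k hk hk0 => ?_⟩
        have hkn := hnot k hk hk0
        rw [hlt k hkn] at hk0
        exact hsub k hkn hk0

/-- Linearly independent vectors span a simplicial cone. -/
theorem simplex {v : ℕ → W} {l : Finset ℕ → W →ₗ[ℝ] ℝ}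
    (hzero : ∀ j ≤ d, ∀ i ≤ d, i ≠ j → l ((Finset.range (d + 1)).erase j) (v i) = 0)
    (hneg : ∀ j ≤ d, l ((Finset.range (d + 1)).erase j) (v j) < 0) :
    Realizes (d + 1) ((Finset.range (d + 1)).image (Finset.range (d + 1)).erase) v l := by
  have hind : LinearIndepOn ℝ v (Finset.range (d + 1) : Set ℕ) := by
    rw [linearIndepOn_finset_iff]
    intro c hc i hi
    have h1 : l ((Finset.range (d + 1)).erase i) (∑ k ∈ Finset.range (d + 1), c k • v k) = 0 := by
      rw [hc, map_zero]
    rw [map_sum, Finset.sum_eq_single_of_mem i hi, map_smul, smul_eq_mul] at h1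
    · exact (mul_eq_zero.1 h1).resolve_right (hneg i (Nat.lt_succ_iff.1 (Finset.mem_range.1 hi))).ne
    · intro k hk hki
      rw [map_smul, hzero i (Nat.lt_succ_iff.1 (Finset.mem_range.1 hi)) k
        (Nat.lt_succ_iff.1 (Finset.mem_range.1 hk)) hki, smul_zero]
  refine ⟨?_, ?_, ?_, ?_⟩
  · simp only [Finset.mem_image]
    rintro F ⟨j, hj, rfl⟩ i hi
    rw [Finset.mem_range, Nat.lt_succ_iff] at hj
    obtain ⟨hij, hi⟩ := Finset.mem_erase.1 hi
    rw [Finset.mem_range, Nat.lt_succ_iff] at hi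
    exact hzero j hj i hi hij
  · simp only [Finset.mem_image]
    rintro F ⟨j, hj, rfl⟩ i hi hiF
    have : i = j := by
      by_contra hne
      exact hiF (Finset.mem_erase.2 ⟨hne, Finset.mem_range.2 hi⟩)
    subst this
    exact hneg i (Nat.lt_succ_iff.1 hi)
  · simp only [Finset.mem_image]
    rintro F ⟨j, hj, rfl⟩
    exact hind.mono (Finset.coe_subset.2 (Finset.erase_subset _ _))
  · rintro m - ⟨i, hi, hmi⟩
    refine ⟨_, Finset.mem_image_of_mem _ (Finset.mem_range.2 hi), fun k hk hk0 => ?_⟩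
    refine Finset.mem_erase.2 ⟨?_, Finset.mem_range.2 hk⟩
    rintro rfl
    exact hmi hk0

theorem exists_simplex {v : ℕ → W} (h : LinearIndepOn ℝ v (Finset.range (d + 1) : Set ℕ)) :
    ∃ l : Finset ℕ → W →ₗ[ℝ] ℝ,
      Realizes (d + 1) ((Finset.range (d + 1)).image (Finset.range (d + 1)).erase) v l := by
  choose m hm using fun j : ℕ => h.exists_functional fun i => if i = j then -1 else 0
  have hj : ∀ j ≤ d, (Finset.range (d + 1) \ (Finset.range (d + 1)).erase j).sup id = j := by
    intro j hj
    rw [Finset.sdiff_erase_self (Finset.mem_range.2 (Nat.lt_succ_of_le hj))]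
    simp
  refine ⟨fun F => m ((Finset.range (d + 1) \ F).sup id), simplex ?_ ?_⟩
  · intro j hjd i hid hij
    rw [hj j hjd, hm j i (Finset.mem_range.2 (Nat.lt_succ_of_le hid)), if_neg hij]
  · intro j hjd
    rw [hj j hjd, hm j j (Finset.mem_range.2 (Nat.lt_succ_of_le hjd)), if_pos rfl]
    norm_num

/-- Stacking a vertex, with unspecified functionals for the new facets. -/
theorem exists_stack [FiniteDimensional ℝ W] (h : Realizes n 𝓕 v l)
    (hc : IsPseudomanifold d n 𝓕) (hd : 2 ≤ d) (hW : Module.finrank ℝ W = d + 1) {F : Finset ℕ}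
    (hF : F ∈ 𝓕) {p : W} (hp : 0 < l F p)
    (hG : ∀ i ∈ F, ∃ G, IsNeighbor 𝓕 F i G ∧ l G p < 0) :
    ∃ l' : Finset ℕ → W →ₗ[ℝ] ℝ,
      Realizes (n + 1) (stackComplex n 𝓕 F) (Function.update v n p) l' := by
  choose! G hG hlt using hG
  refine ⟨stackExtend n F l fun i => (- l (G i) p) • l F + l F p • l (G i),
    h.stack hc hd hW hF hp (fun i hi => ⟨G i, hG i hi, hlt i hi⟩)
      (fun H hH => stackExtend_old (hc.notMem hH)) fun i hi => ⟨G i, hG i hi, - l (G i) p,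
        by have := hlt i hi; linarith, l F p, hp, stackExtend_new (hc.notMem hF) hi, ?_⟩⟩
  rw [stackExtend_new (hc.notMem hF) hi]
  simp only [LinearMap.add_apply, LinearMap.smul_apply, smul_eq_mul]
  ring

/-- Every set of vertices of a facet is the zero set of a functional that is nonpositive on all
vertices. -/
theorem exists_functional [FiniteDimensional ℝ W] (h : Realizes n 𝓕 v l) {F S : Finset ℕ}
    (hF : F ∈ 𝓕) (hS : S ⊆ F) :
    ∃ m : W →ₗ[ℝ] ℝ, (∀ i ∈ S, m (v i) = 0) ∧ ∀ i < n, i ∉ S → m (v i) < 0 := by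
  obtain ⟨m₀, hm₀⟩ := (h.indep F hF).exists_functional fun i => if i ∈ S then 0 else -1
  -- a large multiple of `l F` dominates `m₀` on the vertices outside `F`
  obtain ⟨M, hM⟩ : ∃ M : ℝ, ∀ i < n, i ∉ F → m₀ (v i) + M * l F (v i) < 0 := by
    have hev : ∀ i ∈ Finset.range n, ∀ᶠ M : ℝ in Filter.atTop,
        i ∉ F → m₀ (v i) + M * l F (v i) < 0 := by
      intro i hi
      by_cases hiF : i ∈ F
      · exact .of_forall fun M hM => absurd hiF hM
      · have hlt := h.neg F hF i (Finset.mem_range.1 hi) hiF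
        filter_upwards [Filter.eventually_gt_atTop (m₀ (v i) / (- l F (v i)))] with M hM _
        rw [div_lt_iff₀ (by linarith)] at hM
        linarith
    obtain ⟨M, hM⟩ := ((Finset.range n).eventually_all.2 hev).exists
    exact ⟨M, fun i hi => hM i (Finset.mem_range.2 hi)⟩
  refine ⟨m₀ + M • l F, fun i hi => ?_, fun i hi hiS => ?_⟩
  · simp [hm₀ i (hS hi), hi, h.zero F hF i (hS hi)]
  · by_cases hiF : i ∈ F
    · simp [hm₀ i hiF, hiS, h.zero F hF i hiF]
    · simpa using hM i hi hiF

end Realizes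

/-! ### Face lattices of realizations -/

/-- The vertex sets of the faces of a polytope with vertices `0, …, n - 1` and facets `𝓕`, all of
whose facets are simplices. -/
def IsFaceSet (n : ℕ) (𝓕 : Finset (Finset ℕ)) (S : Finset ℕ) : Prop :=
  S = Finset.range n ∨ ∃ F ∈ 𝓕, S ⊆ F

section Hulls

variable {W : Type*} [AddCommGroup W] [Module ℝ W]

theorem mem_hull_image_iff {v : ℕ → W} {S : Finset ℕ} {x : W} :
    x ∈ PointedCone.hull ℝ (v '' (S : Set ℕ)) ↔
      ∃ c : ℕ → ℝ, (∀ i ∈ S, 0 ≤ c i) ∧ x = ∑ i ∈ S, c i • v i := by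
  rw [PointedCone.hull, Submodule.mem_span_image_finset_iff_exists_fun']
  constructor
  · rintro ⟨c, rfl⟩
    exact ⟨fun i => c i, fun i _ => (c i).2, rfl⟩
  · rintro ⟨c, hc, rfl⟩
    refine ⟨fun i => ⟨max (c i) 0, le_max_right _ _⟩, Finset.sum_congr rfl fun i hi => ?_⟩
    rw [Nonneg.mk_smul, max_eq_left (hc i hi)]

theorem mem_convexHull_image_iff {v : ℕ → W} {S : Finset ℕ} {x : W} :
    x ∈ convexHull ℝ (v '' (S : Set ℕ)) ↔
      ∃ c : ℕ → ℝ, (∀ i ∈ S, 0 ≤ c i) ∧ ∑ i ∈ S, c i = 1 ∧ x = ∑ i ∈ S, c i • v i := by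
  constructor
  · intro hx
    let C : Set W := {x | ∃ c : ℕ → ℝ, (∀ i ∈ S, 0 ≤ c i) ∧ ∑ i ∈ S, c i = 1 ∧
      x = ∑ i ∈ S, c i • v i}
    have hC : Convex ℝ C := by
      rintro _ ⟨c, hc, hc1, rfl⟩ _ ⟨c', hc', hc1', rfl⟩ a b ha hb hab
      refine ⟨fun i => a * c i + b * c' i, fun i hi => ?_, ?_, ?_⟩
      · have := hc i hi
        have := hc' i hi
        positivity
      · rw [Finset.sum_add_distrib, ← Finset.mul_sum, ← Finset.mul_sum, hc1, hc1']
        linarith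
      · simp only [add_smul, mul_smul, Finset.sum_add_distrib, Finset.smul_sum]
    refine convexHull_min (t := C) ?_ hC hx
    rintro _ ⟨j, hj, rfl⟩
    refine ⟨fun i => if i = j then 1 else 0, fun i _ => ?_, ?_, ?_⟩
    · positivity
    · simpa using hj
    · have hj' : j ∈ S := hj
      simp [hj']
  · rintro ⟨c, hc, hc1, rfl⟩
    exact (convex_convexHull ℝ _).sum_mem hc hc1
      fun i hi => subset_convexHull ℝ _ ⟨i, hi, rfl⟩

/-- The vanishing of a functional that is nonpositive on some vectors, on a nonnegative combination
of these vectors, forces the coefficients outside of its zero set to vanish. -/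
theorem coeff_eq_zero {v : ℕ → W} {R : Finset ℕ} {m : W →ₗ[ℝ] ℝ} (hm : ∀ i ∈ R, m (v i) ≤ 0)
    {c : ℕ → ℝ} (hc : ∀ i ∈ R, 0 ≤ c i) (h0 : m (∑ i ∈ R, c i • v i) = 0) {i : ℕ} (hi : i ∈ R)
    (hne : m (v i) ≠ 0) : c i = 0 := by
  rw [map_sum] at h0
  have := (Finset.sum_eq_zero_iff_of_nonpos (fun i hi => by
    rw [map_smul, smul_eq_mul]
    exact mul_nonpos_of_nonneg_of_nonpos (hc i hi) (hm i hi))).1 h0 i hi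
  rw [map_smul, smul_eq_mul] at this
  exact (mul_eq_zero.1 this).resolve_right hne

theorem hull_inter_ker {v : ℕ → W} {R S : Finset ℕ} (hS : S ⊆ R) {m : W →ₗ[ℝ] ℝ}
    (hm : ∀ i ∈ S, m (v i) = 0) (hm' : ∀ i ∈ R, i ∉ S → m (v i) < 0) :
    {x | x ∈ PointedCone.hull ℝ (v '' (R : Set ℕ)) ∧ m x = 0} =
      (PointedCone.hull ℝ (v '' (S : Set ℕ)) : Set W) := by
  have hle : ∀ i ∈ R, m (v i) ≤ 0 := fun i hi => by
    by_cases hiS : i ∈ S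
    · exact (hm i hiS).le
    · exact (hm' i hi hiS).le
  ext x
  rw [SetLike.mem_coe, mem_hull_image_iff, Set.mem_ofPred_eq, mem_hull_image_iff]
  constructor
  · rintro ⟨⟨c, hc, rfl⟩, h0⟩
    refine ⟨c, fun i hi => hc i (hS hi), ?_⟩
    symm
    refine Finset.sum_subset hS fun i hi hiS => ?_
    rw [coeff_eq_zero hle hc h0 hi (hm' i hi hiS).ne, zero_smul]
  · rintro ⟨c, hc, rfl⟩
    refine ⟨⟨fun i => if i ∈ S then c i else 0, fun i _ => ?_, ?_⟩, ?_⟩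
    · dsimp only
      split_ifs with h
      · exact hc i h
      · exact le_rfl
    · rw [← Finset.sum_subset hS]
      · exact Finset.sum_congr rfl fun i hi => by simp [hi]
      · intro i _ hi; simp [hi]
    · rw [map_sum]
      exact Finset.sum_eq_zero fun i hi => by rw [map_smul, hm i hi, smul_zero]

theorem convexHull_inter {V : Type*} [AddCommGroup V] [Module ℝ V] {w : ℕ → V} {R S : Finset ℕ}
    (hS : S ⊆ R) {m : V × ℝ →ₗ[ℝ] ℝ}
    (hm : ∀ i ∈ S, m (w i, 1) = 0) (hm' : ∀ i ∈ R, i ∉ S → m (w i, 1) < 0) :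
    {x | x ∈ convexHull ℝ (w '' (R : Set ℕ)) ∧ m (x, 1) = 0} =
      convexHull ℝ (w '' (S : Set ℕ)) := by
  have hle : ∀ i ∈ R, m (w i, 1) ≤ 0 := fun i hi => by
    by_cases hiS : i ∈ S
    · exact (hm i hiS).le
    · exact (hm' i hi hiS).le
  have hlift : ∀ T : Finset ℕ, ∀ c : ℕ → ℝ, ∑ i ∈ T, c i = 1 →
      ((∑ i ∈ T, c i • w i, (1 : ℝ)) : V × ℝ) = ∑ i ∈ T, c i • (w i, (1 : ℝ)) := by
    intro T c hc
    ext
    · simp [Prod.fst_sum]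
    · simp [Prod.snd_sum, hc]
  ext x
  rw [mem_convexHull_image_iff, Set.mem_ofPred_eq, mem_convexHull_image_iff]
  constructor
  · rintro ⟨⟨c, hc, hc1, rfl⟩, h0⟩
    rw [hlift _ _ hc1] at h0
    have hz : ∀ i ∈ R, i ∉ S → c i = 0 := fun i hi hiS =>
      coeff_eq_zero (v := fun i => (w i, (1 : ℝ))) hle hc h0 hi (hm' i hi hiS).ne
    refine ⟨c, fun i hi => hc i (hS hi), ?_, ?_⟩
    · rw [← hc1]
      exact Finset.sum_subset hS fun i hi hiS => hz i hi hiS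
    · symm
      exact Finset.sum_subset hS fun i hi hiS => by rw [hz i hi hiS, zero_smul]
  · rintro ⟨c, hc, hc1, rfl⟩
    refine ⟨⟨fun i => if i ∈ S then c i else 0, fun i _ => ?_, ?_, ?_⟩, ?_⟩
    · dsimp only
      split_ifs with h
      · exact hc i h
      · exact le_rfl
    · rw [← Finset.sum_subset hS, ← hc1]
      · exact Finset.sum_congr rfl fun i hi => by simp [hi]
      · intro i _ hi; simp [hi]
    · rw [← Finset.sum_subset hS]
      · exact Finset.sum_congr rfl fun i hi => by simp [hi]
      · intro i _ hi; simp [hi]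
    · rw [hlift _ _ hc1, map_sum]
      exact Finset.sum_eq_zero fun i hi => by rw [map_smul, hm i hi, smul_zero]

end Hulls

namespace Realizes

variable {W : Type*} [AddCommGroup W] [Module ℝ W] {d n : ℕ} {𝓕 : Finset (Finset ℕ)}
  {v : ℕ → W} {l : Finset ℕ → W →ₗ[ℝ] ℝ}

theorem exists_functional_of_isFaceSet [FiniteDimensional ℝ W] (h : Realizes n 𝓕 v l)
    {S : Finset ℕ} (hS : IsFaceSet n 𝓕 S) :
    ∃ m : W →ₗ[ℝ] ℝ, (∀ i ∈ S, m (v i) = 0) ∧ ∀ i < n, i ∉ S → m (v i) < 0 := by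
  obtain rfl | ⟨F, hF, hSF⟩ := hS
  · exact ⟨0, by simp, fun i hi hi' => absurd (Finset.mem_range.2 hi) hi'⟩
  · exact h.exists_functional hF hSF

theorem isFaceSet_zeros (h : Realizes n 𝓕 v l) {m : W →ₗ[ℝ] ℝ} (hm : ∀ i < n, m (v i) ≤ 0) :
    IsFaceSet n 𝓕 ({i ∈ Finset.range n | m (v i) = 0}) := by
  by_cases hz : ∃ i < n, m (v i) ≠ 0
  · obtain ⟨F, hF, hsub⟩ := h.complete m hm hz
    refine .inr ⟨F, hF, fun i hi => ?_⟩
    rw [Finset.mem_filter, Finset.mem_range] at hi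
    exact hsub i hi.1 hi.2
  · push Not at hz
    refine .inl (Finset.filter_true_of_mem fun i hi => hz i (Finset.mem_range.1 hi))

end Realizes

theorem IsFaceSet.subset_range {d n : ℕ} {𝓕 : Finset (Finset ℕ)} (hc : IsPseudomanifold d n 𝓕)
    {S : Finset ℕ} (hS : IsFaceSet n 𝓕 S) : S ⊆ Finset.range n := by
  obtain rfl | ⟨F, hF, hSF⟩ := hS
  · exact subset_rfl
  · exact fun i hi => Finset.mem_range.2 (hc.lt F hF i (hSF hi))

section Cone

variable {d e n : ℕ} {𝓕 : Finset (Finset ℕ)} {v : ℕ → E (e + 1)}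
  {l : Finset ℕ → E (e + 1) →ₗ[ℝ] ℝ}

theorem Realizes.hull_mem_coneFaces (h : Realizes n 𝓕 v l) (hc : IsPseudomanifold d n 𝓕)
    {S : Finset ℕ} (hS : IsFaceSet n 𝓕 S) :
    (PointedCone.hull ℝ (v '' (S : Set ℕ)) : Set (E (e + 1))) ∈
      coneFaces (PointedCone.hull ℝ (v '' (Finset.range n : Set ℕ))) := by
  obtain ⟨m, hm, hm'⟩ := h.exists_functional_of_isFaceSet hS
  refine ⟨LinearMap.toContinuousLinearMap m, ?_, ?_⟩
  · intro x hx
    obtain ⟨c, hc0, rfl⟩ := mem_hull_image_iff.1 hx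
    rw [LinearMap.coe_toContinuousLinearMap', map_sum]
    refine Finset.sum_nonpos fun i hi => ?_
    rw [map_smul, smul_eq_mul]
    refine mul_nonpos_of_nonneg_of_nonpos (hc0 i hi) ?_
    by_cases hiS : i ∈ S
    · exact (hm i hiS).le
    · exact (hm' i (Finset.mem_range.1 hi) hiS).le
  · rw [← hull_inter_ker (hS.subset_range hc) hm fun i hi => hm' i (Finset.mem_range.1 hi)]
    rfl

theorem Realizes.exists_eq_hull (h : Realizes n 𝓕 v l) {F : Set (E (e + 1))}
    (hF : F ∈ coneFaces (PointedCone.hull ℝ (v '' (Finset.range n : Set ℕ)))) :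
    ∃ S, IsFaceSet n 𝓕 S ∧ F = (PointedCone.hull ℝ (v '' (S : Set ℕ)) : Set (E (e + 1))) := by
  obtain ⟨m, hm, rfl⟩ := hF
  have hle : ∀ i < n, (m : E (e + 1) →ₗ[ℝ] ℝ) (v i) ≤ 0 := fun i hi =>
    hm _ (PointedCone.subset_hull ⟨i, Finset.mem_coe.2 (Finset.mem_range.2 hi), rfl⟩)
  refine ⟨_, h.isFaceSet_zeros hle, ?_⟩
  rw [← hull_inter_ker (m := (m : E (e + 1) →ₗ[ℝ] ℝ)) (Finset.filter_subset _ _)]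
  · rfl
  · intro i hi
    exact (Finset.mem_filter.1 hi).2
  · intro i hi hi'
    refine lt_of_le_of_ne (hle i (Finset.mem_range.1 hi)) fun h0 => hi' ?_
    exact Finset.mem_filter.2 ⟨hi, h0⟩

/-- The face lattice of a realization as a cone. -/
theorem Realizes.nonempty_coneFaces_iso (h : Realizes n 𝓕 v l) (hc : IsPseudomanifold d n 𝓕) :
    Nonempty ({S // IsFaceSet n 𝓕 S} ≃o
      coneFaces (PointedCone.hull ℝ (v '' (Finset.range n : Set ℕ)))) := by
  refine ⟨RelIso.ofSurjective (OrderEmbedding.ofMapLEIff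
    (fun S => ⟨_, h.hull_mem_coneFaces hc S.2⟩) ?_) ?_⟩
  · rintro ⟨S, hS⟩ ⟨T, hT⟩
    simp only [Subtype.mk_le_mk]
    constructor
    · intro hsub i hi
      obtain ⟨m, hm, hm'⟩ := h.exists_functional_of_isFaceSet hT
      have hmem : v i ∈ (PointedCone.hull ℝ (v '' (T : Set ℕ)) : Set (E (e + 1))) :=
        hsub (PointedCone.subset_hull ⟨i, hi, rfl⟩)
      obtain ⟨c, hc0, hv⟩ := mem_hull_image_iff.1 hmem
      by_contra hiT
      have h1 := hm' i (Finset.mem_range.1 (hS.subset_range hc hi)) hiT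
      rw [hv, map_sum, Finset.sum_eq_zero] at h1
      · exact lt_irrefl _ h1
      · intro k hk; rw [map_smul, hm k hk, smul_zero]
    · intro hST
      exact Submodule.span_mono (Set.image_mono (Finset.coe_subset.2 hST))
  · rintro ⟨F, hF⟩
    obtain ⟨S, hS, rfl⟩ := h.exists_eq_hull hF
    exact ⟨⟨S, hS⟩, rfl⟩

end Cone

section Polytope

variable {d n : ℕ} {𝓕 : Finset (Finset ℕ)} {w : ℕ → E d}
  {l : Finset ℕ → E d × ℝ →ₗ[ℝ] ℝ}

theorem Realizes.convexHull_mem_polytopeFaces (h : Realizes n 𝓕 (fun i => (w i, (1 : ℝ))) l)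
    (hc : IsPseudomanifold d n 𝓕) {S : Finset ℕ} (hS : IsFaceSet n 𝓕 S) :
    convexHull ℝ (w '' (S : Set ℕ)) ∈
      polytopeFaces (convexHull ℝ (w '' (Finset.range n : Set ℕ))) := by
  rintro ⟨x₀, hx₀⟩
  obtain ⟨m, hm, hm'⟩ := h.exists_functional_of_isFaceSet hS
  have hR : ∀ i ∈ Finset.range n, i ∉ S → m (w i, 1) < 0 := fun i hi => hm' i (Finset.mem_range.1 hi)
  have hface := convexHull_inter (hS.subset_range hc) hm hR
  have hsplit : ∀ x, m (x, 1) = m (x, 0) + m (0, 1) := fun x => by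
    rw [← map_add]; simp
  have hle : ∀ y ∈ convexHull ℝ (w '' (Finset.range n : Set ℕ)), m (y, 1) ≤ 0 := by
    have hconv : Convex ℝ {y : E d | m (y, 1) ≤ 0} := by
      have : {y : E d | m (y, 1) ≤ 0} = {y : E d | (m ∘ₗ LinearMap.inl ℝ (E d) ℝ) y ≤ - m (0, 1)} := by
        ext y
        simp only [Set.mem_ofPred_eq, hsplit y, LinearMap.comp_apply, LinearMap.inl_apply]
        constructor <;> intro h <;> linarith
      rw [this]
      exact convex_halfSpace_le (m ∘ₗ LinearMap.inl ℝ (E d) ℝ).isLinear _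
    refine convexHull_min ?_ hconv
    rintro _ ⟨i, hi, rfl⟩
    by_cases hiS : i ∈ S
    · exact (hm i hiS).le
    · exact (hR i hi hiS).le
  refine ⟨LinearMap.toContinuousLinearMap (m ∘ₗ LinearMap.inl ℝ (E d) ℝ), ?_⟩
  rw [← hface] at hx₀ ⊢
  ext x
  simp only [Set.mem_ofPred_eq, LinearMap.coe_toContinuousLinearMap', LinearMap.comp_apply,
    LinearMap.inl_apply]
  refine and_congr_right fun hx => ⟨fun h0 y hy => ?_, fun hmax => ?_⟩
  · have := hle y hy
    rw [hsplit] at this h0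
    linarith
  · have h1 := hmax x₀ hx₀.1
    have h2 := hx₀.2
    have h3 := hle x hx
    rw [hsplit] at h2 h3 ⊢
    linarith

/-- The set where a functional attains its maximum on a polytope is spanned by vertices. -/
theorem Realizes.exists_eq_convexHull_of_functional
    (h : Realizes n 𝓕 (fun i => (w i, (1 : ℝ))) l) (f : E d →ₗ[ℝ] ℝ) (c : ℝ)
    (hle : ∀ x ∈ convexHull ℝ (w '' (Finset.range n : Set ℕ)), f x ≤ c) :
    ∃ S, IsFaceSet n 𝓕 S ∧ S = {i ∈ Finset.range n | f (w i) = c} ∧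
      {x ∈ convexHull ℝ (w '' (Finset.range n : Set ℕ)) | f x = c} =
        convexHull ℝ (w '' (S : Set ℕ)) := by
  let m : E d × ℝ →ₗ[ℝ] ℝ := f ∘ₗ LinearMap.fst ℝ (E d) ℝ - c • LinearMap.snd ℝ (E d) ℝ
  have hm : ∀ x, m (x, 1) = f x - c := fun x => by simp [m]
  have hle' : ∀ i < n, m (w i, 1) ≤ 0 := fun i hi => by
    rw [hm, sub_nonpos]
    exact hle _ (subset_convexHull ℝ _ ⟨i, Finset.mem_coe.2 (Finset.mem_range.2 hi), rfl⟩)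
  have hS := h.isFaceSet_zeros hle'
  simp only [hm, sub_eq_zero] at hS
  refine ⟨_, hS, rfl, ?_⟩
  rw [← convexHull_inter (m := m) (Finset.filter_subset _ _)]
  · simp only [hm, sub_eq_zero]
  · intro i hi
    rw [hm, (Finset.mem_filter.1 hi).2, sub_self]
  · intro i hi hi'
    refine lt_of_le_of_ne (hle' i (Finset.mem_range.1 hi)) fun h0 => hi' ?_
    rw [hm, sub_eq_zero] at h0
    exact Finset.mem_filter.2 ⟨hi, h0⟩

theorem Realizes.exists_eq_convexHull (h : Realizes n 𝓕 (fun i => (w i, (1 : ℝ))) l)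
    (hc : IsPseudomanifold d n 𝓕) {F : Set (E d)}
    (hF : F ∈ polytopeFaces (convexHull ℝ (w '' (Finset.range n : Set ℕ)))) :
    ∃ S, IsFaceSet n 𝓕 S ∧ F = convexHull ℝ (w '' (S : Set ℕ)) := by
  rcases F.eq_empty_or_nonempty with rfl | hne
  · obtain ⟨G, hG⟩ := hc.nonempty
    exact ⟨∅, .inr ⟨G, hG, Finset.empty_subset _⟩, by simp⟩
  · obtain ⟨f, rfl⟩ := hF hne
    obtain ⟨x₀, hx₀, hmax⟩ := hne
    obtain ⟨S, hS, -, hSF⟩ := h.exists_eq_convexHull_of_functional (f : E d →ₗ[ℝ] ℝ) (f x₀) hmax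
    refine ⟨S, hS, ?_⟩
    rw [← hSF]
    ext x
    simp only [Set.mem_ofPred_eq, ContinuousLinearMap.coe_coe]
    refine and_congr_right fun hx => ⟨fun h1 => ?_, fun h1 y hy => ?_⟩
    · exact le_antisymm (hmax x hx) (h1 x₀ hx₀)
    · rw [h1]; exact hmax y hy

theorem Realizes.subset_of_convexHull_subset (h : Realizes n 𝓕 (fun i => (w i, (1 : ℝ))) l)
    (hc : IsPseudomanifold d n 𝓕) {S T : Finset ℕ} (hS : IsFaceSet n 𝓕 S) (hT : IsFaceSet n 𝓕 T)
    (hsub : convexHull ℝ (w '' (S : Set ℕ)) ⊆ convexHull ℝ (w '' (T : Set ℕ))) : S ⊆ T := by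
  intro i hi
  obtain ⟨m, hm, hm'⟩ := h.exists_functional_of_isFaceSet hT
  have hmem := hsub (subset_convexHull ℝ _ ⟨i, hi, rfl⟩)
  rw [← convexHull_inter (hT.subset_range hc) hm fun i hi => hm' i (Finset.mem_range.1 hi)] at hmem
  by_contra hiT
  exact (hm' i (Finset.mem_range.1 (hS.subset_range hc hi)) hiT).ne hmem.2

/-- The face lattice of a realization as a polytope. -/
theorem Realizes.nonempty_polytopeFaces_iso (h : Realizes n 𝓕 (fun i => (w i, (1 : ℝ))) l)
    (hc : IsPseudomanifold d n 𝓕) :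
    Nonempty ({S // IsFaceSet n 𝓕 S} ≃o
      polytopeFaces (convexHull ℝ (w '' (Finset.range n : Set ℕ)))) := by
  refine ⟨RelIso.ofSurjective (OrderEmbedding.ofMapLEIff
    (fun S => ⟨_, h.convexHull_mem_polytopeFaces hc S.2⟩) ?_) ?_⟩
  · rintro ⟨S, hS⟩ ⟨T, hT⟩
    simp only [Subtype.mk_le_mk]
    constructor
    · exact h.subset_of_convexHull_subset hc hS hT
    · intro hST
      exact convexHull_mono (Set.image_mono (Finset.coe_subset.2 hST))
  · rintro ⟨F, hF⟩
    obtain ⟨S, hS, rfl⟩ := h.exists_eq_convexHull hc hF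
    exact ⟨⟨S, hS⟩, rfl⟩

end Polytope

/-! ### Stacked polytopes and stacked complexes -/

section

variable {d n : ℕ} {𝓕 : Finset (Finset ℕ)} {w : ℕ → E d}
  {l : Finset ℕ → E d × ℝ →ₗ[ℝ] ℝ}

theorem finrank_prod_real (d : ℕ) : Module.finrank ℝ (E d × ℝ) = d + 1 := by
  simp [Module.finrank_prod]

theorem affineIndependent_of_linearIndepOn {T : Finset ℕ}
    (h : LinearIndepOn ℝ (fun i => (w i, (1 : ℝ))) (T : Set ℕ)) :
    AffineIndependent ℝ (fun i : T => w i) := by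
  rw [affineIndependent_iff]
  intro s c hc hc' i hi
  have h' : LinearIndependent ℝ (fun i : T => (w i, (1 : ℝ))) := h
  rw [linearIndependent_iff'] at h'
  refine h' s c ?_ i hi
  ext
  · simp [Prod.fst_sum, hc']
  · simp [Prod.snd_sum, hc]

theorem vectorSpan_convexHull (s : Set (E d)) :
    vectorSpan ℝ (convexHull ℝ s) = vectorSpan ℝ s := by
  rw [← direction_affineSpan, affineSpan_convexHull, direction_affineSpan]

theorem finrank_vectorSpan_convexHull {T : Finset ℕ}
    (h : LinearIndepOn ℝ (fun i => (w i, (1 : ℝ))) (T : Set ℕ)) (hT : T.Nonempty) :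
    Module.finrank ℝ (vectorSpan ℝ (convexHull ℝ (w '' (T : Set ℕ)))) + 1 = T.card := by
  have h1 := Finset.card_pos.2 hT
  have := (affineIndependent_of_linearIndepOn h).finrank_vectorSpan (n := T.card - 1)
    (by rw [Fintype.card_coe]; omega)
  rw [vectorSpan_convexHull, Set.image_eq_range]
  have h2 : Module.finrank ℝ (vectorSpan ℝ (Set.range fun x : (T : Set ℕ) => w x)) = T.card - 1 :=
    this
  omega

theorem Realizes.isFacet_iff (h : Realizes n 𝓕 (fun i => (w i, (1 : ℝ))) l)
    (hc : IsPseudomanifold d n 𝓕) (hd : 2 ≤ d) {G : Set (E d)} :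
    IsFacet (convexHull ℝ (w '' (Finset.range n : Set ℕ))) G ↔
      ∃ G₀ ∈ 𝓕, G = convexHull ℝ (w '' (G₀ : Set ℕ)) := by
  constructor
  · rintro ⟨hG, hne, hdim⟩
    obtain ⟨S, hS, rfl⟩ := h.exists_eq_convexHull hc hG
    have hSne : S.Nonempty := by
      rw [convexHull_nonempty_iff, Set.image_nonempty] at hne
      exact_mod_cast hne
    obtain rfl | ⟨F, hF, hSF⟩ := hS
    · obtain ⟨F, hF⟩ := hc.nonempty
      obtain ⟨j, hj, hjF⟩ := exists_notMem hc hd hF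
      have hind : LinearIndepOn ℝ (fun i => (w i, (1 : ℝ))) ((insert j F : Finset ℕ) : Set ℕ) := by
        rw [Finset.coe_insert, linearIndepOn_insert (by exact_mod_cast hjF)]
        refine ⟨h.indep F hF, ?_⟩
        rw [← h.ker_eq_span hc hd (finrank_prod_real d) hF]
        exact (h.neg F hF j hj hjF).ne
      have h1 := finrank_vectorSpan_convexHull hind (Finset.insert_nonempty _ _)
      have h2 := Submodule.finrank_mono (vectorSpan_mono ℝ (convexHull_mono (𝕜 := ℝ)
        (Set.image_mono (f := w) (Finset.coe_subset.2 (show insert j F ⊆ Finset.range n by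
          intro k hk
          rw [Finset.mem_range]
          obtain rfl | hk := Finset.mem_insert.1 hk
          · exact hj
          · exact hc.lt F hF k hk)))))
      rw [Finset.card_insert_of_notMem hjF, hc.card F hF] at h1
      omega
    · have hcard := finrank_vectorSpan_convexHull
        ((h.indep F hF).mono (Finset.coe_subset.2 hSF)) hSne
      have : S = F := Finset.eq_of_subset_of_card_le hSF (by rw [hc.card F hF]; omega)
      exact ⟨F, hF, by rw [this]⟩
  · rintro ⟨G₀, hG₀, rfl⟩
    have hne : G₀.Nonempty := Finset.card_pos.1 (by rw [hc.card G₀ hG₀]; omega)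
    refine ⟨h.convexHull_mem_polytopeFaces hc (.inr ⟨G₀, hG₀, subset_rfl⟩), ?_, ?_⟩
    · rw [convexHull_nonempty_iff, Set.image_nonempty]
      exact_mod_cast hne
    · rw [finrank_vectorSpan_convexHull (h.indep G₀ hG₀) hne, hc.card G₀ hG₀]

theorem Realizes.eq_of_convexHull_eq (h : Realizes n 𝓕 (fun i => (w i, (1 : ℝ))) l)
    (hc : IsPseudomanifold d n 𝓕) {F G : Finset ℕ} (hF : F ∈ 𝓕) (hG : G ∈ 𝓕)
    (he : convexHull ℝ (w '' (F : Set ℕ)) = convexHull ℝ (w '' (G : Set ℕ))) : F = G :=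
  (h.subset_of_convexHull_subset hc (.inr ⟨F, hF, subset_rfl⟩) (.inr ⟨G, hG, subset_rfl⟩)
    he.le).antisymm
  (h.subset_of_convexHull_subset hc (.inr ⟨G, hG, subset_rfl⟩) (.inr ⟨F, hF, subset_rfl⟩) he.ge)

/-- A supporting functional of a facet is a nonnegative multiple of the functional of the facet. -/
theorem Realizes.exists_ratio (h : Realizes n 𝓕 (fun i => (w i, (1 : ℝ))) l)
    (hc : IsPseudomanifold d n 𝓕) (hd : 2 ≤ d) {F : Finset ℕ} (hF : F ∈ 𝓕)
    {f : StrongDual ℝ (E d)} {c : ℝ}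
    (hle : ∀ x ∈ convexHull ℝ (w '' (Finset.range n : Set ℕ)), f x ≤ c)
    (heq : convexHull ℝ (w '' (F : Set ℕ)) =
      {x ∈ convexHull ℝ (w '' (Finset.range n : Set ℕ)) | f x = c}) :
    ∃ r : ℝ, 0 ≤ r ∧ ∀ x, f x - c = r * l F (x, 1) := by
  obtain ⟨j, hj, hjF⟩ := exists_notMem hc hd hF
  let m : E d × ℝ →ₗ[ℝ] ℝ :=
    (f : E d →ₗ[ℝ] ℝ) ∘ₗ LinearMap.fst ℝ (E d) ℝ - c • LinearMap.snd ℝ (E d) ℝ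
  have hm : ∀ x, m (x, 1) = f x - c := fun x => by simp [m]
  refine ⟨m (w j, 1) / l F (w j, 1), div_nonneg_of_nonpos ?_ (h.nonpos hF hj), fun x => ?_⟩
  · rw [hm, sub_nonpos]
    exact hle _ (subset_convexHull ℝ _ ⟨j, Finset.mem_coe.2 (Finset.mem_range.2 hj), rfl⟩)
  · rw [← hm]
    refine h.eq_smul hc hd (finrank_prod_real d) hF (fun i hi => ?_) hj hjF (x, 1)
    have : w i ∈ convexHull ℝ (w '' (F : Set ℕ)) := subset_convexHull ℝ _ ⟨i, hi, rfl⟩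
    rw [heq] at this
    rw [hm, this.2, sub_self]

theorem update_prod (w : ℕ → E d) (n : ℕ) (p : E d) :
    (fun i => (Function.update w n p i, (1 : ℝ))) =
      Function.update (fun i => (w i, (1 : ℝ))) n (p, 1) := by
  funext i
  by_cases hi : i = n
  · subst hi; simp
  · simp [hi]

theorem convexHull_insert_convexHull_range (w : ℕ → E d) (n : ℕ) (p : E d) :
    convexHull ℝ (insert p (convexHull ℝ (w '' (Finset.range n : Set ℕ)))) =
      convexHull ℝ (Function.update w n p '' (Finset.range (n + 1) : Set ℕ)) := by
  rw [Set.insert_eq, convexHull_convexHull_union_right, ← Set.insert_eq, Finset.range_add_one,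
    Finset.coe_insert, Set.image_insert_eq, Function.update_self]
  congr 2
  apply Set.image_congr
  intro i hi
  have : i ≠ n := (Finset.mem_range.1 hi).ne
  simp [this]

theorem exists_realizes_simplex (u : Fin (d + 1) → E d) (hu : AffineIndependent ℝ u) :
    ∃ (w : ℕ → E d) (l : Finset ℕ → E d × ℝ →ₗ[ℝ] ℝ),
      Realizes (d + 1) ((Finset.range (d + 1)).image (Finset.range (d + 1)).erase)
        (fun i => (w i, (1 : ℝ))) l ∧ w '' (Finset.range (d + 1) : Set ℕ) = Set.range u := by
  let w : ℕ → E d := fun i => if h : i < d + 1 then u ⟨i, h⟩ else 0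
  have hw : ∀ i : Fin (d + 1), w i = u i := fun i => dif_pos i.2
  have himg : w '' (Finset.range (d + 1) : Set ℕ) = Set.range u := by
    ext x
    constructor
    · rintro ⟨i, hi, rfl⟩
      exact ⟨⟨i, Finset.mem_range.1 hi⟩, (hw _).symm⟩
    · rintro ⟨i, rfl⟩
      exact ⟨i, Finset.mem_coe.2 (Finset.mem_range.2 i.2), hw i⟩
  have hind : LinearIndepOn ℝ (fun i => (w i, (1 : ℝ))) (Finset.range (d + 1) : Set ℕ) := by
    rw [linearIndepOn_finset_iff]
    intro c hc i hi
    rw [affineIndependent_iff] at hu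
    have h1 : ∑ i ∈ Finset.range (d + 1), c i • w i = 0 := by
      have := congrArg Prod.fst hc
      simpa [Prod.fst_sum] using this
    have h2 : ∑ i ∈ Finset.range (d + 1), c i = 0 := by
      have := congrArg Prod.snd hc
      simpa [Prod.snd_sum] using this
    rw [Finset.sum_range] at h1 h2
    simp only [hw] at h1
    exact hu Finset.univ (fun i => c i) h2 h1 ⟨i, Finset.mem_range.1 hi⟩ (Finset.mem_univ _)
  obtain ⟨l, hl⟩ := Realizes.exists_simplex hind
  exact ⟨w, l, hl, himg⟩

/-- The boundary of a stacked polytope is a stacked complex. -/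
theorem IsStacked.exists_realizes (hd : 2 ≤ d) {P : Set (E d)} (hP : IsStacked P) :
    ∃ (n : ℕ) (𝓕 : Finset (Finset ℕ)) (w : ℕ → E d) (l : Finset ℕ → E d × ℝ →ₗ[ℝ] ℝ),
      StackedComplex d n 𝓕 ∧ Realizes n 𝓕 (fun i => (w i, (1 : ℝ))) l ∧
        P = convexHull ℝ (w '' (Finset.range n : Set ℕ)) := by
  induction hP with
  | simplex u hu =>
    obtain ⟨w, l, hl, hw⟩ := exists_realizes_simplex u hu
    exact ⟨d + 1, _, w, l, .simplex, hl, by rw [hw]⟩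
  | stack P F p hP hF hp hp' ih =>
    obtain ⟨n, 𝓕, w, l, hS, h, rfl⟩ := ih
    have hc := hS.isPseudomanifold hd
    obtain ⟨F₀, hF₀, rfl⟩ := (h.isFacet_iff hc hd).1 hF.1
    have hpos : 0 < l F₀ (p, 1) := by
      obtain ⟨f, c, hle, heq, hlt⟩ := hp
      obtain ⟨r, hr, hfr⟩ := h.exists_ratio hc hd hF₀ hle heq
      have := hfr p
      by_contra! hcon
      nlinarith
    have hneg : ∀ i ∈ F₀, ∃ G, IsNeighbor 𝓕 F₀ i G ∧ l G (p, 1) < 0 := by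
      intro i hi
      obtain ⟨G, hG⟩ := hc.exists_neighbor F₀ hF₀ i hi
      refine ⟨G, hG, ?_⟩
      obtain ⟨f, c, hle, heq, hlt⟩ := hp' _ ((h.isFacet_iff hc hd).2 ⟨G, hG.mem, rfl⟩)
        (fun he => hG.ne hi (h.eq_of_convexHull_eq hc hG.mem hF₀ he))
      obtain ⟨r, hr, hfr⟩ := h.exists_ratio hc hd hG.mem hle heq
      have := hfr p
      by_contra! hcon
      nlinarith
    obtain ⟨l', hl'⟩ := h.exists_stack hc hd (finrank_prod_real d) hF₀ hpos hneg
    refine ⟨n + 1, _, Function.update w n p, l', .stack n 𝓕 F₀ hS hF₀, ?_, ?_⟩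
    · rw [update_prod]; exact hl'
    · exact convexHull_insert_convexHull_range w n p

theorem Realizes.isBeyond (h : Realizes n 𝓕 (fun i => (w i, (1 : ℝ))) l)
    (hc : IsPseudomanifold d n 𝓕) {F : Finset ℕ} (hF : F ∈ 𝓕) (p : E d) :
    (0 < l F (p, 1) → IsBeyond (convexHull ℝ (w '' (Finset.range n : Set ℕ)))
      (convexHull ℝ (w '' (F : Set ℕ))) p) ∧
    (l F (p, 1) < 0 → IsBeneath (convexHull ℝ (w '' (Finset.range n : Set ℕ)))
      (convexHull ℝ (w '' (F : Set ℕ))) p) := by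
  let f : StrongDual ℝ (E d) := LinearMap.toContinuousLinearMap (l F ∘ₗ LinearMap.inl ℝ (E d) ℝ)
  have hf : ∀ x, f x - (- l F (0, 1)) = l F (x, 1) := fun x => by
    simp only [f, LinearMap.coe_toContinuousLinearMap', LinearMap.comp_apply, LinearMap.inl_apply]
    rw [sub_neg_eq_add, ← map_add]
    simp
  have hle : ∀ x ∈ convexHull ℝ (w '' (Finset.range n : Set ℕ)), f x ≤ - l F (0, 1) := by
    refine convexHull_min ?_ (convex_halfSpace_le (f : E d →ₗ[ℝ] ℝ).isLinear _)
    rintro _ ⟨i, hi, rfl⟩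
    have := h.nonpos hF (Finset.mem_range.1 hi)
    rw [← hf] at this
    exact sub_nonpos.1 this
  have heq : convexHull ℝ (w '' (F : Set ℕ)) =
      {x ∈ convexHull ℝ (w '' (Finset.range n : Set ℕ)) | f x = - l F (0, 1)} := by
    rw [← convexHull_inter (m := l F) (S := F)
      (fun i hi => Finset.mem_range.2 (hc.lt F hF i hi)) (h.zero F hF)
      (fun i hi => h.neg F hF i (Finset.mem_range.1 hi))]
    ext x
    rw [Set.mem_ofPred_eq, Set.mem_ofPred_eq, ← hf, sub_eq_zero]
  refine ⟨fun hp => ⟨f, _, hle, heq, ?_⟩, fun hp => ⟨f, _, hle, heq, ?_⟩⟩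
  · rw [← hf] at hp; linarith
  · rw [← hf] at hp; linarith

theorem Realizes.isSimplicialFacet (h : Realizes n 𝓕 (fun i => (w i, (1 : ℝ))) l)
    (hc : IsPseudomanifold d n 𝓕) (hd : 2 ≤ d) {F : Finset ℕ} (hF : F ∈ 𝓕) :
    IsSimplicialFacet (convexHull ℝ (w '' (Finset.range n : Set ℕ)))
      (convexHull ℝ (w '' (F : Set ℕ))) := by
  refine ⟨(h.isFacet_iff hc hd).2 ⟨F, hF, rfl⟩, ?_⟩
  let e : Fin d ≃ F := (F.equivFinOfCardEq (hc.card F hF)).symm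
  refine ⟨fun i => w (e i), ?_, ?_⟩
  · exact (affineIndependent_of_linearIndepOn (h.indep F hF)).comp_embedding e.toEmbedding
  · rw [Set.image_eq_range]
    congr 1
    exact (e.surjective.range_comp (fun x : F => w x)).symm

/-- There are points beyond a given facet and beneath all other facets. -/
theorem Realizes.exists_beyond (h : Realizes n 𝓕 (fun i => (w i, (1 : ℝ))) l)
    (hc : IsPseudomanifold d n 𝓕) (hd : 2 ≤ d) {F : Finset ℕ} (hF : F ∈ 𝓕) :
    ∃ p : E d, 0 < l F (p, 1) ∧ ∀ G ∈ 𝓕, G ≠ F → l G (p, 1) < 0 := by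
  obtain ⟨j, hj, hjF⟩ := exists_notMem hc hd hF
  let b : E d := ∑ i ∈ F, (d : ℝ)⁻¹ • w i
  have hd0 : (0 : ℝ) < d := by exact_mod_cast (by omega : 0 < d)
  have hb : ((b, (1 : ℝ)) : E d × ℝ) = ∑ i ∈ F, (d : ℝ)⁻¹ • (w i, (1 : ℝ)) := by
    ext
    · simp [b, Prod.fst_sum]
    · simp [Prod.snd_sum, hc.card F hF, hd0.ne']
  have hbF : l F (b, 1) = 0 := by
    rw [hb, map_sum]
    exact Finset.sum_eq_zero fun i hi => by rw [map_smul, h.zero F hF i hi, smul_zero]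
  have hbG : ∀ G ∈ 𝓕, G ≠ F → l G (b, 1) < 0 := by
    intro G hG hGF
    obtain ⟨i, hi, hiG⟩ := hc.exists_mem_notMem hG hF hGF.symm
    rw [hb, map_sum]
    refine Finset.sum_neg' (fun k hk => ?_) ⟨i, hi, ?_⟩
    · rw [map_smul, smul_eq_mul]
      exact mul_nonpos_of_nonneg_of_nonpos (by positivity) (h.nonpos hG (hc.lt F hF k hk))
    · rw [map_smul, smul_eq_mul]
      exact mul_neg_of_pos_of_neg (by positivity) (h.neg G hG i (hc.lt F hF i hi) hiG)
  have hline : ∀ (ε : ℝ) (G : Finset ℕ), l G (b + ε • (b - w j), 1) =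
      l G (b, 1) + ε * (l G (b, 1) - l G (w j, 1)) := by
    intro ε G
    have : ((b + ε • (b - w j), (1 : ℝ)) : E d × ℝ) = (b, 1) + ε • ((b, 1) - (w j, 1)) := by
      ext <;> simp
    rw [this, map_add, map_smul, map_sub, smul_eq_mul]
  have hev : ∀ G ∈ 𝓕, ∀ᶠ ε in nhdsWithin (0 : ℝ) (Set.Ioi 0),
      G ≠ F → l G (b + ε • (b - w j), 1) < 0 := by
    intro G hG
    by_cases hGF : G = F
    · exact .of_forall fun _ hne => absurd hGF hne
    · have hcont : Continuous fun ε : ℝ => l G (b, 1) + ε * (l G (b, 1) - l G (w j, 1)) := by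
        fun_prop
      have : ∀ᶠ ε in nhds (0 : ℝ), l G (b, 1) + ε * (l G (b, 1) - l G (w j, 1)) < 0 :=
        hcont.continuousAt.eventually_lt continuousAt_const (by simpa using hbG G hG hGF)
      filter_upwards [nhdsWithin_le_nhds this] with ε hε _
      rw [hline]; exact hε
  obtain ⟨ε, hε, hεpos⟩ := (((Finset.eventually_all 𝓕).2 hev).and self_mem_nhdsWithin).exists
  refine ⟨b + ε • (b - w j), ?_, hε⟩
  rw [hline, hbF]
  have h1 := h.neg F hF j hj hjF
  have h2 : 0 < ε := hεpos
  nlinarith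

/-- Every stacked complex is the boundary complex of a stacked polytope. -/
theorem StackedComplex.exists_isStacked (hd : 2 ≤ d) (hS : StackedComplex d n 𝓕) :
    ∃ (w : ℕ → E d) (l : Finset ℕ → E d × ℝ →ₗ[ℝ] ℝ),
      Realizes n 𝓕 (fun i => (w i, (1 : ℝ))) l ∧
        IsStacked (convexHull ℝ (w '' (Finset.range n : Set ℕ))) := by
  induction hS with
  | simplex =>
    obtain ⟨b⟩ : Nonempty (AffineBasis (Fin (d + 1)) ℝ (E d)) :=
      AffineBasis.exists_affineBasis_of_finiteDimensional (by simp)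
    obtain ⟨w, l, hl, hw⟩ := exists_realizes_simplex b b.ind
    exact ⟨w, l, hl, by rw [hw]; exact .simplex b b.ind⟩
  | stack n 𝓕 F hS hF ih =>
    obtain ⟨w, l, h, hst⟩ := ih
    have hc := hS.isPseudomanifold hd
    obtain ⟨p, hp, hpG⟩ := h.exists_beyond hc hd hF
    obtain ⟨l', hl'⟩ := h.exists_stack hc hd (finrank_prod_real d) hF hp fun i hi => by
      obtain ⟨G, hG⟩ := hc.exists_neighbor F hF i hi
      exact ⟨G, hG, hpG G hG.mem (hG.ne hi)⟩
    refine ⟨Function.update w n p, l', ?_, ?_⟩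
    · rw [update_prod]; exact hl'
    · rw [← convexHull_insert_convexHull_range]
      refine .stack _ _ p hst (h.isSimplicialFacet hc hd hF) ((h.isBeyond hc hF p).1 hp) ?_
      intro G hG hGF
      obtain ⟨G₀, hG₀, rfl⟩ := (h.isFacet_iff hc hd).1 hG
      refine (h.isBeyond hc hG₀ p).2 (hpG G₀ hG₀ ?_)
      rintro rfl
      exact hGF rfl

end

/-! ### Lorentzian geometry -/

section Lorentz

variable {d : ℕ}

/-- The Lorentzian scalar product as a bilinear map. -/
def lorentzForm (d : ℕ) : E (d + 1) →ₗ[ℝ] E (d + 1) →ₗ[ℝ] ℝ :=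
  LinearMap.mk₂ ℝ lorentz
    (fun x x' y => by
      simp only [lorentz, PiLp.add_apply, add_mul, Finset.sum_add_distrib]; ring)
    (fun c x y => by
      simp only [lorentz, PiLp.smul_apply, smul_eq_mul, mul_assoc, ← Finset.mul_sum]; ring)
    (fun x y y' => by
      simp only [lorentz, PiLp.add_apply, mul_add, Finset.sum_add_distrib]; ring)
    (fun c x y => by
      simp only [lorentz, PiLp.smul_apply, smul_eq_mul, mul_left_comm _ c, ← Finset.mul_sum]; ring)

@[simp] theorem lorentzForm_apply (x y : E (d + 1)) : lorentzForm d x y = lorentz x y := rfl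

theorem lorentz_comm (x y : E (d + 1)) : lorentz x y = lorentz y x := by
  simp only [lorentz, mul_comm]

theorem lorentz_add_left (x y z : E (d + 1)) : lorentz (x + y) z = lorentz x z + lorentz y z := by
  simp [← lorentzForm_apply]

theorem lorentz_add_right (x y z : E (d + 1)) : lorentz x (y + z) = lorentz x y + lorentz x z := by
  simp [← lorentzForm_apply]

theorem lorentz_sub_left (x y z : E (d + 1)) : lorentz (x - y) z = lorentz x z - lorentz y z := by
  simp [← lorentzForm_apply]

theorem lorentz_sub_right (x y z : E (d + 1)) : lorentz x (y - z) = lorentz x y - lorentz x z := by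
  simp [← lorentzForm_apply]

theorem lorentz_neg_left (x y : E (d + 1)) : lorentz (-x) y = -lorentz x y := by
  simp [← lorentzForm_apply]

theorem lorentz_neg_right (x y : E (d + 1)) : lorentz x (-y) = -lorentz x y := by
  simp [← lorentzForm_apply]

theorem lorentz_smul_left (c : ℝ) (x y : E (d + 1)) : lorentz (c • x) y = c * lorentz x y := by
  simp [← lorentzForm_apply]

theorem lorentz_smul_right (c : ℝ) (x y : E (d + 1)) : lorentz x (c • y) = c * lorentz x y := by
  simp [← lorentzForm_apply]

theorem lorentz_zero_left (x : E (d + 1)) : lorentz 0 x = 0 := by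
  simp [← lorentzForm_apply]

theorem lorentz_sum_right {ι : Type*} (x : E (d + 1)) (s : Finset ι) (f : ι → E (d + 1)) :
    lorentz x (∑ i ∈ s, f i) = ∑ i ∈ s, lorentz x (f i) := by
  simp [← lorentzForm_apply]

/-- The Lorentzian scalar product represents every functional. -/
theorem exists_lorentz_eq (m : E (d + 1) →ₗ[ℝ] ℝ) : ∃ z, ∀ y, lorentz z y = m y := by
  let b := (EuclideanSpace.basisFun (Fin (d + 1)) ℝ).toBasis
  refine ⟨WithLp.toLp 2 (Fin.cons (-m (b 0)) fun i : Fin d => m (b i.succ)), fun y => ?_⟩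
  conv_rhs => rw [← b.sum_repr y, map_sum, Fin.sum_univ_succ]
  simp [lorentz, b, mul_comm]

theorem lorentz_self_nonneg_of_zero {z : E (d + 1)} (hz : z 0 = 0) :
    0 ≤ lorentz z z ∧ (lorentz z z = 0 → z = 0) := by
  have h : lorentz z z = ∑ i : Fin d, z i.succ * z i.succ := by simp [lorentz, hz]
  rw [h]
  refine ⟨Finset.sum_nonneg fun i _ => mul_self_nonneg _, fun h0 => ?_⟩
  rw [Finset.sum_eq_zero_iff_of_nonneg fun i _ => mul_self_nonneg _] at h0
  ext i
  refine Fin.cases hz (fun i => ?_) i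
  simpa using h0 i (Finset.mem_univ i)

/-- `x` is in the closed future light cone. -/
def IsFuture (x : E (d + 1)) : Prop := lorentz x x ≤ 0 ∧ 0 ≤ x 0

theorem IsFuture.pos {x : E (d + 1)} (hx : IsFuture x) (h0 : x ≠ 0) : 0 < x 0 := by
  refine lt_of_le_of_ne hx.2 fun h => h0 ?_
  have := lorentz_self_nonneg_of_zero h.symm
  exact this.2 (le_antisymm hx.1 this.1)

theorem IsFuture.smul {x : E (d + 1)} (hx : IsFuture x) {r : ℝ} (hr : 0 ≤ r) :
    IsFuture (r • x) := by
  refine ⟨?_, ?_⟩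
  · rw [lorentz_smul_left, lorentz_smul_right]
    have := hx.1
    nlinarith [mul_nonneg hr hr]
  · simpa using mul_nonneg hr hx.2

theorem lorentz_sub_smul_self (x y : E (d + 1)) (r : ℝ) :
    lorentz (x - r • y) (x - r • y) =
      lorentz x x - 2 * r * lorentz x y + r ^ 2 * lorentz y y := by
  rw [lorentz_sub_left, lorentz_sub_right, lorentz_sub_right, lorentz_smul_left, lorentz_smul_right,
    lorentz_smul_left, lorentz_smul_right, lorentz_comm y x]
  ring

theorem sub_smul_zero {x y : E (d + 1)} (hy : y 0 ≠ 0) : (x - (x 0 / y 0) • y) 0 = 0 := by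
  simp [hy]

theorem IsFuture.lorentz_nonpos {x y : E (d + 1)} (hx : IsFuture x) (hy : IsFuture y) :
    lorentz x y ≤ 0 := by
  by_cases hy0 : y = 0
  · rw [hy0, lorentz_comm, lorentz_zero_left]
  by_cases hx0 : x = 0
  · rw [hx0, lorentz_zero_left]
  have hyp := hy.pos hy0
  have h1 := (lorentz_self_nonneg_of_zero (sub_smul_zero (x := x) hyp.ne')).1
  rw [lorentz_sub_smul_self] at h1
  have hr : 0 < x 0 / y 0 := div_pos (hx.pos hx0) hyp
  by_contra! hcon
  have := mul_pos hr hcon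
  nlinarith [hx.1, hy.1, mul_nonneg (sq_nonneg (x 0 / y 0)) (neg_nonneg.2 hy.1)]

/-- Orthogonal vectors of the future light cone are parallel. -/
theorem IsFuture.eq_smul_of_lorentz_eq_zero {x y : E (d + 1)} (hx : IsFuture x) (hy : IsFuture y)
    (hy0 : y ≠ 0) (h : lorentz x y = 0) : x = (x 0 / y 0) • y := by
  have h1 := lorentz_self_nonneg_of_zero (sub_smul_zero (x := x) (hy.pos hy0).ne')
  refine sub_eq_zero.1 (h1.2 (le_antisymm ?_ h1.1))
  rw [lorentz_sub_smul_self, h]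
  nlinarith [hx.1, hy.1, mul_nonneg (sq_nonneg (x 0 / y 0)) (neg_nonneg.2 hy.1)]

theorem IsFuture.add {x y : E (d + 1)} (hx : IsFuture x) (hy : IsFuture y) : IsFuture (x + y) := by
  refine ⟨?_, by simpa using add_nonneg hx.2 hy.2⟩
  rw [lorentz_add_left, lorentz_add_right, lorentz_add_right, lorentz_comm y x]
  linarith [hx.1, hy.1, hx.lorentz_nonpos hy]

theorem IsFuture.sum {ι : Type*} {s : Finset ι} {f : ι → E (d + 1)}
    (h : ∀ i ∈ s, IsFuture (f i)) : IsFuture (∑ i ∈ s, f i) := by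
  induction s using Finset.cons_induction with
  | empty => exact ⟨by simp [lorentz_zero_left], by simp⟩
  | cons i s hi ih =>
    rw [Finset.sum_cons]
    exact (h i (Finset.mem_cons_self i s)).add (ih fun j hj => h j (Finset.mem_cons_of_mem hj))

/-- The orthogonal complement of a timelike vector is spacelike. -/
theorem lorentz_self_pos_of_orthogonal {w t : E (d + 1)} (ht : lorentz t t < 0)
    (hwt : lorentz w t = 0) (hw : w ≠ 0) : 0 < lorentz w w := by
  have ht0 : t 0 ≠ 0 := fun h => by linarith [(lorentz_self_nonneg_of_zero h).1]
  have h1 := lorentz_self_nonneg_of_zero (sub_smul_zero (x := w) ht0)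
  rw [lorentz_sub_smul_self, hwt] at h1
  by_cases hr : w 0 / t 0 = 0
  · rw [hr] at h1
    simp only [mul_zero, zero_smul, sub_zero] at h1
    have h2 : 0 ≤ lorentz w w := by linarith [h1.1]
    exact lt_of_le_of_ne h2 fun h0 => hw (h1.2 (by linarith))
  · have : 0 < (w 0 / t 0) ^ 2 := by positivity
    nlinarith [h1.1]

theorem mem_lightCap_iff {x : E (d + 1)} : x ∈ lightCap d ↔ ‖x‖ = 1 ∧ IsFuture x := Iff.rfl

/-! ### Tangent simplicial cones -/

theorem span_hull (s : Set (E (d + 1))) :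
    Submodule.span ℝ (PointedCone.hull ℝ s : Set (E (d + 1))) = Submodule.span ℝ s := by
  apply le_antisymm
  · rw [Submodule.span_le]
    exact PointedCone.hull_le_span ℝ s
  · exact Submodule.span_mono PointedCone.subset_hull

/-- A positive combination of linearly independent vectors is in the relative interior of their
conical hull. -/
theorem mem_intrinsicInterior_hull {v : ℕ → E (d + 1)} {S : Finset ℕ}
    (hind : LinearIndepOn ℝ v (S : Set ℕ)) {c : ℕ → ℝ} (hc : ∀ i ∈ S, 0 < c i) :
    ∑ i ∈ S, c i • v i ∈
      intrinsicInterior ℝ (PointedCone.hull ℝ (v '' (S : Set ℕ)) : Set (E (d + 1))) := by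
  choose m hm using fun j : ℕ => hind.exists_functional fun i => if i = j then 1 else 0
  have hcoef : ∀ (a : ℕ → ℝ), ∀ j ∈ S, m j (∑ i ∈ S, a i • v i) = a j := by
    intro a j hj
    rw [map_sum, Finset.sum_eq_single_of_mem j hj]
    · simp [hm j j hj]
    · intro i hi hij
      simp [hm j i hi, hij]
  have hmem : ∑ i ∈ S, c i • v i ∈ (PointedCone.hull ℝ (v '' (S : Set ℕ)) : Set (E (d + 1))) :=
    mem_hull_image_iff.2 ⟨c, fun i hi => (hc i hi).le, rfl⟩
  refine mem_intrinsicInterior.2 ⟨⟨_, subset_affineSpan ℝ _ hmem⟩, ?_, rfl⟩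
  rw [mem_interior]
  refine ⟨Subtype.val ⁻¹' {x | ∀ j ∈ S, 0 < m j x}, ?_, ?_, ?_⟩
  · rintro ⟨x, hx⟩ hpos
    have hx' := affineSpan_le_toAffineSubspace_span hx
    rw [Submodule.mem_toAffineSubspace, span_hull] at hx'
    obtain ⟨a, rfl⟩ := (Submodule.mem_span_image_finset_iff_exists_fun' ℝ).1 hx'
    refine mem_hull_image_iff.2 ⟨a, fun j hj => ?_, rfl⟩
    have := hpos j hj
    rw [hcoef a j hj] at this
    exact this.le
  · refine IsOpen.preimage continuous_subtype_val ?_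
    have : {x | ∀ j ∈ S, 0 < m j x} = ⋂ j ∈ S, {x | 0 < m j x} := by ext; simp
    rw [this]
    exact isOpen_biInter_finset fun j _ =>
      isOpen_lt continuous_const (LinearMap.continuous_of_finiteDimensional (m j))
  · intro j hj
    rw [hcoef c j hj]
    exact hc j hj

/-- A simplicial cone in the Lorentz-orthogonal complement of a light-like vector `t` of its
relative interior is tangent to the light cone. -/
theorem isTangent_hull {v : ℕ → E (d + 1)} {S : Finset ℕ}
    (hind : LinearIndepOn ℝ v (S : Set ℕ)) {t : E (d + 1)}
    (ht : ∃ c : ℕ → ℝ, (∀ i ∈ S, 0 < c i) ∧ t = ∑ i ∈ S, c i • v i)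
    (ht0 : 0 < t 0) (htt : lorentz t t = 0) (hort : ∀ i ∈ S, lorentz t (v i) = 0) :
    IsTangent (PointedCone.hull ℝ (v '' (S : Set ℕ)) : Set (E (d + 1))) := by
  obtain ⟨c, hc, htc⟩ := ht
  have htne : t ≠ 0 := fun h => by simp [h] at ht0
  have hnorm : 0 < ‖t‖ := norm_pos_iff.2 htne
  have hfut : IsFuture t := ⟨htt.le, ht0.le⟩
  have hfut' := hfut.smul (inv_nonneg.2 hnorm.le)
  have hnorm' : ‖‖t‖⁻¹ • t‖ = 1 := by
    rw [norm_smul, norm_inv, norm_norm, inv_mul_cancel₀ hnorm.ne']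
  have hint : ‖t‖⁻¹ • t ∈
      intrinsicInterior ℝ (PointedCone.hull ℝ (v '' (S : Set ℕ)) : Set (E (d + 1))) := by
    have : ‖t‖⁻¹ • t = ∑ i ∈ S, (‖t‖⁻¹ * c i) • v i := by
      conv_lhs => rw [htc, Finset.smul_sum]
      simp only [mul_smul, ← htc]
    rw [this]
    exact mem_intrinsicInterior_hull hind fun i hi => mul_pos (inv_pos.2 hnorm) (hc i hi)
  refine ⟨‖t‖⁻¹ • t, ⟨hnorm', ?_, hfut'.2⟩, hint, ?_⟩
  · rw [lorentz_smul_left, lorentz_smul_right, htt, mul_zero, mul_zero]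
  · ext x
    rw [Set.mem_singleton_iff]
    constructor
    · rintro ⟨hx, hx1, hxf⟩
      have hxt : lorentz x t = 0 := by
        obtain ⟨a, ha, rfl⟩ := mem_hull_image_iff.1 hx
        rw [lorentz_comm, lorentz_sum_right]
        exact Finset.sum_eq_zero fun i hi => by rw [lorentz_smul_right, hort i hi, mul_zero]
      have hxe := IsFuture.eq_smul_of_lorentz_eq_zero hxf hfut htne hxt
      have hr : 0 ≤ x 0 / t 0 := div_nonneg hxf.2 ht0.le
      have : x 0 / t 0 = ‖t‖⁻¹ := by
        rw [hxe, norm_smul, Real.norm_of_nonneg hr] at hx1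
        exact eq_inv_of_mul_eq_one_left hx1
      rw [← this]; exact hxe
    · rintro rfl
      exact ⟨intrinsicInterior_subset hint, hnorm', hfut'⟩

/-! ### Scribability of realizations -/

variable {n k : ℕ} {𝓕 : Finset (Finset ℕ)} {v : ℕ → E (d + 1)}
  {l : Finset ℕ → E (d + 1) →ₗ[ℝ] ℝ}

theorem Realizes.isPointedPolyhedral (h : Realizes n 𝓕 v l) (hc : IsPseudomanifold d n 𝓕)
    (hd : 2 ≤ d) : IsPointedPolyhedral (PointedCone.hull ℝ (v '' (Finset.range n : Set ℕ))) := by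
  classical
  refine ⟨⟨(Finset.range n).image v, by rw [Finset.coe_image]⟩, fun x hx hx' => ?_⟩
  have hle : ∀ F ∈ 𝓕, ∀ x ∈ PointedCone.hull ℝ (v '' (Finset.range n : Set ℕ)), l F x ≤ 0 := by
    intro F hF x hx
    obtain ⟨c, hc0, rfl⟩ := mem_hull_image_iff.1 hx
    rw [map_sum]
    refine Finset.sum_nonpos fun i hi => ?_
    rw [map_smul, smul_eq_mul]
    exact mul_nonpos_of_nonneg_of_nonpos (hc0 i hi) (h.nonpos hF (Finset.mem_range.1 hi))
  have h0 : ∀ F ∈ 𝓕, l F x = 0 := fun F hF =>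
    le_antisymm (hle F hF x hx) (by simpa using hle F hF _ hx')
  obtain ⟨F, hF⟩ := hc.nonempty
  obtain ⟨c, rfl⟩ := h.exists_coeff hc hd (by simp) hF (h0 F hF)
  refine Finset.sum_eq_zero fun i hi => ?_
  obtain ⟨G, hG⟩ := hc.exists_neighbor F hF i hi
  have := h0 G hG.mem
  rw [h.apply_neighbor hi hG] at this
  rw [(mul_eq_zero.1 this).resolve_right (h.neg G hG.mem i (hc.lt F hF i hi) hG.notMem).ne,
    zero_smul]

theorem Realizes.isScribed (h : Realizes n 𝓕 v l) (hc : IsPseudomanifold d n 𝓕) (hd : 2 ≤ d)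
    (hk : k < d) (ht : ∀ F ∈ 𝓕, ∀ S ⊆ F, S.card = k + 1 →
      IsTangent (PointedCone.hull ℝ (v '' (S : Set ℕ)) : Set (E (d + 1)))) :
    IsScribed k (PointedCone.hull ℝ (v '' (Finset.range n : Set ℕ))) := by
  intro F hF hdim
  obtain ⟨S, hS | ⟨G, hG, hSG⟩, rfl⟩ := h.exists_eq_hull hF
  · exfalso
    obtain ⟨G, hG⟩ := hc.nonempty
    obtain ⟨j, hj, hjG⟩ := exists_notMem hc hd hG
    have hlt : Submodule.span ℝ (v '' (G : Set ℕ)) < Submodule.span ℝ (v '' (S : Set ℕ)) := by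
      refine lt_of_le_of_ne (Submodule.span_mono (Set.image_mono (Finset.coe_subset.2 ?_))) ?_
      · rw [hS]
        exact fun i hi => Finset.mem_range.2 (hc.lt G hG i hi)
      · intro he
        have : v j ∈ Submodule.span ℝ (v '' (G : Set ℕ)) := by
          rw [he]
          exact Submodule.subset_span ⟨j, by rw [hS]; exact Finset.mem_range.2 hj, rfl⟩
        rw [← h.ker_eq_span hc hd (by simp) hG] at this
        exact (h.neg G hG j hj hjG).ne this
    have := Submodule.finrank_lt_finrank_of_lt hlt
    rw [h.finrank_span hG subset_rfl, hc.card G hG] at this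
    rw [span_hull] at hdim
    omega
  · rw [span_hull, h.finrank_span hG hSG] at hdim
    exact ht G hG S hSG hdim

/-- A polytope is `k`-scribable if its boundary complex has a `k`-scribed realization. -/
theorem Realizes.isScribable (h : Realizes n 𝓕 v l) (hc : IsPseudomanifold d n 𝓕) (hd : 2 ≤ d)
    {w : ℕ → E d} {l' : Finset ℕ → E d × ℝ →ₗ[ℝ] ℝ}
    (h' : Realizes n 𝓕 (fun i => (w i, (1 : ℝ))) l')
    (hs : IsScribed k (PointedCone.hull ℝ (v '' (Finset.range n : Set ℕ)))) :
    IsScribable k (convexHull ℝ (w '' (Finset.range n : Set ℕ))) := by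
  obtain ⟨e⟩ := h.nonempty_coneFaces_iso hc
  obtain ⟨e'⟩ := h'.nonempty_polytopeFaces_iso hc
  exact ⟨_, h.isPointedPolyhedral hc hd, ⟨e'.symm.trans e⟩, hs⟩

end Lorentz

/-! ### Realizations by Lorentzian normals -/

section Normals

variable {d n : ℕ} {𝓕 : Finset (Finset ℕ)}

theorem lorentz_eq_inner (x y : E (d + 1)) : lorentz x y = inner ℝ x y - 2 * (x 0 * y 0) := by
  rw [PiLp.inner_apply, Fin.sum_univ_succ]
  simp only [lorentz, RCLike.inner_apply, conj_trivial, mul_comm (y _) (x _)]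
  ring

/-- The vertices of a regular simplex, placed at prescribed heights `α` along the time axis. -/
theorem exists_regular_simplex (d : ℕ) (α : ℕ → ℝ) : ∃ N : ℕ → E (d + 1),
    (∀ j, N j 0 = α j) ∧ ∀ i ≤ d, ∀ j ≤ d,
      lorentz (N i) (N j) = (if i = j then 1 else 0) - 1 / (d + 1 : ℝ) - α i * α j := by
  have hd : (0 : ℝ) < d + 1 := by positivity
  -- reflect the standard simplex so that its axis becomes the time axis
  let a : E (d + 1) := WithLp.toLp 2 fun _ => 1 / √(d + 1 : ℝ)
  let e : E (d + 1) := EuclideanSpace.single 0 1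
  have ha : ‖a‖ = ‖e‖ := by
    rw [EuclideanSpace.norm_eq]
    simp [a, e, Real.sq_sqrt hd.le, hd.ne', abs_of_pos (Real.sqrt_pos.2 hd)]
  let ρ := (Submodule.span ℝ {a - e})ᗮ.reflection
  have hρ : ρ a = e := Submodule.reflection_sub ha
  let z : ℕ → E (d + 1) := fun j => ρ (if h : j < d + 1 then EuclideanSpace.single ⟨j, h⟩ 1 else 0)
  have hz0 : ∀ j ≤ d, z j 0 = 1 / √(d + 1 : ℝ) := by
    intro j hj
    have h1 : z j 0 = inner ℝ e (z j) := by simp [e, EuclideanSpace.inner_single_left]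
    rw [h1, ← hρ]
    simp only [z, LinearIsometryEquiv.inner_map_map, dif_pos (Nat.lt_succ_of_le hj)]
    rw [EuclideanSpace.inner_single_right]
    simp [a]
  have hz : ∀ i ≤ d, ∀ j ≤ d, (inner ℝ (z i) (z j) : ℝ) = if i = j then 1 else 0 := by
    intro i hi j hj
    simp only [z, LinearIsometryEquiv.inner_map_map, dif_pos (Nat.lt_succ_of_le hi),
      dif_pos (Nat.lt_succ_of_le hj)]
    rw [EuclideanSpace.inner_single_left]
    simp
  refine ⟨fun j => WithLp.toLp 2 (Fin.cons (α j) fun k : Fin d => z j k.succ),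
    fun j => by simp, fun i hi j hj => ?_⟩
  have h1 := lorentz_eq_inner (z i) (z j)
  rw [hz i hi j hj, hz0 i hi, hz0 j hj] at h1
  have h2 : 1 / √(d + 1 : ℝ) * (1 / √(d + 1 : ℝ)) = 1 / (d + 1 : ℝ) := by
    rw [div_mul_div_comm, one_mul, Real.mul_self_sqrt hd.le]
  rw [h2] at h1
  simp only [lorentz] at h1 ⊢
  rw [hz0 i hi, hz0 j hj, h2] at h1
  simp only [Fin.cons_zero, Fin.cons_succ]
  linarith

/-- A simplex whose facet normals are the vertices of a regular simplex placed at prescribed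
heights `α` along the time axis, and scaled by `r`. -/
theorem exists_realizes_regular (d : ℕ) {α : ℕ → ℝ} (hα : ∀ i, 0 < α i) {r : ℝ} (hr : 0 < r) :
    ∃ (N : Finset ℕ → E (d + 1)) (v : ℕ → E (d + 1)),
      Realizes (d + 1) ((Finset.range (d + 1)).image (Finset.range (d + 1)).erase) v
        (fun F => lorentzForm d (N F)) ∧
      (∀ j ≤ d, N ((Finset.range (d + 1)).erase j) 0 = r * α j) ∧
      ∀ i ≤ d, ∀ j ≤ d, lorentz (N ((Finset.range (d + 1)).erase i))
        (N ((Finset.range (d + 1)).erase j)) =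
          r ^ 2 * ((if i = j then 1 else 0) - 1 / (d + 1 : ℝ) - α i * α j) := by
  obtain ⟨N₀, hN0, hN⟩ := exists_regular_simplex d α
  have hd : (0 : ℝ) < d + 1 := by positivity
  have hind : LinearIndepOn ℝ N₀ (Finset.range (d + 1) : Set ℕ) := by
    rw [linearIndepOn_finset_iff]
    intro c hc
    have h0 : ∑ i ∈ Finset.range (d + 1), c i * α i = 0 := by
      have := congrArg (fun x : E (d + 1) => x 0) hc
      simpa [hN0] using this
    have h1 : ∀ j ∈ Finset.range (d + 1),
        c j = (∑ i ∈ Finset.range (d + 1), c i) * (1 / (d + 1 : ℝ)) := by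
      intro j hj
      have hjd := Nat.lt_succ_iff.1 (Finset.mem_range.1 hj)
      have h2 : lorentz (N₀ j) (∑ i ∈ Finset.range (d + 1), c i • N₀ i) = 0 := by
        rw [hc, lorentz_comm, lorentz_zero_left]
      rw [lorentz_sum_right] at h2
      have h3 : ∀ i ∈ Finset.range (d + 1), lorentz (N₀ j) (c i • N₀ i) =
          (if j = i then c i else 0) - c i * (1 / (d + 1 : ℝ)) - α j * (c i * α i) := by
        intro i hi
        rw [lorentz_smul_right, hN j hjd i (Nat.lt_succ_iff.1 (Finset.mem_range.1 hi))]
        split_ifs <;> ring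
      rw [Finset.sum_congr rfl h3, Finset.sum_sub_distrib, Finset.sum_sub_distrib,
        ← Finset.mul_sum, h0, Finset.sum_ite_eq, if_pos hj, ← Finset.sum_mul] at h2
      linarith
    have h4 : (∑ i ∈ Finset.range (d + 1), c i) = 0 := by
      have h5 : (∑ i ∈ Finset.range (d + 1), c i) * (1 / (d + 1 : ℝ)) *
          ∑ i ∈ Finset.range (d + 1), α i = 0 := by
        rw [Finset.mul_sum, ← h0]
        exact Finset.sum_congr rfl fun i hi => by rw [← h1 i hi]
      have h6 : 0 < ∑ i ∈ Finset.range (d + 1), α i :=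
        Finset.sum_pos (fun i _ => hα i) ⟨0, by simp⟩
      have h7 := (mul_eq_zero.1 h5).resolve_right h6.ne'
      exact (mul_eq_zero.1 h7).resolve_right (by positivity)
    intro j hj
    rw [h1 j hj, h4, zero_mul]
  choose m hm using fun j : ℕ => hind.exists_functional fun i => if i = j then -1 else 0
  choose v hv using fun j => exists_lorentz_eq (m j)
  have hj : ∀ j ≤ d, (Finset.range (d + 1) \ (Finset.range (d + 1)).erase j).sup id = j := by
    intro j hj
    rw [Finset.sdiff_erase_self (Finset.mem_range.2 (Nat.lt_succ_of_le hj))]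
    simp
  refine ⟨fun F => r • N₀ ((Finset.range (d + 1) \ F).sup id), v,
    Realizes.simplex ?_ ?_, ?_, ?_⟩
  · intro j hjd i hid hij
    beta_reduce
    rw [hj j hjd, lorentzForm_apply, lorentz_smul_left, lorentz_comm, hv,
      hm i j (Finset.mem_range.2 (Nat.lt_succ_of_le hjd)), if_neg hij.symm, mul_zero]
  · intro j hjd
    beta_reduce
    rw [hj j hjd, lorentzForm_apply, lorentz_smul_left, lorentz_comm, hv,
      hm j j (Finset.mem_range.2 (Nat.lt_succ_of_le hjd)), if_pos rfl]
    linarith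
  · intro j hjd
    simp only [hj j hjd, PiLp.smul_apply, hN0, smul_eq_mul]
  · intro i hid j hjd
    simp only [hj i hid, hj j hjd, lorentz_smul_left, lorentz_smul_right, hN i hid j hjd]
    ring

/-- There is a point with prescribed values under the functionals of a facet and its neighbors. -/
theorem Realizes.exists_point {W : Type*} [AddCommGroup W] [Module ℝ W]
    {v : ℕ → W} {l : Finset ℕ → W →ₗ[ℝ] ℝ} (h : Realizes n 𝓕 v l) (hc : IsPseudomanifold d n 𝓕)
    (hd : 2 ≤ d) {F : Finset ℕ} (hF : F ∈ 𝓕) {G : ℕ → Finset ℕ}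
    (hG : ∀ i ∈ F, IsNeighbor 𝓕 F i (G i)) (r : ℕ → ℝ) :
    ∃ p, l F p = 1 ∧ ∀ i ∈ F, l (G i) p = - r i := by
  obtain ⟨j, hj, hjF⟩ := exists_notMem hc hd hF
  have hlj := (h.neg F hF j hj hjF).ne
  let x := (l F (v j))⁻¹ • v j
  refine ⟨x + ∑ k ∈ F, ((- r k - l (G k) x) / l (G k) (v k)) • v k, ?_, fun i hi => ?_⟩
  · rw [map_add, map_smul, smul_eq_mul, inv_mul_cancel₀ hlj, map_sum, Finset.sum_eq_zero, add_zero]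
    intro i hi
    rw [map_smul, h.zero F hF i hi, smul_zero]
  · rw [map_add, h.apply_neighbor hi (hG i hi) fun k => (- r k - l (G k) x) / l (G k) (v k),
      div_mul_cancel₀ _ (h.neg _ (hG i hi).mem i (hc.lt F hF i hi) (hG i hi).notMem).ne]
    ring

/-- Stacking a vertex onto a facet so that the normals of the new facets are prescribed positive
combinations of the normal of this facet and those of its neighbors. -/
theorem Realizes.exists_stack_normals {N : Finset ℕ → E (d + 1)} {v : ℕ → E (d + 1)}
    (h : Realizes n 𝓕 v (fun F => lorentzForm d (N F))) (hc : IsPseudomanifold d n 𝓕)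
    (hd : 2 ≤ d) {F : Finset ℕ} (hF : F ∈ 𝓕) {G : ℕ → Finset ℕ}
    (hG : ∀ i ∈ F, IsNeighbor 𝓕 F i (G i)) {a b : ℕ → ℝ} (ha : ∀ i ∈ F, 0 < a i)
    (hb : ∀ i ∈ F, 0 < b i) :
    ∃ p, Realizes (n + 1) (stackComplex n 𝓕 F) (Function.update v n p) (fun H =>
      lorentzForm d (stackExtend n F N (fun i => a i • N F + b i • N (G i)) H)) := by
  obtain ⟨p, hp1, hp2⟩ := h.exists_point hc hd hF hG fun i => a i / b i
  refine ⟨p, h.stack hc hd (by simp) hF (by rw [hp1]; exact one_pos) (fun i hi => ?_)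
    (fun H hH => by rw [stackExtend_old (hc.notMem hH)]) fun i hi => ?_⟩
  · refine ⟨G i, hG i hi, ?_⟩
    have := div_pos (ha i hi) (hb i hi)
    rw [hp2 i hi]
    linarith
  · refine ⟨G i, hG i hi, a i, ha i hi, b i, hb i hi, ?_⟩
    have he : lorentzForm d (a i • N F + b i • N (G i)) =
        a i • lorentzForm d (N F) + b i • lorentzForm d (N (G i)) := by
      rw [map_add, map_smul, map_smul]
    rw [stackExtend_new (hc.notMem hF) hi, he]
    refine ⟨rfl, ?_⟩
    rw [LinearMap.add_apply, LinearMap.smul_apply, LinearMap.smul_apply, hp1, hp2 i hi,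
      smul_eq_mul, smul_eq_mul]
    have := (hb i hi).ne'
    field_simp
    ring

end Normals

/-! ### Circumscribed realizations -/

section Facets

variable {d n : ℕ} {𝓕 : Finset (Finset ℕ)}

/-- The invariant of the construction of circumscribed realizations: the normals of the facets in
`A` are space-like, those of the other facets are light-like, and all of them are the poles of
pairwise disjoint caps of the light sphere (which degenerate to points outside of `A`). -/
structure HasDisjointCaps (𝓕 : Finset (Finset ℕ)) (A : Set (Finset ℕ))
    (N : Finset ℕ → E (d + 1)) : Prop where
  time_pos : ∀ F ∈ 𝓕, 0 < N F 0
  self_pos : ∀ F ∈ 𝓕, F ∈ A → 0 < lorentz (N F) (N F)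
  self_zero : ∀ F ∈ 𝓕, F ∉ A → lorentz (N F) (N F) = 0
  neg : ∀ F ∈ 𝓕, ∀ G ∈ 𝓕, F ≠ G → lorentz (N F) (N G) < 0
  lt_sq : ∀ F ∈ 𝓕, ∀ G ∈ 𝓕, F ≠ G →
    lorentz (N F) (N F) * lorentz (N G) (N G) < lorentz (N F) (N G) ^ 2

theorem HasDisjointCaps.self_nonneg {A : Set (Finset ℕ)} {N : Finset ℕ → E (d + 1)}
    (h : HasDisjointCaps 𝓕 A N) {F : Finset ℕ} (hF : F ∈ 𝓕) : 0 ≤ lorentz (N F) (N F) := by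
  by_cases hA : F ∈ A
  · exact (h.self_pos F hF hA).le
  · exact (h.self_zero F hF hA).ge

theorem lorentz_add_smul_self (x y : E (d + 1)) (s : ℝ) :
    lorentz (x + s • y) (x + s • y) = lorentz x x + 2 * s * lorentz x y + s ^ 2 * lorentz y y := by
  rw [lorentz_add_left, lorentz_add_right, lorentz_add_right, lorentz_smul_left, lorentz_smul_right,
    lorentz_smul_left, lorentz_smul_right, lorentz_comm y x]
  ring

/-- If the caps with poles `x` and `y` are disjoint, then the ray from `x` in the direction of `y`
meets the light cone. The point found is the first such point; its cap, a single point, is still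
disjoint from that of `y`. -/
theorem exists_lightlike {x y : E (d + 1)} (hx : 0 < lorentz x x) (hy : 0 ≤ lorentz y y)
    (hxy : lorentz x y < 0) (hlt : lorentz x x * lorentz y y < lorentz x y ^ 2) :
    ∃ s > 0, lorentz (x + s • y) (x + s • y) = 0 ∧ lorentz (x + s • y) y < 0 ∧
      lorentz x x + 2 * (s * lorentz x y) ≤ 0 := by
  set q := lorentz x x
  set c := - lorentz x y with hc
  set M := lorentz y y
  set D := c ^ 2 - q * M with hD
  have hDpos : 0 < D := by rw [hD, hc]; nlinarith
  have hs := Real.sqrt_pos.2 hDpos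
  have hsq := Real.sq_sqrt hDpos.le
  have hcpos : 0 < c := by rw [hc]; linarith
  have hden : 0 < c + √D := by positivity
  -- the smaller root of `q - 2 c s + M s ^ 2`
  have key : q / (c + √D) * M = c - √D := by
    rw [div_mul_eq_mul_div, div_eq_iff hden.ne']
    nlinarith
  have key2 : q / (c + √D) * (c + √D) = q := div_mul_cancel₀ _ hden.ne'
  have hspos : 0 < q / (c + √D) := div_pos hx hden
  have hxy' : lorentz x y = - c := by rw [hc, neg_neg]
  refine ⟨q / (c + √D), hspos, ?_, ?_, ?_⟩
  · rw [lorentz_add_smul_self, hxy']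
    change q + 2 * _ * (-c) + _ ^ 2 * M = 0
    set s := q / (c + √D)
    have : s ^ 2 * M = s * (c - √D) := by rw [← key]; ring
    rw [this]; linarith
  · rw [lorentz_add_left, lorentz_smul_left, hxy']
    change -c + _ * M < 0
    rw [key]; linarith
  · rw [hxy']
    set s := q / (c + √D)
    have : s * √D ≤ s * c := by
      refine mul_le_mul_of_nonneg_left ?_ hspos.le
      have : 0 ≤ s * M := mul_nonneg hspos.le hy
      linarith
    linarith

theorem hasDisjointCaps_simplex (hd : 2 ≤ d) (A : Set (Finset ℕ)) :
    ∃ (N : Finset ℕ → E (d + 1)) (v : ℕ → E (d + 1)),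
      Realizes (d + 1) ((Finset.range (d + 1)).image (Finset.range (d + 1)).erase) v
        (fun F => lorentzForm d (N F)) ∧
      HasDisjointCaps ((Finset.range (d + 1)).image (Finset.range (d + 1)).erase) A N := by
  classical
  have hd' : (2 : ℝ) ≤ d := by exact_mod_cast hd
  let α : ℕ → ℝ := fun j => if (Finset.range (d + 1)).erase j ∈ A then √(1 / 2) else √(d / (d + 1))
  have hαpos : ∀ j, 0 < α j := by
    intro j
    simp only [α]
    split_ifs
    · exact Real.sqrt_pos.2 (by norm_num)
    · exact Real.sqrt_pos.2 (by positivity)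
  have hαA : ∀ j, (Finset.range (d + 1)).erase j ∈ A → α j * α j = 1 / 2 := by
    intro j hj
    simp only [α, if_pos hj]
    exact Real.mul_self_sqrt (by norm_num)
  have hαA' : ∀ j, (Finset.range (d + 1)).erase j ∉ A → α j * α j = d / (d + 1) := by
    intro j hj
    simp only [α, if_neg hj]
    exact Real.mul_self_sqrt (by positivity)
  obtain ⟨N, v, h, h0, hN⟩ := exists_realizes_regular d hαpos one_pos
  simp only [one_pow, one_mul] at hN h0
  have hlt : 1 / ((d : ℝ) + 1) < 1 / 2 := one_div_lt_one_div_of_lt (by norm_num) (by linarith)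
  have hpos : 0 < 1 / ((d : ℝ) + 1) := by positivity
  have hself : ∀ j ≤ d, (Finset.range (d + 1)).erase j ∈ A → lorentz
      (N ((Finset.range (d + 1)).erase j)) (N ((Finset.range (d + 1)).erase j)) =
        1 / 2 - 1 / ((d : ℝ) + 1) := by
    intro j hj hA
    rw [hN j hj j hj, if_pos rfl, hαA j hA]; ring
  have hself' : ∀ j ≤ d, (Finset.range (d + 1)).erase j ∉ A → lorentz
      (N ((Finset.range (d + 1)).erase j)) (N ((Finset.range (d + 1)).erase j)) = 0 := by
    intro j hj hA
    rw [hN j hj j hj, if_pos rfl, hαA' j hA]; field_simp; ring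
  have hneg : ∀ i ≤ d, ∀ j ≤ d, i ≠ j → lorentz
      (N ((Finset.range (d + 1)).erase i)) (N ((Finset.range (d + 1)).erase j)) < 0 := by
    intro i hi j hj hij
    rw [hN i hi j hj, if_neg hij]
    have := mul_pos (hαpos i) (hαpos j)
    linarith
  refine ⟨N, v, h, ?_, ?_, ?_, ?_, ?_⟩
  · simp only [Finset.mem_image, Finset.mem_range, Nat.lt_succ_iff]
    rintro F ⟨j, hj, rfl⟩
    rw [h0 j hj]; exact hαpos j
  · simp only [Finset.mem_image, Finset.mem_range, Nat.lt_succ_iff]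
    rintro F ⟨j, hj, rfl⟩ hA
    rw [hself j hj hA]; linarith
  · simp only [Finset.mem_image, Finset.mem_range, Nat.lt_succ_iff]
    rintro F ⟨j, hj, rfl⟩ hA
    exact hself' j hj hA
  · simp only [Finset.mem_image, Finset.mem_range, Nat.lt_succ_iff]
    rintro F ⟨i, hi, rfl⟩ G ⟨j, hj, rfl⟩ hne
    exact hneg i hi j hj (fun he => hne (by rw [he]))
  · simp only [Finset.mem_image, Finset.mem_range, Nat.lt_succ_iff]
    rintro F ⟨i, hi, rfl⟩ G ⟨j, hj, rfl⟩ hne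
    have hij : i ≠ j := fun he => hne (by rw [he])
    have hsq := sq_pos_of_neg (hneg i hi j hj hij)
    by_cases hiA : (Finset.range (d + 1)).erase i ∈ A
    · by_cases hjA : (Finset.range (d + 1)).erase j ∈ A
      · have hαα : α i * α j = 1 / 2 := by
          have : α i = α j := by simp only [α, if_pos hiA, if_pos hjA]
          rw [this, hαA j hjA]
        rw [hself i hi hiA, hself j hj hjA, hN i hi j hj, if_neg hij, hαα]
        nlinarith
      · rw [hself' j hj hjA, mul_zero]; exact hsq
    · rw [hself' i hi hiA, zero_mul]; exact hsq

/-- Stacking onto a facet `F` with a space-like normal: each new normal is in the plane spanned by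
the normals of `F` and of a neighbor of `F`. It is taken light-like, or close to light-like. -/
theorem HasDisjointCaps.stack {A : Set (Finset ℕ)} {N : Finset ℕ → E (d + 1)} {F : Finset ℕ}
    (hN : HasDisjointCaps 𝓕 (insert F A) N) (hc : IsPseudomanifold d n 𝓕)
    (hF : F ∈ 𝓕) {G : ℕ → Finset ℕ}
    (hG : ∀ i ∈ F, IsNeighbor 𝓕 F i (G i)) :
    ∃ s : ℕ → ℝ, (∀ i ∈ F, 0 < s i) ∧ HasDisjointCaps (stackComplex n 𝓕 F) A
      (stackExtend n F N fun i => (1 : ℝ) • N F + s i • N (G i)) := by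
  classical
  have hFn := hc.notMem hF
  have hGF : ∀ i ∈ F, G i ≠ F := fun i hi => (hG i hi).ne hi
  have hs : ∀ i ∈ F, ∃ s > 0, lorentz (N F + s • N (G i)) (N F + s • N (G i)) = 0 ∧
      lorentz (N F + s • N (G i)) (N (G i)) < 0 ∧
      lorentz (N F) (N F) + 2 * (s * lorentz (N F) (N (G i))) ≤ 0 := fun i hi =>
    exists_lightlike (hN.self_pos F hF (Set.mem_insert _ _)) (hN.self_nonneg (hG i hi).mem)
      (hN.neg F hF _ (hG i hi).mem (hGF i hi).symm)
      (hN.lt_sq F hF _ (hG i hi).mem (hGF i hi).symm)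
  choose! s hspos hs0 hsG hsq using hs
  let e : ℕ → ℝ := fun i => if insert n (F.erase i) ∈ A then 1 else 0
  let N' : ℝ → Finset ℕ → E (d + 1) := fun ε =>
    stackExtend n F N fun i => (1 : ℝ) • N F + (s i - ε * e i) • N (G i)
  have hold : ∀ ε, ∀ H ∈ 𝓕, N' ε H = N H := fun ε H hH => stackExtend_old (hc.notMem hH)
  have hnew : ∀ ε, ∀ i ∈ F, N' ε (insert n (F.erase i)) = N F + (s i - ε * e i) • N (G i) := by
    intro ε i hi
    simp only [N', stackExtend_new hFn hi, one_smul]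
  have hnew0 : ∀ i ∈ F, N' 0 (insert n (F.erase i)) = N F + s i • N (G i) := by
    intro i hi
    rw [hnew 0 i hi, zero_mul, sub_zero]
  have hcont : ∀ H H', Continuous fun ε => lorentz (N' ε H) (N' ε H') := by
    have h1 : ∀ H, Continuous fun ε => N' ε H := by
      intro H
      simp only [N', stackExtend]
      split_ifs
      · fun_prop
      · fun_prop
    intro H H'
    have hH := h1 H
    have hH' := h1 H'
    unfold lorentz
    fun_prop
  -- in the limit, the new normals are light-like
  have hself0 : ∀ i ∈ F,
      lorentz (N' 0 (insert n (F.erase i))) (N' 0 (insert n (F.erase i))) = 0 := by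
    intro i hi
    rw [hnew0 i hi, hs0 i hi]
  have hneg_new_old : ∀ i ∈ F, ∀ H ∈ 𝓕, H ≠ F →
      lorentz (N' 0 (insert n (F.erase i))) (N' 0 H) < 0 := by
    intro i hi H hH hHF
    rw [hnew0 i hi, hold 0 H hH]
    by_cases hHG : H = G i
    · rw [hHG]; exact hsG i hi
    · rw [lorentz_add_left, lorentz_smul_left]
      have h1 := hN.neg F hF H hH hHF.symm
      have h2 := hN.neg _ (hG i hi).mem H hH (Ne.symm hHG)
      have := mul_neg_of_pos_of_neg (hspos i hi) h2
      linarith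
  have hneg0 : ∀ H ∈ stackComplex n 𝓕 F, ∀ H' ∈ stackComplex n 𝓕 F, H ≠ H' →
      lorentz (N' 0 H) (N' 0 H') < 0 := by
    intro H hH H' hH' hne
    obtain ⟨hHF, hH⟩ | ⟨i, hi, rfl⟩ := mem_stackComplex.1 hH <;>
      obtain ⟨hHF', hH'⟩ | ⟨j, hj, rfl⟩ := mem_stackComplex.1 hH'
    · rw [hold 0 H hH, hold 0 H' hH']
      exact hN.neg H hH H' hH' hne
    · rw [lorentz_comm]
      exact hneg_new_old j hj H hH hHF
    · exact hneg_new_old i hi H' hH' hHF'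
    · have hij : i ≠ j := fun he => hne (by rw [he])
      have h1 := hN.neg _ (hG i hi).mem _ (hG j hj).mem
        (IsPseudomanifold.neighbor_ne_neighbor hij hi (hG i hi) (hG j hj))
      have h2 := hsq i hi
      have h3 := hsq j hj
      have h4 := mul_neg_of_pos_of_neg (mul_pos (hspos i hi) (hspos j hj)) h1
      rw [hnew0 i hi, hnew0 j hj, lorentz_add_left, lorentz_add_right, lorentz_add_right,
        lorentz_smul_left, lorentz_smul_right, lorentz_smul_left, lorentz_smul_right,
        lorentz_comm (N (G i)) (N F)]
      nlinarith
  have hlt0 : ∀ H ∈ stackComplex n 𝓕 F, ∀ H' ∈ stackComplex n 𝓕 F, H ≠ H' →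
      lorentz (N' 0 H) (N' 0 H) * lorentz (N' 0 H') (N' 0 H') < lorentz (N' 0 H) (N' 0 H') ^ 2 := by
    intro H hH H' hH' hne
    have hsq := sq_pos_of_neg (hneg0 H hH H' hH' hne)
    obtain ⟨hHF, hH⟩ | ⟨i, hi, rfl⟩ := mem_stackComplex.1 hH
    · obtain ⟨hHF', hH'⟩ | ⟨j, hj, rfl⟩ := mem_stackComplex.1 hH'
      · rw [hold 0 H hH, hold 0 H' hH']
        exact hN.lt_sq H hH H' hH' hne
      · rw [hself0 j hj, mul_zero]; exact hsq
    · rw [hself0 i hi, zero_mul]; exact hsq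
  have hev1 : ∀ᶠ ε in nhds (0 : ℝ), ∀ H ∈ stackComplex n 𝓕 F, ∀ H' ∈ stackComplex n 𝓕 F,
      H ≠ H' → lorentz (N' ε H) (N' ε H') < 0 ∧
        lorentz (N' ε H) (N' ε H) * lorentz (N' ε H') (N' ε H') <
          lorentz (N' ε H) (N' ε H') ^ 2 := by
    rw [Finset.eventually_all]
    intro H hH
    rw [Finset.eventually_all]
    intro H' hH'
    by_cases hne : H = H'
    · exact .of_forall fun _ h => absurd hne h
    · have h1 := (hcont H H').continuousAt.eventually_lt continuousAt_const
        (hneg0 H hH H' hH' hne)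
      have h2 := (((hcont H H).mul (hcont H' H')).continuousAt).eventually_lt
        ((hcont H H').pow 2).continuousAt (hlt0 H hH H' hH' hne)
      filter_upwards [h1, h2] with ε h1 h2 _
      exact ⟨h1, h2⟩
  have hev2 : ∀ᶠ ε in nhds (0 : ℝ), ∀ i ∈ F, 0 < s i - ε * e i := by
    rw [Finset.eventually_all]
    intro i hi
    have : Continuous fun ε : ℝ => s i - ε * e i := by fun_prop
    exact continuousAt_const.eventually_lt this.continuousAt (by simpa using hspos i hi)
  obtain ⟨ε, ⟨hε1, hε2⟩, hε⟩ := (((hev1.and hev2).filter_mono nhdsWithin_le_nhds).and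
    (self_mem_nhdsWithin : ∀ᶠ ε in nhdsWithin (0 : ℝ) (Set.Ioi 0), ε ∈ Set.Ioi (0 : ℝ))).exists
  have hself : ∀ i ∈ F, lorentz (N' ε (insert n (F.erase i))) (N' ε (insert n (F.erase i))) =
      ε * e i * (ε * e i * lorentz (N (G i)) (N (G i)) -
        2 * lorentz (N F + s i • N (G i)) (N (G i))) := by
    intro i hi
    have h1 := hs0 i hi
    rw [hnew ε i hi, lorentz_add_smul_self, lorentz_add_left, lorentz_smul_left]
    rw [lorentz_add_smul_self] at h1
    linear_combination h1
  refine ⟨fun i => s i - ε * e i, hε2, ?_, ?_, ?_, fun H hH H' hH' hne => (hε1 H hH H' hH' hne).1,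
    fun H hH H' hH' hne => (hε1 H hH H' hH' hne).2⟩
  · intro H hH
    change 0 < N' ε H 0
    obtain ⟨hHF, hH⟩ | ⟨i, hi, rfl⟩ := mem_stackComplex.1 hH
    · rw [hold ε H hH]; exact hN.time_pos H hH
    · rw [hnew ε i hi, PiLp.add_apply, PiLp.smul_apply, smul_eq_mul]
      exact add_pos (hN.time_pos F hF) (mul_pos (hε2 i hi) (hN.time_pos _ (hG i hi).mem))
  · intro H hH hHA
    change 0 < lorentz (N' ε H) (N' ε H)
    obtain ⟨hHF, hH⟩ | ⟨i, hi, rfl⟩ := mem_stackComplex.1 hH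
    · rw [hold ε H hH]; exact hN.self_pos H hH (Set.mem_insert_of_mem _ hHA)
    · have he : e i = 1 := if_pos hHA
      rw [hself i hi, he, mul_one]
      have h1 := hsG i hi
      have h2 := mul_nonneg (le_of_lt hε) (hN.self_nonneg (hG i hi).mem)
      exact mul_pos hε (by linarith)
  · intro H hH hHA
    change lorentz (N' ε H) (N' ε H) = 0
    obtain ⟨hHF, hH⟩ | ⟨i, hi, rfl⟩ := mem_stackComplex.1 hH
    · rw [hold ε H hH]
      exact hN.self_zero H hH (fun h => (Set.mem_insert_iff.1 h).elim hHF hHA)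
    · have he : e i = 0 := if_neg hHA
      rw [hself i hi, he, mul_zero, zero_mul]

theorem StackedComplex.exists_hasDisjointCaps (hd : 2 ≤ d) (hS : StackedComplex d n 𝓕)
    (A : Set (Finset ℕ)) : ∃ (N : Finset ℕ → E (d + 1)) (v : ℕ → E (d + 1)),
      Realizes n 𝓕 v (fun F => lorentzForm d (N F)) ∧ HasDisjointCaps 𝓕 A N := by
  induction hS generalizing A with
  | simplex => exact hasDisjointCaps_simplex hd A
  | stack n 𝓕 F hS hF ih =>
    obtain ⟨N, v, h, hN⟩ := ih (insert F A)
    have hc := hS.isPseudomanifold hd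
    choose! G hG using hc.exists_neighbor F hF
    obtain ⟨s, hs, hN'⟩ := hN.stack hc hF hG
    obtain ⟨p, hp⟩ := h.exists_stack_normals hc hd hF hG (a := fun _ => 1)
      (fun _ _ => one_pos) hs
    exact ⟨_, _, hp, hN'⟩

/-- Stacked polytopes are circumscribable. -/
theorem IsStacked.isScribable_facets (hd : 2 ≤ d) {P : Set (E d)} (hP : IsStacked P) :
    IsScribable (d - 1) P := by
  obtain ⟨n, 𝓕, w, l', hS, h', rfl⟩ := hP.exists_realizes hd
  have hc := hS.isPseudomanifold hd
  obtain ⟨N, v, h, hN⟩ := hS.exists_hasDisjointCaps hd ∅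
  refine h.isScribable hc hd h' (h.isScribed hc hd (by omega) fun F hF S hSF hcard => ?_)
  obtain rfl : S = F := Finset.eq_of_subset_of_card_le hSF (by rw [hc.card F hF]; omega)
  have h0 := hN.self_zero S hF (Set.notMem_empty S)
  refine isTangent_hull (h.indep S hF) (t := N S) ?_ (hN.time_pos S hF) h0 (h.zero S hF)
  refine h.exists_pos_coeff hc hd (by simp) hF h0 fun i hi => ?_
  obtain ⟨G, hG⟩ := hc.exists_neighbor S hF i hi
  exact ⟨G, hG, hN.neg G hG.mem S hF (hG.ne hi)⟩

end Facets

/-! ### Ridge-scribed realizations -/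

section Ridges

variable {d n : ℕ} {𝓕 : Finset (Finset ℕ)}

/-- The invariant of the construction of ridge-scribed realizations: the normals of adjacent facets
are the poles of externally tangent caps of the light sphere; their sums `T i` represent the points
of tangency, and the points of tangency of each cap with its neighbors form, up to a conformal map,
the vertices of a regular simplex. -/
structure HasTangentCaps (𝓕 : Finset (Finset ℕ)) (N : Finset ℕ → E (d + 1)) : Prop where
  time_pos : ∀ F ∈ 𝓕, 0 < N F 0
  self : ∀ F ∈ 𝓕, lorentz (N F) (N F) = 1
  tangent : ∀ F ∈ 𝓕, ∃ (c : ℕ → ℝ) (T : ℕ → E (d + 1)), (∀ i ∈ F, 0 < c i) ∧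
    (∀ i ∈ F, ∀ G, IsNeighbor 𝓕 F i G → N F + N G = T i ∧ lorentz (N F) (N G) = -1) ∧
    ∀ i ∈ F, ∀ j ∈ F, i ≠ j → lorentz (T i) (T j) = -2 * c i * c j

theorem hasTangentCaps_simplex (hd : 2 ≤ d) :
    ∃ (N : Finset ℕ → E (d + 1)) (v : ℕ → E (d + 1)),
      Realizes (d + 1) ((Finset.range (d + 1)).image (Finset.range (d + 1)).erase) v
        (fun F => lorentzForm d (N F)) ∧
      HasTangentCaps ((Finset.range (d + 1)).image (Finset.range (d + 1)).erase) N := by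
  have hd' : (2 : ℝ) ≤ d := by exact_mod_cast hd
  have hpos : (0 : ℝ) < (d - 1) / (2 * (d + 1)) := div_pos (by linarith) (by linarith)
  have hα : 0 < √(((d : ℝ) - 1) / (2 * (d + 1))) := Real.sqrt_pos.2 hpos
  have hr : 0 < √(2 : ℝ) := Real.sqrt_pos.2 (by norm_num)
  obtain ⟨N, v, h, h0, hN⟩ := exists_realizes_regular d (α := fun _ => √((d - 1) / (2 * (d + 1))))
    (fun _ => hα) hr
  have h1 : (d : ℝ) + 1 ≠ 0 := by positivity
  have hN' : ∀ i ≤ d, ∀ j ≤ d, lorentz (N ((Finset.range (d + 1)).erase i))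
        (N ((Finset.range (d + 1)).erase j)) = if i = j then 1 else -1 := by
    intro i hi j hj
    rw [hN i hi j hj, Real.sq_sqrt (by norm_num), Real.mul_self_sqrt hpos.le]
    split_ifs
    · field_simp; ring
    · field_simp; ring
  refine ⟨N, v, h, ?_, ?_, ?_⟩
  · simp only [Finset.mem_image, Finset.mem_range, Nat.lt_succ_iff]
    rintro F ⟨j, hj, rfl⟩
    rw [h0 j hj]; positivity
  · simp only [Finset.mem_image, Finset.mem_range, Nat.lt_succ_iff]
    rintro F ⟨j, hj, rfl⟩
    rw [hN' j hj j hj, if_pos rfl]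
  · intro F hF
    obtain ⟨k, hk, rfl⟩ := Finset.mem_image.1 hF
    rw [Finset.mem_range, Nat.lt_succ_iff] at hk
    refine ⟨fun _ => 1, fun i => N ((Finset.range (d + 1)).erase k) +
      N ((Finset.range (d + 1)).erase i), fun _ _ => one_pos, ?_, ?_⟩
    · intro i hi G hG
      have hik := (Finset.mem_erase.1 hi).1
      have hid := Nat.lt_succ_iff.1 (Finset.mem_range.1 (Finset.mem_of_mem_erase hi))
      obtain ⟨m, hm, rfl⟩ := Finset.mem_image.1 hG.mem
      have hmi : m = i := by
        by_contra hne
        exact hG.notMem (Finset.mem_erase.2 ⟨fun e => hne e.symm, Finset.mem_of_mem_erase hi⟩)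
      subst hmi
      exact ⟨rfl, by rw [hN' k hk m hid, if_neg hik.symm]⟩
    · intro i hi j hj hij
      have hik := (Finset.mem_erase.1 hi).1
      have hjk := (Finset.mem_erase.1 hj).1
      have hid := Nat.lt_succ_iff.1 (Finset.mem_range.1 (Finset.mem_of_mem_erase hi))
      have hjd := Nat.lt_succ_iff.1 (Finset.mem_range.1 (Finset.mem_of_mem_erase hj))
      rw [lorentz_add_left, lorentz_add_right, lorentz_add_right, hN' k hk k hk, hN' k hk j hjd,
        hN' i hid k hk, hN' i hid j hjd, if_pos rfl, if_neg hjk.symm, if_neg hik, if_neg hij]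
      norm_num

/-- Stacking onto a facet `F`: the caps of the new facets are mutually tangent caps inside the cap
of `F`, touching it in the points where it touches its neighbors. -/
theorem HasTangentCaps.stack {N : Finset ℕ → E (d + 1)} {F : Finset ℕ}
    (hN : HasTangentCaps 𝓕 N) (hc : IsPseudomanifold d n 𝓕) (hd : 2 ≤ d)
    (hF : F ∈ 𝓕) {G : ℕ → Finset ℕ} (hG : ∀ i ∈ F, IsNeighbor 𝓕 F i (G i)) :
    ∃ a b : ℕ → ℝ, (∀ i ∈ F, 0 < a i) ∧ (∀ i ∈ F, 0 < b i) ∧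
      HasTangentCaps (stackComplex n 𝓕 F)
        (stackExtend n F N fun i => a i • N F + b i • N (G i)) := by
  have hFn := hc.notMem hF
  have hc' := hc.stack hd hF
  obtain ⟨c, T, hcpos, hT, hTT⟩ := hN.tangent F hF
  have hTG : ∀ i ∈ F, N F + N (G i) = T i := fun i hi => (hT i hi _ (hG i hi)).1
  have hNG : ∀ i ∈ F, lorentz (N F) (N (G i)) = -1 := fun i hi => (hT i hi _ (hG i hi)).2
  have hNN := hN.self F hF
  have hNT : ∀ i ∈ F, lorentz (N F) (T i) = 0 := fun i hi => by
    rw [← hTG i hi, lorentz_add_right, hNN, hNG i hi]; norm_num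
  have hTself : ∀ i ∈ F, lorentz (T i) (T i) = 0 := fun i hi => by
    conv_lhs => rw [← hTG i hi]
    rw [lorentz_add_left, lorentz_add_right, lorentz_add_right, lorentz_comm (N (G i)), hNN,
      hNG i hi, hN.self _ (hG i hi).mem]
    norm_num
  set N' := stackExtend n F N fun i => (1 + (c i)⁻¹) • N F + (c i)⁻¹ • N (G i) with hN'
  have hold : ∀ H ∈ 𝓕, N' H = N H := fun H hH => stackExtend_old (hc.notMem hH)
  have hnew : ∀ i ∈ F, N' (insert n (F.erase i)) = N F + (c i)⁻¹ • T i := by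
    intro i hi
    rw [hN', stackExtend_new hFn hi, ← hTG i hi]
    module
  have hself_new : ∀ i ∈ F,
      lorentz (N' (insert n (F.erase i))) (N' (insert n (F.erase i))) = 1 := by
    intro i hi
    rw [hnew i hi, lorentz_add_smul_self, hNN, hNT i hi, hTself i hi]; ring
  have hnewT : ∀ i ∈ F, ∀ j ∈ F, i ≠ j →
      lorentz (N' (insert n (F.erase i))) (T j) = -2 * c j := by
    intro i hi j hj hij
    rw [hnew i hi, lorentz_add_left, lorentz_smul_left, hNT j hj, hTT i hi j hj hij]
    have := (hcpos i hi).ne'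
    field_simp; ring
  have hnewT' : ∀ i ∈ F, lorentz (N' (insert n (F.erase i))) (T i) = 0 := by
    intro i hi
    rw [hnew i hi, lorentz_add_left, lorentz_smul_left, hNT i hi, hTself i hi]; ring
  have hnew_new : ∀ i ∈ F, ∀ j ∈ F, i ≠ j →
      lorentz (N' (insert n (F.erase i))) (N' (insert n (F.erase j))) = -1 := by
    intro i hi j hj hij
    conv_lhs => rw [hnew j hj, lorentz_add_right, lorentz_smul_right, hnewT i hi j hj hij, hnew i hi,
      lorentz_add_left, lorentz_smul_left, lorentz_comm (T i), hNN, hNT i hi]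
    have := (hcpos j hj).ne'
    field_simp; norm_num
  have hnew_old : ∀ i ∈ F, lorentz (N' (insert n (F.erase i))) (N (G i)) = -1 := by
    intro i hi
    have h1 : N (G i) = T i - N F := by rw [← hTG i hi]; abel
    rw [h1, lorentz_sub_right, hnewT' i hi, hnew i hi, lorentz_add_left, lorentz_smul_left,
      lorentz_comm (T i), hNN, hNT i hi]
    norm_num
  have hsum : ∀ i ∈ F, N' (insert n (F.erase i)) + N (G i) = (1 + (c i)⁻¹) • T i := by
    intro i hi
    rw [hnew i hi, add_smul, one_smul]
    nth_rewrite 2 [← hTG i hi]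
    abel
  refine ⟨fun i => 1 + (c i)⁻¹, fun i => (c i)⁻¹, ?_, ?_, ?_, ?_, ?_⟩
  · intro i hi
    have := inv_pos.2 (hcpos i hi)
    linarith
  · exact fun i hi => inv_pos.2 (hcpos i hi)
  · intro H hH
    change 0 < N' H 0
    obtain ⟨hHF, hH⟩ | ⟨i, hi, rfl⟩ := mem_stackComplex.1 hH
    · rw [hold H hH]; exact hN.time_pos H hH
    · have h1 := hN.time_pos F hF
      have h2 := hN.time_pos _ (hG i hi).mem
      have h3 := inv_pos.2 (hcpos i hi)
      rw [hnew i hi, ← hTG i hi, PiLp.add_apply, PiLp.smul_apply, PiLp.add_apply, smul_eq_mul]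
      positivity
  · intro H hH
    change lorentz (N' H) (N' H) = 1
    obtain ⟨hHF, hH⟩ | ⟨i, hi, rfl⟩ := mem_stackComplex.1 hH
    · rw [hold H hH]; exact hN.self H hH
    · exact hself_new i hi
  · intro H hH'
    change ∃ (c : ℕ → ℝ) (T : ℕ → E (d + 1)), (∀ i ∈ H, 0 < c i) ∧
      (∀ i ∈ H, ∀ K, IsNeighbor (stackComplex n 𝓕 F) H i K →
        N' H + N' K = T i ∧ lorentz (N' H) (N' K) = -1) ∧
      ∀ i ∈ H, ∀ j ∈ H, i ≠ j → lorentz (T i) (T j) = -2 * c i * c j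
    obtain ⟨hHF, hH⟩ | ⟨i, hi, rfl⟩ := mem_stackComplex.1 hH'
    · -- an old facet: some of its points of tangency are rescaled
      obtain ⟨cH, TH, hcH, hTH, hTTH⟩ := hN.tangent H hH
      have hμ : ∀ j ∈ H, ∃ μ : ℝ, 0 < μ ∧ ∀ K, IsNeighbor (stackComplex n 𝓕 F) H j K →
          N' H + N' K = μ • TH j ∧ lorentz (N' H) (N' K) = -1 := by
        intro j hj
        obtain ⟨K₀, hK₀⟩ := hc.exists_neighbor H hH j hj
        by_cases hKF : K₀ = F
        · subst hKF
          obtain ⟨i, hi, hiH, hij, hnb⟩ := hc.neighbor_symm hH hj hK₀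
          have hHG : H = G i := hc.neighbor_unique hF hi (hG i hi) hnb
          have hpos := inv_pos.2 (hcpos i hi)
          refine ⟨1 + (c i)⁻¹, by linarith, fun K hK => ?_⟩
          obtain rfl := hc'.neighbor_unique hH' hj
            (hc.neighbor_old_new hH hj hi hK₀.notMem hij.symm) hK
          have h1 : TH j = T i := by
            rw [← (hTH j hj K₀ hK₀).1, ← hTG i hi, hHG]
            abel
          rw [hold H hH, hHG, h1, lorentz_comm, hnew_old i hi, ← hsum i hi]
          exact ⟨by abel, rfl⟩
        · refine ⟨1, one_pos, fun K hK => ?_⟩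
          obtain rfl := hc'.neighbor_unique hH' hj
            (IsPseudomanifold.neighbor_old_old hKF hK₀) hK
          rw [hold H hH, hold K hK₀.mem, one_smul]
          exact hTH j hj K hK₀
      choose! μ hμpos hμ using hμ
      refine ⟨fun j => μ j * cH j, fun j => μ j • TH j, fun j hj => mul_pos (hμpos j hj) (hcH j hj),
        hμ, fun j hj k hk hjk => ?_⟩
      rw [lorentz_smul_left, lorentz_smul_right, hTTH j hj k hk hjk]
      ring
    · -- a new facet
      refine ⟨fun j => if j = n then c i + 1 else 1, fun j => if j = n then (1 + (c i)⁻¹) • T i else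
        N' (insert n (F.erase i)) + N' (insert n (F.erase j)), ?_, ?_, ?_⟩
      · intro j _
        have := hcpos i hi
        dsimp only
        split_ifs <;> linarith
      · intro j hj K hK
        obtain rfl | hj' := Finset.mem_insert.1 hj
        · obtain rfl := hc'.neighbor_unique hH' hj (hc.neighbor_new_base hF hi (hG i hi)) hK
          beta_reduce
          rw [if_pos rfl, hold _ (hG i hi).mem]
          exact ⟨hsum i hi, hnew_old i hi⟩
        · have hjn : j ≠ n := fun e => hFn (e ▸ Finset.mem_of_mem_erase hj')
          obtain rfl := hc'.neighbor_unique hH' hj (hc.neighbor_new_new hF hj') hK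
          beta_reduce
          rw [if_neg hjn]
          exact ⟨rfl, hnew_new i hi j (Finset.mem_of_mem_erase hj') (Finset.ne_of_mem_erase hj').symm⟩
      · have hcross : ∀ j ∈ F.erase i, lorentz ((1 + (c i)⁻¹) • T i)
            (N' (insert n (F.erase i)) + N' (insert n (F.erase j))) = -2 * (c i + 1) := by
          intro j hj
          rw [lorentz_smul_left, lorentz_comm, lorentz_add_left, hnewT' i hi,
            hnewT j (Finset.mem_of_mem_erase hj) i hi (Finset.ne_of_mem_erase hj)]
          have := (hcpos i hi).ne'
          field_simp; ring
        intro j hj k hk hjk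
        beta_reduce
        obtain rfl | hj' := Finset.mem_insert.1 hj
        · have hk' := (Finset.mem_insert.1 hk).resolve_left hjk.symm
          rw [if_pos rfl, if_pos rfl, if_neg hjk.symm, if_neg hjk.symm, hcross k hk', mul_one]
        · have hjn : j ≠ n := fun e => hFn (e ▸ Finset.mem_of_mem_erase hj')
          obtain rfl | hk' := Finset.mem_insert.1 hk
          · rw [if_pos rfl, if_pos rfl, if_neg hjk, if_neg hjk, lorentz_comm, hcross j hj']
            ring
          · have hkn : k ≠ n := fun e => hFn (e ▸ Finset.mem_of_mem_erase hk')
            have hjF := Finset.mem_of_mem_erase hj'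
            have hkF := Finset.mem_of_mem_erase hk'
            rw [if_neg hjn, if_neg hkn, if_neg hjn, if_neg hkn, lorentz_add_left,
              lorentz_add_right, lorentz_add_right, hself_new i hi,
              hnew_new i hi k hkF (Finset.ne_of_mem_erase hk').symm,
              hnew_new j hjF i hi (Finset.ne_of_mem_erase hj'), hnew_new j hjF k hkF hjk]
            norm_num

theorem StackedComplex.exists_hasTangentCaps (hd : 2 ≤ d) (hS : StackedComplex d n 𝓕) :
    ∃ (N : Finset ℕ → E (d + 1)) (v : ℕ → E (d + 1)),
      Realizes n 𝓕 v (fun F => lorentzForm d (N F)) ∧ HasTangentCaps 𝓕 N := by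
  induction hS with
  | simplex => exact hasTangentCaps_simplex hd
  | stack n 𝓕 F hS hF ih =>
    obtain ⟨N, v, h, hN⟩ := ih
    have hc := hS.isPseudomanifold hd
    choose! G hG using hc.exists_neighbor F hF
    obtain ⟨a, b, ha, hb, hN'⟩ := hN.stack hc hd hF hG
    obtain ⟨p, hp⟩ := h.exists_stack_normals hc hd hF hG ha hb
    exact ⟨_, _, hp, hN'⟩

/-- Stacked polytopes are ridge-scribable. -/
theorem IsStacked.isScribable_ridges (hd : 2 ≤ d) {P : Set (E d)} (hP : IsStacked P) :
    IsScribable (d - 2) P := by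
  obtain ⟨n, 𝓕, w, l', hS, h', rfl⟩ := hP.exists_realizes hd
  have hc := hS.isPseudomanifold hd
  obtain ⟨N, v, h, hN⟩ := hS.exists_hasTangentCaps hd
  refine h.isScribable hc hd h' (h.isScribed hc hd (by omega) fun F hF S hSF hcard => ?_)
  obtain ⟨i, hi, rfl⟩ : ∃ i ∈ F, S = F.erase i := by
    obtain ⟨i, hi, hiS⟩ : ∃ i ∈ F, i ∉ S := by
      by_contra! hcon
      have := Finset.card_le_card (show F ⊆ S from hcon)
      rw [hc.card F hF] at this
      omega
    refine ⟨i, hi, Finset.eq_of_subset_of_card_le ?_ ?_⟩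
    · exact fun x hx => Finset.mem_erase.2 ⟨fun e => hiS (e ▸ hx), hSF hx⟩
    · have := Finset.card_erase_add_one hi
      rw [hc.card F hF] at this
      omega
  obtain ⟨G, hG⟩ := hc.exists_neighbor F hF i hi
  obtain ⟨c, T, hcpos, hT, hTT⟩ := hN.tangent F hF
  obtain ⟨hTi, hFG⟩ := hT i hi G hG
  have hFF := hN.self F hF
  have hGG := hN.self G hG.mem
  have hFT : lorentz (N F) (T i) = 0 := by
    rw [← hTi, lorentz_add_right, hFF, hFG]; norm_num
  have hGT : lorentz (N G) (T i) = 0 := by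
    rw [← hTi, lorentz_add_right, lorentz_comm, hGG, hFG]; norm_num
  refine isTangent_hull ((h.indep F hF).mono (Finset.coe_subset.2 hSF)) (t := T i) ?_ ?_ ?_ ?_
  · obtain ⟨a, ha⟩ := h.exists_coeff hc hd (by simp) hF (x := T i) hFT
    have hnb : ∀ k ∈ F, ∀ H, IsNeighbor 𝓕 F k H → lorentz (N H) (T i) = a k * lorentz (N H) (v k) := by
      intro k hk H hH
      conv_lhs => rw [ha]
      exact h.apply_neighbor hk hH a
    have hneg : ∀ k ∈ F, ∀ H, IsNeighbor 𝓕 F k H → lorentz (N H) (v k) < 0 := fun k hk H hH =>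
      h.neg H hH.mem k (hc.lt F hF k hk) hH.notMem
    have hai : a i = 0 := by
      have := hnb i hi G hG
      rw [hGT] at this
      exact (mul_eq_zero.1 this.symm).resolve_right (hneg i hi G hG).ne
    refine ⟨a, fun k hk => ?_, ?_⟩
    · have hkF := Finset.mem_of_mem_erase hk
      obtain ⟨H, hH⟩ := hc.exists_neighbor F hF k hkF
      have h1 := hnb k hkF H hH
      have h2 := hneg k hkF H hH
      have h3 : N H = T k - N F := by rw [← (hT k hkF H hH).1]; abel
      rw [h3, lorentz_sub_left, hFT, hTT k hkF i hi (Finset.ne_of_mem_erase hk), ← h3] at h1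
      have h4 := mul_pos (hcpos k hkF) (hcpos i hi)
      by_contra! hcon
      have := mul_nonneg_of_nonpos_of_nonpos hcon h2.le
      linarith
    · rw [ha, ← Finset.add_sum_erase F _ hi, hai, zero_smul, zero_add]
  · rw [← hTi, PiLp.add_apply]
    exact add_pos (hN.time_pos F hF) (hN.time_pos G hG.mem)
  · nth_rewrite 1 [← hTi]
    rw [lorentz_add_left, hFT, hGT, add_zero]
  · intro k hk
    have h1 : lorentz (N F) (v k) = 0 := h.zero F hF k (Finset.mem_of_mem_erase hk)
    have h2 : lorentz (N G) (v k) = 0 := h.zero G hG.mem k (hG.subset hk)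
    rw [← hTi, lorentz_add_left, h1, h2, add_zero]

end Ridges

/-! ### An angle-sum obstruction -/

section Angles

open Real

/-- The angles of a triangle with given sides. -/
theorem exists_triangle_angles {A B C : ℝ} (hA : 0 < A) (hB : 0 < B) (hC : 0 < C)
    (h1 : A < B + C) (h2 : B < A + C) (h3 : C < A + B) :
    ∃ α β γ k : ℝ, 0 < α ∧ 0 < β ∧ 0 < γ ∧ α + β + γ = π ∧ 0 < k ∧
      A = k * sin α ∧ B = k * sin β ∧ C = k * sin γ := by
  set S := (A + B + C) * (B + C - A) * (A + C - B) * (A + B - C) with hS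
  have hSpos : 0 < S := by
    have : 0 < B + C - A := by linarith
    have : 0 < A + C - B := by linarith
    have : 0 < A + B - C := by linarith
    positivity
  have hr := sqrt_pos.2 hSpos
  have hsin : ∀ x y z : ℝ, 0 < x → 0 < y → 0 < z →
      (x + y + z) * (y + z - x) * (x + z - y) * (x + y - z) = S →
      0 < arccos ((y ^ 2 + z ^ 2 - x ^ 2) / (2 * y * z)) ∧
      arccos ((y ^ 2 + z ^ 2 - x ^ 2) / (2 * y * z)) < π ∧
      cos (arccos ((y ^ 2 + z ^ 2 - x ^ 2) / (2 * y * z))) = (y ^ 2 + z ^ 2 - x ^ 2) / (2 * y * z) ∧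
      sin (arccos ((y ^ 2 + z ^ 2 - x ^ 2) / (2 * y * z))) = √S / (2 * y * z) := by
    intro x y z hx hy hz hxyz
    set q := (y ^ 2 + z ^ 2 - x ^ 2) / (2 * y * z) with hq
    have h1 : 1 - q ^ 2 = S / (2 * y * z) ^ 2 := by
      rw [hq, ← hxyz]; field_simp; ring
    have h2 : q ^ 2 < 1 := by
      have : 0 < S / (2 * y * z) ^ 2 := by positivity
      linarith
    have h3 := abs_lt.1 ((sq_lt_one_iff_abs_lt_one q).1 h2)
    refine ⟨arccos_pos.2 h3.2, ?_, cos_arccos h3.1.le h3.2.le, ?_⟩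
    · refine lt_of_le_of_ne (arccos_le_pi q) fun h => ?_
      rw [arccos_eq_pi] at h
      linarith
    · rw [sin_arccos, h1, sqrt_div hSpos.le, sqrt_sq (by positivity)]
  obtain ⟨ha0, haπ, hac, has⟩ := hsin A B C hA hB hC rfl
  obtain ⟨hb0, hbπ, hbc, hbs⟩ := hsin B A C hB hA hC (by rw [hS]; ring)
  set α := arccos ((B ^ 2 + C ^ 2 - A ^ 2) / (2 * B * C))
  set β := arccos ((A ^ 2 + C ^ 2 - B ^ 2) / (2 * A * C))
  have hsum : sin (α + β) = √S / (2 * A * B) := by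
    rw [sin_add, has, hbs, hac, hbc]; field_simp; ring
  have hlt : α + β < π := by
    by_contra! hcon
    have h1 : sin (α + β - π) = - sin (α + β) := sin_sub_pi _
    have h2 : 0 ≤ sin (α + β - π) := sin_nonneg_of_nonneg_of_le_pi (by linarith) (by linarith)
    have h3 : 0 < √S / (2 * A * B) := by positivity
    linarith
  refine ⟨α, β, π - (α + β), 2 * A * B * C / √S, ha0, hb0, by linarith, by ring, by positivity,
    ?_, ?_, ?_⟩
  · rw [has]; field_simp
  · rw [hbs]; field_simp
  · rw [sin_pi_sub, hsum]; field_simp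

/-- `x = cos α + sin α cot φ` has a solution `φ` in `(0, π - α)`. -/
theorem exists_angle {α x : ℝ} (hα : 0 < α) (hα' : α < π) (hx : 0 < x) :
    ∃ φ X : ℝ, 0 < φ ∧ α + φ < π ∧ x = cos α + sin α * X ∧ cos φ = X * sin φ := by
  have hs := sin_pos_of_pos_of_lt_pi hα hα'
  set X := (x - cos α) / sin α with hX
  have hxX : x = cos α + sin α * X := by rw [hX]; field_simp; ring
  have hc : cos (π / 2 - arctan X) = X * sin (π / 2 - arctan X) := by
    rw [cos_pi_div_two_sub, sin_pi_div_two_sub]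
    have := tan_mul_cos (cos_arctan_pos X).ne'
    rw [tan_arctan] at this
    exact this.symm
  have h1 := arctan_lt_pi_div_two X
  have h2 := neg_pi_div_two_lt_arctan X
  set φ := π / 2 - arctan X with hφ
  have hφs : 0 < sin φ := sin_pos_of_pos_of_lt_pi (by rw [hφ]; linarith) (by rw [hφ]; linarith)
  have hsum : sin (α + φ) = x * sin φ := by
    rw [sin_add, hc, hxX]; ring
  refine ⟨φ, X, by rw [hφ]; linarith, ?_, hxX, hc⟩
  by_contra! hcon
  have h3 : sin (α + φ - π) = - sin (α + φ) := sin_sub_pi _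
  have h4 : 0 ≤ sin (α + φ - π) := sin_nonneg_of_nonneg_of_le_pi (by linarith)
    (by rw [hφ]; linarith)
  have := mul_pos hx hφs
  linarith

/-- If `x = sin (α + φ) / sin φ` and `x' = sin (α + φ') / sin φ'`, then `x * x' > 1` says that the
angles `α`, `φ` and `φ'`, which meet along an edge, add up to less than `π`. Here `X` and `X'` are
the cotangents of `φ` and `φ'`. -/
theorem angle_pair_lt {α x x' φ φ' X X' : ℝ} (hα : 0 < α) (hα' : α < π) (hφ : 0 < φ)
    (hφ' : 0 < φ') (hαφ : α + φ < π) (hαφ' : α + φ' < π) (hx : x = cos α + sin α * X)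
    (hX : cos φ = X * sin φ) (hx' : x' = cos α + sin α * X') (hX' : cos φ' = X' * sin φ')
    (h : 1 < x * x') : α + φ + φ' < π := by
  have hs := sin_pos_of_pos_of_lt_pi hα hα'
  have hsφ := sin_pos_of_pos_of_lt_pi hφ (by linarith)
  have hsφ' := sin_pos_of_pos_of_lt_pi hφ' (by linarith)
  have hid : sin α * sin (α + φ + φ') = sin φ * sin φ' * (x * x' - 1) := by
    rw [sin_add, sin_add α φ, cos_add α φ, hX, hX', hx, hx']
    linear_combination -(sin φ * sin φ') * (sin_sq_add_cos_sq α)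
  have hpos : 0 < sin α * sin (α + φ + φ') := by
    rw [hid]; exact mul_pos (mul_pos hsφ hsφ') (by linarith)
  by_contra! hcon
  have h3 : sin (α + φ + φ' - π) = - sin (α + φ + φ') := sin_sub_pi _
  have h4 : 0 ≤ sin (α + φ + φ' - π) :=
    sin_nonneg_of_nonneg_of_le_pi (by linarith) (by linarith)
  nlinarith

/-- In the coordinates `x = cos α + sin α cot φ` and so on, the quadratic inequality `h` becomes
`cot φ cot ψ + cot φ cot χ + cot ψ cot χ ≤ 1`, so that `φ + ψ + χ ≥ π`. Equality holds for the
dihedral angles of an ideal tetrahedron. -/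
theorem angle_sum_ge {α β γ x y z φ ψ χ X Y Z : ℝ} (hα : 0 < α) (hβ : 0 < β) (hγ : 0 < γ)
    (hsum : α + β + γ = π) (hφ : 0 < φ) (hψ : 0 < ψ) (hχ : 0 < χ) (hαφ : α + φ < π)
    (hβψ : β + ψ < π) (hγχ : γ + χ < π)
    (hx : x = cos α + sin α * X) (hX : cos φ = X * sin φ)
    (hy : y = cos β + sin β * Y) (hY : cos ψ = Y * sin ψ)
    (hz : z = cos γ + sin γ * Z) (hZ : cos χ = Z * sin χ)
    (h : sin γ * (x * y) + sin β * (x * z) + sin α * (y * z) ≤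
      sin α * x + sin β * y + sin γ * z) : π ≤ φ + ψ + χ := by
  have hsα := sin_pos_of_pos_of_lt_pi hα (by linarith)
  have hsβ := sin_pos_of_pos_of_lt_pi hβ (by linarith)
  have hsγ := sin_pos_of_pos_of_lt_pi hγ (by linarith)
  have hsφ := sin_pos_of_pos_of_lt_pi hφ (by linarith)
  have hsψ := sin_pos_of_pos_of_lt_pi hψ (by linarith)
  have hsχ := sin_pos_of_pos_of_lt_pi hχ (by linarith)
  have hα' : α = π - (β + γ) := by linarith
  have hβ' : β = π - (α + γ) := by linarith
  have hγ' : γ = π - (α + β) := by linarith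
  have s1 : sin α = sin β * cos γ + cos β * sin γ := by
    conv_lhs => rw [hα', sin_pi_sub, sin_add]
  have s2 : sin β = sin α * cos γ + cos α * sin γ := by
    conv_lhs => rw [hβ', sin_pi_sub, sin_add]
  have s3 : sin γ = sin α * cos β + cos α * sin β := by
    conv_lhs => rw [hγ', sin_pi_sub, sin_add]
  have c1 : cos α = sin β * sin γ - cos β * cos γ := by
    conv_lhs => rw [hα', cos_pi_sub, cos_add]
    ring
  have c2 : cos β = sin α * sin γ - cos α * cos γ := by
    conv_lhs => rw [hβ', cos_pi_sub, cos_add]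
    ring
  have c3 : cos γ = sin α * sin β - cos α * cos β := by
    conv_lhs => rw [hγ', cos_pi_sub, cos_add]
    ring
  have hid : sin α * x + sin β * y + sin γ * z -
      (sin γ * (x * y) + sin β * (x * z) + sin α * (y * z)) =
      sin α * sin β * sin γ * (1 - (X * Y + X * Z + Y * Z)) := by
    rw [hx, hy, hz]
    linear_combination (sin α * c1 + sin β * c2 + sin γ * c3) +
      X * sin α * s1 + Y * sin β * s2 + Z * sin γ * s3 +
      2 * (cos α * s1 - sin α * c1)
  have hXYZ : X * Y + X * Z + Y * Z ≤ 1 := by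
    have : 0 ≤ sin α * sin β * sin γ * (1 - (X * Y + X * Z + Y * Z)) := by linarith
    have := nonneg_of_mul_nonneg_right this (by positivity)
    linarith
  have hsin : sin (φ + ψ + χ) = sin φ * sin ψ * sin χ * (X * Y + X * Z + Y * Z - 1) := by
    rw [sin_add, sin_add φ ψ, cos_add φ ψ, hX, hY, hZ]; ring
  by_contra! hcon
  have h5 := sin_pos_of_pos_of_lt_pi (x := φ + ψ + χ) (by linarith) hcon
  rw [hsin] at h5
  have := pos_of_mul_pos_right h5 (show 0 ≤ sin φ * sin ψ * sin χ by positivity)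
  linarith

/-- The angles between the faces of an ideal tetrahedron with opposite dihedral angles `α`, `β`,
`γ` and four further ideal tetrahedra stacked onto its faces cannot all be convex. Here `A`, `B`,
`C` are proportional to the sines of the angles, and `x i`, `y i`, `z i` are the coordinates of the
`i`-th stacked vertex. -/
theorem four_stacked_contradiction {A B C : ℝ} (hA : 0 < A) (hB : 0 < B) (hC : 0 < C)
    (h1 : A < B + C) (h2 : B < A + C) (h3 : C < A + B) {x y z : Fin 4 → ℝ}
    (hx : ∀ i, 0 < x i) (hy : ∀ i, 0 < y i) (hz : ∀ i, 0 < z i)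
    (hQ : ∀ i, C * (x i * y i) + B * (x i * z i) + A * (y i * z i) ≤ A * x i + B * y i + C * z i)
    (hx01 : 1 < x 0 * x 1) (hx23 : 1 < x 2 * x 3) (hy02 : 1 < y 0 * y 2) (hy13 : 1 < y 1 * y 3)
    (hz03 : 1 < z 0 * z 3) (hz12 : 1 < z 1 * z 2) : False := by
  obtain ⟨α, β, γ, k, hα, hβ, hγ, hsum, hk, rfl, rfl, rfl⟩ := exists_triangle_angles hA hB hC h1 h2 h3
  choose φ X hφ hαφ hxX hX using fun i => exists_angle hα (by linarith) (hx i)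
  choose ψ Y hψ hβψ hyY hY using fun i => exists_angle hβ (by linarith) (hy i)
  choose χ Z hχ hγχ hzZ hZ using fun i => exists_angle hγ (by linarith) (hz i)
  have hge : ∀ i, π ≤ φ i + ψ i + χ i := by
    intro i
    refine angle_sum_ge hα hβ hγ hsum (hφ i) (hψ i) (hχ i) (hαφ i) (hβψ i) (hγχ i) (hxX i) (hX i)
      (hyY i) (hY i) (hzZ i) (hZ i) (le_of_mul_le_mul_left ?_ hk)
    have := hQ i
    linarith
  have p1 := angle_pair_lt hα (by linarith) (hφ 0) (hφ 1) (hαφ 0) (hαφ 1) (hxX 0) (hX 0) (hxX 1)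
    (hX 1) hx01
  have p2 := angle_pair_lt hα (by linarith) (hφ 2) (hφ 3) (hαφ 2) (hαφ 3) (hxX 2) (hX 2) (hxX 3)
    (hX 3) hx23
  have p3 := angle_pair_lt hβ (by linarith) (hψ 0) (hψ 2) (hβψ 0) (hβψ 2) (hyY 0) (hY 0) (hyY 2)
    (hY 2) hy02
  have p4 := angle_pair_lt hβ (by linarith) (hψ 1) (hψ 3) (hβψ 1) (hβψ 3) (hyY 1) (hY 1) (hyY 3)
    (hY 3) hy13
  have p5 := angle_pair_lt hγ (by linarith) (hχ 0) (hχ 3) (hγχ 0) (hγχ 3) (hzZ 0) (hZ 0) (hzZ 3)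
    (hZ 3) hz03
  have p6 := angle_pair_lt hγ (by linarith) (hχ 1) (hχ 2) (hγχ 1) (hγχ 2) (hzZ 1) (hZ 1) (hzZ 2)
    (hZ 2) hz12
  linarith [hge 0, hge 1, hge 2, hge 3]

end Angles

section Null

variable {d : ℕ}

/-- Adding a future vector to a time-like future vector gives a time-like vector. So a vector `q`
cannot be time-like if both `q` and `-q` become light-like by adding future vectors. -/
theorem lorentz_self_nonneg_of_null {q u y : E (d + 1)} (hu : IsFuture u) (hy : IsFuture y)
    (hqu : lorentz (q + u) (q + u) = 0) (hyq : lorentz (y - q) (y - q) = 0) :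
    0 ≤ lorentz q q := by
  have key : ∀ w y : E (d + 1), lorentz w w < 0 → 0 ≤ w 0 → IsFuture y →
      lorentz (w + y) (w + y) < 0 := by
    intro w y hw hw0 hy
    have h1 := IsFuture.lorentz_nonpos ⟨hw.le, hw0⟩ hy
    rw [lorentz_add_left, lorentz_add_right, lorentz_add_right, lorentz_comm y w]
    linarith [hy.1]
  by_contra! hcon
  rcases le_total 0 (q 0) with h0 | h0
  · exact (key q u hcon h0 hu).ne hqu
  · have := key (-q) y (by rw [lorentz_neg_left, lorentz_neg_right, neg_neg]; exact hcon)
      (by simpa using h0) hy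
    rw [neg_add_eq_sub] at this
    exact this.ne hyq

/-- Four light-like vectors `t i`, scaled so that opposite pairs have the same scalar product, do
not admit four light-like points stacked onto the faces of their simplex. -/
theorem stacked_null_contradiction_of_scaled {t p u : Fin 4 → E (d + 1)} {b : Fin 4 → Fin 4 → ℝ}
    (ht : ∀ i, lorentz (t i) (t i) = 0) (htf : ∀ i, IsFuture (t i))
    (hneg : ∀ i j, i ≠ j → lorentz (t i) (t j) < 0) (hind : LinearIndependent ℝ t)
    (hp : ∀ i, lorentz (p i) (p i) = 0) (hu : ∀ i, IsFuture (u i))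
    (hpb : ∀ i, p i = ∑ j, b i j • t j + u i) (hbi : ∀ i, b i i = -1)
    (hb : ∀ i j, i ≠ j → 0 < b i j) (hbb : ∀ i j, i ≠ j → 1 < b i j * b j i)
    (hA : lorentz (t 0) (t 1) = lorentz (t 2) (t 3))
    (hB : lorentz (t 0) (t 2) = lorentz (t 1) (t 3))
    (hC : lorentz (t 0) (t 3) = lorentz (t 1) (t 2)) : False := by
  have hcomm := fun i j => lorentz_comm (t i) (t j)
  have h10 := hcomm 1 0
  have h20 := hcomm 2 0
  have h30 := hcomm 3 0
  have h21 := hcomm 2 1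
  have h31 := hcomm 3 1
  have h32 := hcomm 3 2
  have hexp : ∀ c c' : Fin 4 → ℝ, lorentz (∑ j, c j • t j) (∑ j, c' j • t j) =
      (c 0 * c' 1 + c 1 * c' 0 + c 2 * c' 3 + c 3 * c' 2) * lorentz (t 0) (t 1) +
      (c 0 * c' 2 + c 2 * c' 0 + c 1 * c' 3 + c 3 * c' 1) * lorentz (t 0) (t 2) +
      (c 0 * c' 3 + c 3 * c' 0 + c 1 * c' 2 + c 2 * c' 1) * lorentz (t 0) (t 3) := by
    intro c c'
    simp only [Fin.sum_univ_four, lorentz_add_left, lorentz_add_right, lorentz_smul_left,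
      lorentz_smul_right, ht, h10, h20, h30, h21, h31, h32, ← hA, ← hB, ← hC]
    ring
  set A := lorentz (t 0) (t 1)
  set B := lorentz (t 0) (t 2)
  set C := lorentz (t 0) (t 3)
  have hAneg : A < 0 := hneg 0 1 (by decide)
  have hBneg : B < 0 := hneg 0 2 (by decide)
  have hCneg : C < 0 := hneg 0 3 (by decide)
  -- the sum of all `t i` is timelike, and orthogonal to the differences of opposite edges
  have htri : ∀ c : Fin 4 → ℝ, c ≠ 0 →
      lorentz (∑ j, c j • t j) (∑ j, (1 : ℝ) • t j) = 0 →
      0 < lorentz (∑ j, c j • t j) (∑ j, c j • t j) := by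
    intro c hc h0
    refine lorentz_self_pos_of_orthogonal (t := ∑ j, (1 : ℝ) • t j) ?_ h0 ?_
    · rw [hexp]; linarith
    · intro hz
      rw [Fintype.linearIndependent_iff] at hind
      exact hc (funext fun j => hind c hz j)
  have hq : ∀ i, 0 ≤ lorentz (∑ j, b i j • t j) (∑ j, b i j • t j) := by
    intro i
    refine lorentz_self_nonneg_of_null (u := u i) (y := ∑ j ∈ Finset.univ.erase i, b i j • t j)
      (hu i) (IsFuture.sum fun j hj => (htf j).smul (hb i j (Finset.ne_of_mem_erase hj).symm).le)
      (by rw [← hpb]; exact hp i) ?_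
    rw [← Finset.add_sum_erase Finset.univ (fun j => b i j • t j) (Finset.mem_univ i), hbi]
    have : ∑ j ∈ Finset.univ.erase i, b i j • t j -
        ((-1 : ℝ) • t i + ∑ j ∈ Finset.univ.erase i, b i j • t j) = t i := by module
    rw [this]; exact ht i
  have t1 := htri ![1, 1, -1, -1] (fun h => by simpa using congrFun h 0)
    (by rw [hexp]; simp)
  have t2 := htri ![1, -1, 1, -1] (fun h => by simpa using congrFun h 0)
    (by rw [hexp]; simp)
  have t3 := htri ![1, -1, -1, 1] (fun h => by simpa using congrFun h 0)
    (by rw [hexp]; simp)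
  rw [hexp] at t1 t2 t3
  simp [Matrix.cons_val_zero, Matrix.cons_val_one] at t1 t2 t3
  refine four_stacked_contradiction (A := -A) (B := -B) (C := -C) (by linarith) (by linarith)
    (by linarith) (by linarith) (by linarith) (by linarith)
    (x := ![b 0 1, b 1 0, b 2 3, b 3 2]) (y := ![b 0 2, b 1 3, b 2 0, b 3 1])
    (z := ![b 0 3, b 1 2, b 2 1, b 3 0]) ?_ ?_ ?_ ?_ (hbb 0 1 (by decide)) (hbb 2 3 (by decide))
    (hbb 0 2 (by decide)) (hbb 1 3 (by decide)) (hbb 0 3 (by decide)) (hbb 1 2 (by decide))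
  · intro i; fin_cases i
    · exact hb 0 1 (by decide)
    · exact hb 1 0 (by decide)
    · exact hb 2 3 (by decide)
    · exact hb 3 2 (by decide)
  · intro i; fin_cases i
    · exact hb 0 2 (by decide)
    · exact hb 1 3 (by decide)
    · exact hb 2 0 (by decide)
    · exact hb 3 1 (by decide)
  · intro i; fin_cases i
    · exact hb 0 3 (by decide)
    · exact hb 1 2 (by decide)
    · exact hb 2 1 (by decide)
    · exact hb 3 0 (by decide)
  · intro i
    have := hq i
    rw [hexp] at this
    have hbi' := hbi i
    fin_cases i <;> simp at this hbi' ⊢ <;> rw [hbi'] at this <;> linarith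

/-- Four light-like vectors do not admit four light-like points stacked onto the faces of their
simplex. The `i`-th stacked point `p i` may have a further component `u i` in the future light
cone. -/
theorem stacked_null_contradiction {t p u : Fin 4 → E (d + 1)} {b : Fin 4 → Fin 4 → ℝ}
    (ht : ∀ i, lorentz (t i) (t i) = 0) (htf : ∀ i, IsFuture (t i))
    (hneg : ∀ i j, i ≠ j → lorentz (t i) (t j) < 0) (hind : LinearIndependent ℝ t)
    (hp : ∀ i, lorentz (p i) (p i) = 0) (hu : ∀ i, IsFuture (u i))
    (hpb : ∀ i, p i = ∑ j, b i j • t j + u i) (hbi : ∀ i, b i i = -1)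
    (hb : ∀ i j, i ≠ j → 0 < b i j) (hbb : ∀ i j, i ≠ j → 1 < b i j * b j i) : False := by
  have h01 := hneg 0 1 (by decide)
  have h02 := hneg 0 2 (by decide)
  have h03 := hneg 0 3 (by decide)
  have h12 := hneg 1 2 (by decide)
  have h13 := hneg 1 3 (by decide)
  have h23 := hneg 2 3 (by decide)
  obtain ⟨g01, e01⟩ : ∃ g, g = - lorentz (t 0) (t 1) := ⟨_, rfl⟩
  obtain ⟨g02, e02⟩ : ∃ g, g = - lorentz (t 0) (t 2) := ⟨_, rfl⟩
  obtain ⟨g03, e03⟩ : ∃ g, g = - lorentz (t 0) (t 3) := ⟨_, rfl⟩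
  obtain ⟨g12, e12⟩ : ∃ g, g = - lorentz (t 1) (t 2) := ⟨_, rfl⟩
  obtain ⟨g13, e13⟩ : ∃ g, g = - lorentz (t 1) (t 3) := ⟨_, rfl⟩
  obtain ⟨g23, e23⟩ : ∃ g, g = - lorentz (t 2) (t 3) := ⟨_, rfl⟩
  have p01 : 0 < g01 := by linarith
  have p02 : 0 < g02 := by linarith
  have p03 : 0 < g03 := by linarith
  have p12 : 0 < g12 := by linarith
  have p13 : 0 < g13 := by linarith
  have p23 : 0 < g23 := by linarith
  -- rescaling `t i` by the square root of the product of the scalar products not involving `t i`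
  -- equalizes the scalar products of opposite pairs
  let s : Fin 4 → ℝ := ![√(g12 * g13 * g23), √(g02 * g03 * g23), √(g01 * g03 * g13),
    √(g01 * g02 * g12)]
  have hs : ∀ i, 0 < s i := by
    intro i
    fin_cases i
    · exact Real.sqrt_pos.2 (by positivity)
    · exact Real.sqrt_pos.2 (by positivity)
    · exact Real.sqrt_pos.2 (by positivity)
    · exact Real.sqrt_pos.2 (by positivity)
  have hs0 : s 0 ^ 2 = g12 * g13 * g23 := Real.sq_sqrt (by positivity)
  have hs1 : s 1 ^ 2 = g02 * g03 * g23 := Real.sq_sqrt (by positivity)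
  have hs2 : s 2 ^ 2 = g01 * g03 * g13 := Real.sq_sqrt (by positivity)
  have hs3 : s 3 ^ 2 = g01 * g02 * g12 := Real.sq_sqrt (by positivity)
  have hmul : ∀ (i j k l : Fin 4) (g g' : ℝ), 0 < g → 0 < g' →
      s i ^ 2 * s j ^ 2 * g ^ 2 = s k ^ 2 * s l ^ 2 * g' ^ 2 →
      s i * (s j * -g) = s k * (s l * -g') := by
    intro i j k l g g' hg hg' h
    have h1 := hs i
    have h2 := hs j
    have h3 := hs k
    have h4 := hs l
    have : s i * s j * g = s k * s l * g' := by
      refine (pow_left_inj₀ (by positivity) (by positivity) two_ne_zero).1 ?_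
      linear_combination h
    linarith
  have hscale : ∀ i j, lorentz (s i • t i) (s j • t j) = s i * (s j * lorentz (t i) (t j)) :=
    fun i j => by rw [lorentz_smul_left, lorentz_smul_right]
  refine stacked_null_contradiction_of_scaled (t := fun i => s i • t i) (p := fun i => s i • p i)
    (u := fun i => s i • u i) (b := fun i j => b i j * s i / s j) ?_ ?_ ?_ ?_ ?_ ?_ ?_ ?_ ?_ ?_ ?_ ?_ ?_
  · intro i; simp only [hscale, ht, mul_zero]
  · exact fun i => (htf i).smul (hs i).le
  · intro i j hij
    simp only [hscale]
    exact mul_neg_of_pos_of_neg (hs i) (mul_neg_of_pos_of_neg (hs j) (hneg i j hij))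
  · exact hind.units_smul fun i => Units.mk0 (s i) (hs i).ne'
  · intro i; simp only [lorentz_smul_left, lorentz_smul_right, hp, mul_zero]
  · exact fun i => (hu i).smul (hs i).le
  · intro i
    simp only [hpb i, smul_add, Finset.smul_sum, smul_smul]
    congr 1
    refine Finset.sum_congr rfl fun j _ => ?_
    rw [div_mul_cancel₀ _ (hs j).ne', mul_comm]
  · intro i
    simp only [hbi]
    rw [mul_div_assoc, div_self (hs i).ne', mul_one]
  · exact fun i j hij => div_pos (mul_pos (hb i j hij) (hs i)) (hs j)
  · intro i j hij
    have h1 := (hs i).ne'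
    have h2 := (hs j).ne'
    have : b i j * s i / s j * (b j i * s j / s i) = b i j * b j i := by field_simp
    rw [this]
    exact hbb i j hij
  · simp only [hscale]
    rw [← neg_neg (lorentz (t 0) (t 1)), ← neg_neg (lorentz (t 2) (t 3)), ← e01, ← e23]
    exact hmul _ _ _ _ _ _ p01 p23 (by rw [hs0, hs1, hs2, hs3]; ring)
  · simp only [hscale]
    rw [← neg_neg (lorentz (t 0) (t 2)), ← neg_neg (lorentz (t 1) (t 3)), ← e02, ← e13]
    exact hmul _ _ _ _ _ _ p02 p13 (by rw [hs0, hs1, hs2, hs3]; ring)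
  · simp only [hscale]
    rw [← neg_neg (lorentz (t 0) (t 3)), ← neg_neg (lorentz (t 1) (t 2)), ← e03, ← e12]
    exact hmul _ _ _ _ _ _ p03 p12 (by rw [hs0, hs1, hs2, hs3]; ring)

/-- The linear part of the obstruction. The vectors `t a`, `a ≤ D`, play the role of the vertices of
a simplex in the Lorentz-orthogonal complement of `L`, and `s i`, `i < 4`, is stacked onto the facet
opposite to `t i`. The functional `m i j` belongs to the facet spanned by `s i` and all `t a` but
`t i` and `t j`. -/
theorem stacked_cone_contradiction {D : ℕ} (hD : 3 ≤ D) {L : Submodule ℝ (E (d + 1))}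
    (hLdim : Module.finrank ℝ L + (D + 1) = d + 1) (hL : ∀ y ∈ L, lorentz y y = 0 → y = 0)
    {t s : ℕ → E (d + 1)}
    (ht : ∀ a ≤ D, lorentz (t a) (t a) = 0 ∧ IsFuture (t a) ∧ ∀ y ∈ L, lorentz (t a) y = 0)
    (hs : ∀ i < 4, lorentz (s i) (s i) = 0 ∧ IsFuture (s i) ∧ ∀ y ∈ L, lorentz (s i) y = 0)
    {m : ℕ → ℕ → E (d + 1) →ₗ[ℝ] ℝ}
    (hmL : ∀ i < 4, ∀ j ≤ D, j ≠ i → ∀ y ∈ L, m i j y = 0)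
    (hm0 : ∀ i < 4, ∀ j ≤ D, j ≠ i → ∀ a ≤ D, a ≠ i → a ≠ j → m i j (t a) = 0)
    (hmi : ∀ i < 4, ∀ j ≤ D, j ≠ i → m i j (t i) < 0)
    (hmj : ∀ i < 4, ∀ j ≤ D, j ≠ i → m i j (t j) < 0)
    (hms : ∀ i < 4, ∀ j ≤ D, j ≠ i → m i j (s i) = 0)
    (hms' : ∀ i < 4, ∀ j ≤ D, j ≠ i → ∀ r < 4, r ≠ i → m i j (s r) < 0) : False := by
  have hsum : ∀ i < 4, ∀ j ≤ D, j ≠ i → ∀ c : ℕ → ℝ,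
      m i j (∑ a ∈ Finset.range (D + 1), c a • t a) = c i * m i j (t i) + c j * m i j (t j) := by
    intro i hi j hj hij c
    have hsub : ({i, j} : Finset ℕ) ⊆ Finset.range (D + 1) := by
      intro x hx
      simp only [Finset.mem_insert, Finset.mem_singleton] at hx
      rw [Finset.mem_range]
      omega
    rw [map_sum, ← Finset.sum_subset hsub, Finset.sum_pair hij.symm]
    · simp
    · intro a ha hna
      simp only [Finset.mem_insert, Finset.mem_singleton, not_or] at hna
      rw [map_smul, hm0 i hi j hj hij a (Nat.lt_succ_iff.1 (Finset.mem_range.1 ha)) hna.1 hna.2,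
        smul_zero]
  -- coefficients of opposite signs in all pairs among three indices must vanish
  have hzero : ∀ c : ℕ → ℝ, (∀ i < 4, ∀ j ≤ D, j ≠ i →
      m i j (∑ a ∈ Finset.range (D + 1), c a • t a) = 0) → ∀ a ≤ D, c a = 0 := by
    intro c hc
    have hpair : ∀ i < 4, ∀ j ≤ D, j ≠ i → c i * m i j (t i) + c j * m i j (t j) = 0 :=
      fun i hi j hj hij => by rw [← hsum i hi j hj hij]; exact hc i hi j hj hij
    have hpos : ∀ i < 4, ∀ j ≤ D, j ≠ i → 0 < c i → c j < 0 := by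
      intro i hi j hj hij h
      have h1 := mul_neg_of_pos_of_neg h (hmi i hi j hj hij)
      have h2 := hpair i hi j hj hij
      have h3 := hmj i hi j hj hij
      by_contra! hcon
      have := mul_nonpos_of_nonneg_of_nonpos hcon h3.le
      linarith
    have hneg : ∀ i < 4, ∀ j ≤ D, j ≠ i → c i < 0 → 0 < c j := by
      intro i hi j hj hij h
      have h1 := mul_pos_of_neg_of_neg h (hmi i hi j hj hij)
      have h2 := hpair i hi j hj hij
      have h3 := hmj i hi j hj hij
      by_contra! hcon
      have := mul_nonneg_of_nonpos_of_nonpos hcon h3.le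
      linarith
    have h0 : c 0 = 0 := by
      rcases lt_trichotomy (c 0) 0 with h | h | h
      · have h1 := hneg 0 (by norm_num) 1 (by omega) (by norm_num) h
        have h2 := hneg 0 (by norm_num) 2 (by omega) (by norm_num) h
        have h3 := hpos 1 (by norm_num) 2 (by omega) (by norm_num) h1
        linarith
      · exact h
      · have h1 := hpos 0 (by norm_num) 1 (by omega) (by norm_num) h
        have h2 := hpos 0 (by norm_num) 2 (by omega) (by norm_num) h
        have h3 := hneg 1 (by norm_num) 2 (by omega) (by norm_num) h1
        linarith
    intro a ha
    by_cases ha0 : a = 0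
    · rw [ha0, h0]
    · have h1 := hpair 0 (by norm_num) a ha ha0
      rw [h0, zero_mul, zero_add] at h1
      exact (mul_eq_zero.1 h1).resolve_right (hmj 0 (by norm_num) a ha ha0).ne
  have hind : LinearIndepOn ℝ t (Finset.range (D + 1) : Set ℕ) := by
    rw [linearIndepOn_finset_iff]
    intro c hc a ha
    exact hzero c (fun i _ j _ _ => by rw [hc, map_zero]) a
      (Nat.lt_succ_iff.1 (Finset.mem_range.1 ha))
  have htop : Submodule.span ℝ (t '' (Finset.range (D + 1) : Set ℕ)) ⊔ L = ⊤ := by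
    apply Submodule.eq_top_of_finrank_eq
    have h1 := Submodule.finrank_sup_add_finrank_inf_eq
      (Submodule.span ℝ (t '' (Finset.range (D + 1) : Set ℕ))) L
    have h2 : Submodule.span ℝ (t '' (Finset.range (D + 1) : Set ℕ)) ⊓ L = ⊥ := by
      rw [eq_bot_iff]
      rintro x ⟨hx, hxL⟩
      obtain ⟨c, rfl⟩ := (Submodule.mem_span_image_finset_iff_exists_fun' ℝ).1 hx
      have := hzero c fun i hi j hj hij => hmL i hi j hj hij _ hxL
      rw [Submodule.mem_bot]
      exact Finset.sum_eq_zero fun a ha => by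
        rw [this a (Nat.lt_succ_iff.1 (Finset.mem_range.1 ha)), zero_smul]
    have h3 : Module.finrank ℝ (Submodule.span ℝ (t '' (Finset.range (D + 1) : Set ℕ))) = D + 1 := by
      rw [Set.image_eq_range]
      exact (finrank_span_eq_card (R := ℝ) hind).trans (by simp)
    rw [h2, finrank_bot, h3] at h1
    simp only [finrank_euclideanSpace, Fintype.card_fin]
    omega
  have hcoef : ∀ i < 4, ∃ c : ℕ → ℝ, s i = ∑ a ∈ Finset.range (D + 1), c a • t a := by
    intro i hi
    have : s i ∈ Submodule.span ℝ (t '' (Finset.range (D + 1) : Set ℕ)) ⊔ L := by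
      rw [htop]; exact Submodule.mem_top
    obtain ⟨y, hy, w, hw, hyw⟩ := Submodule.mem_sup.1 this
    obtain ⟨c, rfl⟩ := (Submodule.mem_span_image_finset_iff_exists_fun' ℝ).1 hy
    -- the component in `L` is orthogonal to `L`, hence zero
    have hw0 : lorentz w w = 0 := by
      have h1 : w = s i - ∑ a ∈ Finset.range (D + 1), c a • t a := by rw [← hyw]; abel
      nth_rewrite 1 [h1]
      rw [lorentz_sub_left, (hs i hi).2.2 w hw, lorentz_comm, lorentz_sum_right,
        Finset.sum_eq_zero, sub_zero]
      intro a ha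
      rw [lorentz_smul_right, lorentz_comm,
        (ht a (Nat.lt_succ_iff.1 (Finset.mem_range.1 ha))).2.2 w hw, mul_zero]
    rw [hL w hw hw0, add_zero] at hyw
    exact ⟨c, hyw.symm⟩
  choose! c hc using hcoef
  have hcs : ∀ i < 4, ∀ j ≤ D, j ≠ i → c i i * m i j (t i) + c i j * m i j (t j) = 0 := by
    intro i hi j hj hij
    rw [← hsum i hi j hj hij, ← hc i hi, hms i hi j hj hij]
  have hcs' : ∀ i < 4, ∀ j ≤ D, j ≠ i → ∀ r < 4, r ≠ i →
      c r i * m i j (t i) + c r j * m i j (t j) < 0 := by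
    intro i hi j hj hij r hr hri
    rw [← hsum i hi j hj hij, ← hc r hr]
    exact hms' i hi j hj hij r hr hri
  have hcneg : ∀ i < 4, c i i < 0 := by
    intro i hi
    obtain ⟨j, hj, k, hk, hji, hki, hkj⟩ : ∃ j < 4, ∃ k < 4, j ≠ i ∧ k ≠ i ∧ k ≠ j := by
      interval_cases i
      · exact ⟨1, by norm_num, 2, by norm_num, by norm_num⟩
      · exact ⟨0, by norm_num, 2, by norm_num, by norm_num⟩
      · exact ⟨0, by norm_num, 1, by norm_num, by norm_num⟩
      · exact ⟨0, by norm_num, 1, by norm_num, by norm_num⟩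
    have h1 := hcs i hi j (by omega) hji
    have h2 := hcs i hi k (by omega) hki
    have h3 := hcs' j hj k (by omega) hkj i hi hji.symm
    have a1 := hmi i hi j (by omega) hji
    have a2 := hmj i hi j (by omega) hji
    have a3 := hmi i hi k (by omega) hki
    have a4 := hmj i hi k (by omega) hki
    have a5 := hmi j hj k (by omega) hkj
    have a6 := hmj j hj k (by omega) hkj
    by_contra! hcon
    have b1 : c i j ≤ 0 := by
      by_contra! h
      have := mul_neg_of_pos_of_neg h a2
      have := mul_nonpos_of_nonneg_of_nonpos hcon a1.le
      linarith
    have b2 : c i k ≤ 0 := by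
      by_contra! h
      have := mul_neg_of_pos_of_neg h a4
      have := mul_nonpos_of_nonneg_of_nonpos hcon a3.le
      linarith
    have := mul_nonneg_of_nonpos_of_nonpos b1 a5.le
    have := mul_nonneg_of_nonpos_of_nonpos b2 a6.le
    linarith
  have hcpos : ∀ i < 4, ∀ j ≤ D, j ≠ i → 0 < c i j := by
    intro i hi j hj hij
    have h1 := hcs i hi j hj hij
    have h2 := mul_pos_of_neg_of_neg (hcneg i hi) (hmi i hi j hj hij)
    by_contra! hcon
    have := mul_nonneg_of_nonpos_of_nonpos hcon (hmj i hi j hj hij).le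
    linarith
  have hmem : ∀ i : Fin 4, (i : ℕ) ≤ D := fun i => by omega
  have hne : ∀ i j : Fin 4, i ≠ j → (j : ℕ) ≠ i := fun i j h e => h (Fin.ext e.symm)
  have hrange : Finset.range 4 ⊆ Finset.range (D + 1) := Finset.range_mono (by omega)
  have htne : ∀ a ≤ D, t a ≠ 0 := fun a ha =>
    hind.ne_zero (Finset.mem_coe.2 (Finset.mem_range.2 (Nat.lt_succ_of_le ha)))
  have hpos : ∀ i : Fin 4, 0 < (- c i i)⁻¹ := fun i => inv_pos.2 (neg_pos.2 (hcneg i i.2))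
  refine stacked_null_contradiction (t := fun i : Fin 4 => t i)
    (p := fun i : Fin 4 => (- c i i)⁻¹ • s i)
    (u := fun i : Fin 4 => ∑ a ∈ Finset.range (D + 1) \ Finset.range 4, ((- c i i)⁻¹ * c i a) • t a)
    (b := fun i j => (- c i i)⁻¹ * c i j)
    (fun i => (ht i (hmem i)).1) (fun i => (ht i (hmem i)).2.1) ?_ ?_ ?_ ?_ ?_ ?_ ?_ ?_
  · intro i j hij
    refine lt_of_le_of_ne ((ht i (hmem i)).2.1.lorentz_nonpos (ht j (hmem j)).2.1) fun h0 => ?_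
    have h1 := (ht i (hmem i)).2.1.eq_smul_of_lorentz_eq_zero (ht j (hmem j)).2.1
      (htne j (hmem j)) h0
    have h2 := (hmi i i.2 j (hmem j) (hne i j hij)).ne
    -- another facet, containing `t j` but not `t i`
    obtain ⟨k, hk, hki, hkj⟩ : ∃ k < 4, k ≠ (i : ℕ) ∧ k ≠ (j : ℕ) := by
      by_cases h0 : (0 : ℕ) ≠ i ∧ (0 : ℕ) ≠ j
      · exact ⟨0, by norm_num, h0⟩
      · by_cases h1 : (1 : ℕ) ≠ i ∧ (1 : ℕ) ≠ j
        · exact ⟨1, by norm_num, h1⟩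
        · exact ⟨2, by norm_num, by omega, by omega⟩
    have h3 := hmi i i.2 k (by omega) hki
    rw [h1, map_smul, hm0 i i.2 k (by omega) hki j (hmem j) (hne i j hij) hkj.symm, smul_zero] at h3
    exact lt_irrefl _ h3
  · have : LinearIndependent ℝ (fun x : (Finset.range (D + 1) : Set ℕ) => t x) := hind
    exact this.comp (fun i : Fin 4 => ⟨(i : ℕ), Finset.mem_coe.2
      (Finset.mem_range.2 (Nat.lt_succ_of_le (hmem i)))⟩) fun i j h => Fin.ext (congrArg Subtype.val h)
  · intro i
    simp only [lorentz_smul_left, lorentz_smul_right, (hs i i.2).1, mul_zero]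
  · intro i
    refine IsFuture.sum fun a ha => (ht a ?_).2.1.smul ?_
    · have := Finset.mem_range.1 (Finset.mem_sdiff.1 ha).1
      omega
    · have h1 := Finset.mem_range.1 (Finset.mem_sdiff.1 ha).1
      have h2 := (Finset.mem_sdiff.1 ha).2
      rw [Finset.mem_range] at h2
      exact mul_nonneg (hpos i).le (hcpos i i.2 a (by omega) (by omega)).le
  · intro i
    beta_reduce
    have hsplit := Finset.sum_sdiff hrange (f := fun a => ((- c i i)⁻¹ * c i a) • t a)
    rw [Fin.sum_univ_eq_sum_range (fun j => ((- c i i)⁻¹ * c i j) • t j) 4]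
    refine Eq.trans ?_ (hsplit.symm.trans (add_comm _ _))
    refine (congrArg _ (hc i i.2)).trans ?_
    rw [Finset.smul_sum]
    simp only [smul_smul]
  · intro i
    have := (hcneg i i.2).ne
    field_simp
  · intro i j hij
    exact mul_pos (hpos i) (hcpos i i.2 j (hmem j) (hne i j hij))
  · intro i j hij
    have hij' := hne i j hij
    have h1 := hcs i i.2 j (hmem j) hij'
    have h2 := hcs' i i.2 j (hmem j) hij' j j.2 hij'
    have h3 := hmi i i.2 j (hmem j) hij'
    have h4 := hmj i i.2 j (hmem j) hij'
    have h5 := hcneg i i.2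
    have h6 := hcneg j j.2
    have h7 := hcpos j j.2 i (hmem i) hij'.symm
    have h8 := hcpos i i.2 j (hmem j) hij'
    have h9 : (- c i i)⁻¹ * c i j * ((- c j j)⁻¹ * c j i) = c i j * c j i / (c i i * c j j) := by
      have := h5.ne
      have := h6.ne
      field_simp
    rw [h9, one_lt_div (mul_pos_of_neg_of_neg h5 h6)]
    -- eliminate the ratio of the two values of `m i j`
    have h10 : c i i * (c j i * m i j (t i) + c j j * m i j (t j)) =
        (c i i * c j j - c i j * c j i) * m i j (t j) := by
      linear_combination c j i * h1
    have h11 : 0 < c i i * (c j i * m i j (t i) + c j j * m i j (t j)) := mul_pos_of_neg_of_neg h5 h2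
    rw [h10] at h11
    have := neg_of_mul_pos_left h11 h4.le
    linarith

end Null

/-! ### Tangent faces of a scribed cone -/

variable {d n k : ℕ} {𝓕 : Finset (Finset ℕ)} {K : PointedCone ℝ (E (d + 1))}

section Tangent

variable {F : Set (E (d + 1))} {t y : E (d + 1)}

/-- From a relative interior point of a set containing `0` one can move a little in each direction
of its linear span. -/
theorem eventually_add_smul_mem (h0 : (0 : E (d + 1)) ∈ F) (ht : t ∈ intrinsicInterior ℝ F)
    (hy : y ∈ Submodule.span ℝ F) : ∀ᶠ ε in nhds (0 : ℝ), t + ε • y ∈ F := by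
  obtain ⟨x, hx, rfl⟩ := mem_intrinsicInterior.1 ht
  have hspan : (affineSpan ℝ F : Set (E (d + 1))) = Submodule.span ℝ F := by
    rw [← affineSpan_insert_zero, Set.insert_eq_of_mem h0]
  have hmem : ∀ ε : ℝ, (x : E (d + 1)) + ε • y ∈ affineSpan ℝ F := by
    intro ε
    have hxs : (x : E (d + 1)) ∈ (affineSpan ℝ F : Set (E (d + 1))) := x.2
    rw [hspan] at hxs
    have : (x : E (d + 1)) + ε • y ∈ (Submodule.span ℝ F : Set (E (d + 1))) :=
      Submodule.add_mem _ hxs (Submodule.smul_mem _ ε hy)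
    rw [← hspan] at this
    exact this
  have hcont : Continuous fun ε : ℝ => (⟨(x : E (d + 1)) + ε • y, hmem ε⟩ : affineSpan ℝ F) := by
    refine Continuous.subtype_mk ?_ _
    fun_prop
  have h := hcont.continuousAt (x := 0)
  have hev : (Subtype.val ⁻¹' F : Set (affineSpan ℝ F)) ∈
      nhds (⟨(x : E (d + 1)) + (0 : ℝ) • y, hmem 0⟩ : affineSpan ℝ F) := by
    have : (⟨(x : E (d + 1)) + (0 : ℝ) • y, hmem 0⟩ : affineSpan ℝ F) = x :=
      Subtype.ext (by simp)
    rw [this]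
    exact mem_interior_iff_mem_nhds.1 hx
  exact h hev

theorem eq_smul_of_isFuture (hsmul : ∀ x ∈ F, ∀ r : ℝ, 0 ≤ r → r • x ∈ F)
    (hF : F ∩ lightCap d = {t}) (hy : y ∈ F) (hfut : IsFuture y) : y = ‖y‖ • t := by
  by_cases h0 : y = 0
  · simp [h0]
  have hn : ‖y‖ ≠ 0 := norm_ne_zero_iff.2 h0
  have hmem : ‖y‖⁻¹ • y ∈ F ∩ lightCap d :=
    ⟨hsmul y hy _ (by positivity), mem_lightCap_iff.2
      ⟨by rw [norm_smul, norm_inv, norm_norm, inv_mul_cancel₀ hn], hfut.smul (by positivity)⟩⟩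
  rw [hF, Set.mem_singleton_iff] at hmem
  rw [← hmem, smul_inv_smul₀ hn]

/-- The linear span of a tangent face lies in the hyperplane orthogonal to the tangent point `t`,
and the multiples of `t` are its only vectors that are not space-like. -/
theorem IsTangent.exists_point (hsmul : ∀ x ∈ F, ∀ r : ℝ, 0 ≤ r → r • x ∈ F) (h : IsTangent F) :
    ∃ t ∈ intrinsicInterior ℝ F, lorentz t t = 0 ∧ IsFuture t ∧
      (∀ y ∈ Submodule.span ℝ F, lorentz t y = 0) ∧
      ∀ y ∈ Submodule.span ℝ F, lorentz y y ≤ 0 → ∃ r : ℝ, y = r • t := by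
  obtain ⟨t, ⟨ht1, ht2, ht3⟩, hint, hF⟩ := h
  have hfut : IsFuture t := ⟨ht2.le, ht3⟩
  have htne : t ≠ 0 := fun h => by simp [h] at ht1
  have htF : t ∈ F := intrinsicInterior_subset hint
  have h0 : (0 : E (d + 1)) ∈ F := by simpa using hsmul t htF 0 le_rfl
  have hnorm : ∀ (y : E (d + 1)) (ε : ℝ), lorentz (t + ε • y) (t + ε • y) =
      ε * (2 * lorentz t y + ε * lorentz y y) := by
    intro y ε
    rw [lorentz_add_left, lorentz_add_right, lorentz_add_right, lorentz_smul_left,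
      lorentz_smul_right, lorentz_smul_right, lorentz_comm y t, lorentz_smul_left, ht2]
    ring
  have hev : ∀ y ∈ Submodule.span ℝ F, ∀ᶠ ε in nhdsWithin (0 : ℝ) (Set.Ioi 0),
      0 < ε ∧ t + ε • y ∈ F ∧ 0 ≤ (t + ε • y) 0 := by
    intro y hy
    have h1 := eventually_add_smul_mem h0 hint hy
    have h2 : ∀ᶠ ε in nhds (0 : ℝ), 0 < (t + ε • y) 0 := by
      have hcont : Continuous fun ε : ℝ => (t + ε • y) 0 := by fun_prop
      refine hcont.continuousAt.eventually (lt_mem_nhds ?_)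
      simpa using hfut.pos htne
    filter_upwards [self_mem_nhdsWithin, nhdsWithin_le_nhds h1, nhdsWithin_le_nhds h2]
      with ε hε h1 h2
    exact ⟨hε, h1, h2.le⟩
  have hnn : ∀ y ∈ Submodule.span ℝ F, 0 ≤ lorentz t y := by
    intro y hy
    by_contra! hneg
    have h3 : ∀ᶠ ε in nhds (0 : ℝ), 2 * lorentz t y + ε * lorentz y y < 0 := by
      have hcont : Continuous fun ε : ℝ => 2 * lorentz t y + ε * lorentz y y := by fun_prop
      refine hcont.continuousAt.eventually (gt_mem_nhds ?_)
      linarith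
    obtain ⟨ε, ⟨hε, hmem, h0'⟩, h3⟩ := ((hev y hy).and (nhdsWithin_le_nhds h3)).exists
    have hlt : lorentz (t + ε • y) (t + ε • y) < 0 := by
      rw [hnorm]; exact mul_neg_of_pos_of_neg hε h3
    have := eq_smul_of_isFuture hsmul hF hmem ⟨hlt.le, h0'⟩
    rw [this, lorentz_smul_left, lorentz_smul_right, ht2] at hlt
    simp at hlt
  have hort : ∀ y ∈ Submodule.span ℝ F, lorentz t y = 0 := fun y hy =>
    le_antisymm (by simpa [lorentz_neg_right] using hnn _ (Submodule.neg_mem _ hy)) (hnn y hy)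
  refine ⟨t, hint, ht2, hfut, hort, fun y hy hyy => ?_⟩
  obtain ⟨ε, hε, hmem, h0'⟩ := (hev y hy).exists
  have hle : lorentz (t + ε • y) (t + ε • y) ≤ 0 := by
    rw [hnorm, hort y hy, mul_zero, zero_add]
    exact mul_nonpos_of_nonneg_of_nonpos hε.le (mul_nonpos_of_nonneg_of_nonpos hε.le hyy)
  have := eq_smul_of_isFuture hsmul hF hmem ⟨hle, h0'⟩
  refine ⟨ε⁻¹ * (‖t + ε • y‖ - 1), ?_⟩
  rw [mul_smul, sub_smul, ← this, one_smul, add_sub_cancel_left, inv_smul_smul₀ hε.ne']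

end Tangent

/-! ### Cones with a given combinatorial type -/

/-- The faces `Φ S`, cut out of the cone `K` by the functionals `m S`, are indexed by the face sets
of the complex `𝓕` so that inclusion is preserved and reflected. -/
structure IsFaceMap (n : ℕ) (𝓕 : Finset (Finset ℕ)) (K : PointedCone ℝ (E (d + 1)))
    (Φ : Finset ℕ → Set (E (d + 1))) (m : Finset ℕ → E (d + 1) →ₗ[ℝ] ℝ) : Prop where
  nonpos : ∀ S, IsFaceSet n 𝓕 S → ∀ x ∈ K, m S x ≤ 0
  eq : ∀ S, IsFaceSet n 𝓕 S → Φ S = {x | x ∈ K ∧ m S x = 0}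
  subset_iff : ∀ S T, IsFaceSet n 𝓕 S → IsFaceSet n 𝓕 T → (Φ S ⊆ Φ T ↔ S ⊆ T)

theorem exists_isFaceMap (e : {S // IsFaceSet n 𝓕 S} ≃o coneFaces K) :
    ∃ Φ m, IsFaceMap n 𝓕 K Φ m := by
  classical
  choose l hl using fun S => (e S).2
  refine ⟨fun S => if h : IsFaceSet n 𝓕 S then (e ⟨S, h⟩ : Set (E (d + 1))) else ∅,
    fun S => if h : IsFaceSet n 𝓕 S then (l ⟨S, h⟩ : E (d + 1) →ₗ[ℝ] ℝ) else 0, ?_, ?_, ?_⟩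
  · intro S hS x hx
    rw [dif_pos hS]
    exact (hl ⟨S, hS⟩).1 x hx
  · intro S hS
    rw [dif_pos hS, dif_pos hS]
    exact (hl ⟨S, hS⟩).2
  · intro S T hS hT
    simp only [dif_pos hS, dif_pos hT]
    exact e.le_iff_le (x := ⟨S, hS⟩) (y := ⟨T, hT⟩)

namespace IsFaceMap

variable {Φ : Finset ℕ → Set (E (d + 1))} {m : Finset ℕ → E (d + 1) →ₗ[ℝ] ℝ} {S T F F₀ : Finset ℕ}

theorem mem_coneFaces (h : IsFaceMap n 𝓕 K Φ m) (hS : IsFaceSet n 𝓕 S) : Φ S ∈ coneFaces K :=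
  ⟨LinearMap.toContinuousLinearMap (m S), h.nonpos S hS, h.eq S hS⟩

theorem span_le_ker (h : IsFaceMap n 𝓕 K Φ m) (hS : IsFaceSet n 𝓕 S) :
    Submodule.span ℝ (Φ S) ≤ LinearMap.ker (m S) := by
  rw [Submodule.span_le, h.eq S hS]
  exact fun x hx => hx.2

/-- A proper face of a face spans a smaller subspace. -/
theorem finrank_lt (h : IsFaceMap n 𝓕 K Φ m) (hS : IsFaceSet n 𝓕 S) (hT : IsFaceSet n 𝓕 T)
    (hST : S ⊂ T) : Module.finrank ℝ (Submodule.span ℝ (Φ S)) <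
      Module.finrank ℝ (Submodule.span ℝ (Φ T)) := by
  have hle := Submodule.span_mono (R := ℝ) ((h.subset_iff S T hS hT).2 hST.1)
  refine Submodule.finrank_lt_finrank_of_lt (lt_of_le_of_ne hle fun heq => hST.2 ?_)
  refine (h.subset_iff T S hT hS).1 fun x hx => ?_
  have hx' : x ∈ Submodule.span ℝ (Φ S) := heq ▸ Submodule.subset_span hx
  rw [h.eq T hT] at hx
  rw [h.eq S hS]
  exact ⟨hx.1, h.span_le_ker hS hx'⟩

theorem finrank_add_card_le (h : IsFaceMap n 𝓕 K Φ m) (hF : F ∈ 𝓕) (hS : S ⊆ F) (U : Finset ℕ)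
    (hU : U ⊆ F) (hSU : Disjoint S U) : Module.finrank ℝ (Submodule.span ℝ (Φ S)) + U.card ≤
      Module.finrank ℝ (Submodule.span ℝ (Φ (S ∪ U))) := by
  induction U using Finset.induction_on with
  | empty => rw [Finset.union_empty, Finset.card_empty, add_zero]
  | insert a U ha ih =>
    rw [Finset.insert_subset_iff] at hU
    rw [Finset.disjoint_insert_right] at hSU
    have h1 := ih hU.2 hSU.2
    have h2 := h.finrank_lt (S := S ∪ U) (T := S ∪ insert a U)
      (.inr ⟨F, hF, Finset.union_subset hS hU.2⟩)
      (.inr ⟨F, hF, Finset.union_subset hS (Finset.insert_subset hU.1 hU.2)⟩) (by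
        rw [Finset.union_insert]
        exact Finset.ssubset_insert (by simp [ha, hSU.1]))
    rw [Finset.card_insert_of_notMem ha]
    omega

/-- Comparing with maximal chains of faces determines the dimension of each face. -/
theorem finrank_eq (h : IsFaceMap n 𝓕 K Φ m) (hc : IsPseudomanifold d n 𝓕) (hd : 2 ≤ d)
    (hF : F ∈ 𝓕) (hS : S ⊆ F) : Module.finrank ℝ (Submodule.span ℝ (Φ S)) = S.card := by
  have h1 := h.finrank_add_card_le hF hS (F \ S) Finset.sdiff_subset Finset.disjoint_sdiff
  have h2 := h.finrank_add_card_le hF (Finset.empty_subset F) S hS (Finset.disjoint_empty_left S)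
  rw [Finset.union_sdiff_of_subset hS, Finset.card_sdiff_of_subset hS, hc.card F hF] at h1
  rw [Finset.empty_union] at h2
  have h3 := h.finrank_lt (S := F) (T := Finset.range n) (.inr ⟨F, hF, subset_rfl⟩) (.inl rfl) (by
    obtain ⟨j, hj, hjF⟩ := Realizes.exists_notMem hc hd hF
    refine ⟨fun i hi => Finset.mem_range.2 (hc.lt F hF i hi), fun hsub => ?_⟩
    exact hjF (hsub (Finset.mem_range.2 hj)))
  have h4 := Submodule.finrank_le (Submodule.span ℝ (Φ (Finset.range n)))
  have h5 : Module.finrank ℝ (E (d + 1)) = d + 1 := by simp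
  have h6 := Finset.card_le_card hS
  rw [hc.card F hF] at h6
  omega

/-- Modulo the span of a face with vertex set `F₀` of cardinality `k`, the tangent point of a
`k`-face with one more vertex `x` is a positive multiple of `x`. -/
theorem exists_tangent_point (h : IsFaceMap n 𝓕 K Φ m) (hc : IsPseudomanifold d n 𝓕) (hd : 2 ≤ d)
    (hs : IsScribed k K) (hk : F₀.card = k) {x : ℕ} (hx : x ∉ F₀) (hF : F ∈ 𝓕)
    (hxF : insert x F₀ ⊆ F) :
    ∃ t, lorentz t t = 0 ∧ IsFuture t ∧ (∀ y ∈ Submodule.span ℝ (Φ F₀), lorentz t y = 0) ∧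
      (∀ y ∈ Submodule.span ℝ (Φ F₀), lorentz y y = 0 → y = 0) ∧
      ∀ G ∈ 𝓕, F₀ ⊆ G → (x ∈ G → m G t = 0) ∧ (x ∉ G → m G t < 0) := by
  have hF₀ : IsFaceSet n 𝓕 F₀ := .inr ⟨F, hF, (Finset.subset_insert x F₀).trans hxF⟩
  have hF₁ : IsFaceSet n 𝓕 (insert x F₀) := .inr ⟨F, hF, hxF⟩
  have hfx : IsFaceSet n 𝓕 {x} :=
    .inr ⟨F, hF, (Finset.singleton_subset_iff.2 (Finset.mem_insert_self x F₀)).trans hxF⟩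
  have hf0 : IsFaceSet n 𝓕 ∅ := .inr ⟨F, hF, Finset.empty_subset F⟩
  have h1 := h.finrank_eq hc hd hF hxF
  have h2 := h.finrank_eq hc hd hF ((Finset.subset_insert x F₀).trans hxF)
  have h3 := h.finrank_eq hc hd hF
    ((Finset.singleton_subset_iff.2 (Finset.mem_insert_self x F₀)).trans hxF)
  rw [Finset.card_insert_of_notMem hx, hk] at h1
  rw [hk] at h2
  rw [Finset.card_singleton] at h3
  -- a generator `u` of the ray of the vertex `x`
  obtain ⟨u, hu, hu0⟩ : ∃ u ∈ Φ {x}, u ∉ Φ ∅ := by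
    by_contra! hcon
    have := (h.subset_iff {x} ∅ hfx hf0).1 hcon
    simp at this
  have hune : u ≠ 0 := by
    rintro rfl
    refine hu0 ?_
    rw [h.eq ∅ hf0]
    exact ⟨K.zero_mem, map_zero _⟩
  have huK : u ∈ K := by
    rw [h.eq _ hfx] at hu
    exact hu.1
  have hspanx : Submodule.span ℝ (Φ {x}) ≤ Submodule.span ℝ {u} := by
    refine le_of_eq (Submodule.eq_of_le_of_finrank_eq ?_ ?_).symm
    · rw [Submodule.span_singleton_le_iff_mem]
      exact Submodule.subset_span hu
    · rw [h3, finrank_span_singleton hune]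
  have huS : ∀ S, IsFaceSet n 𝓕 S → x ∉ S → m S u < 0 := by
    intro S hS hxS
    refine lt_of_le_of_ne (h.nonpos S hS u huK) fun heq => hxS ?_
    refine Finset.singleton_subset_iff.1 ((h.subset_iff {x} S hfx hS).1 fun y hy => ?_)
    obtain ⟨r, rfl⟩ := Submodule.mem_span_singleton.1 (hspanx (Submodule.subset_span hy))
    rw [h.eq _ hfx] at hy
    rw [h.eq S hS]
    exact ⟨hy.1, by rw [map_smul, heq, smul_zero]⟩
  have huF₁ : u ∈ Φ (insert x F₀) :=
    (h.subset_iff _ _ hfx hF₁).2 (Finset.singleton_subset_iff.2 (Finset.mem_insert_self x F₀)) hu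
  have hsup : Submodule.span ℝ (Φ (insert x F₀)) =
      Submodule.span ℝ {u} ⊔ Submodule.span ℝ (Φ F₀) := by
    symm
    apply Submodule.eq_of_le_of_finrank_eq
    · refine sup_le ?_ (Submodule.span_mono
        ((h.subset_iff _ _ hF₀ hF₁).2 (Finset.subset_insert x F₀)))
      rw [Submodule.span_singleton_le_iff_mem]
      exact Submodule.subset_span huF₁
    · have hinf : Submodule.span ℝ {u} ⊓ Submodule.span ℝ (Φ F₀) = ⊥ := by
        rw [eq_bot_iff]
        rintro y ⟨hy, hy'⟩
        obtain ⟨r, rfl⟩ := Submodule.mem_span_singleton.1 hy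
        have h4 := h.span_le_ker hF₀ hy'
        rw [LinearMap.mem_ker, map_smul, smul_eq_mul] at h4
        rw [Submodule.mem_bot, (mul_eq_zero.1 h4).resolve_right (huS F₀ hF₀ hx).ne, zero_smul]
      have h4 := Submodule.finrank_sup_add_finrank_inf_eq (Submodule.span ℝ {u})
        (Submodule.span ℝ (Φ F₀))
      rw [hinf, finrank_bot, finrank_span_singleton hune, h2] at h4
      rw [h1]
      omega
  have hsmul : ∀ y ∈ Φ (insert x F₀), ∀ r : ℝ, 0 ≤ r → r • y ∈ Φ (insert x F₀) := by
    intro y hy r hr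
    rw [h.eq _ hF₁] at hy ⊢
    exact ⟨K.smul_mem hr hy.1, by rw [map_smul, hy.2, smul_zero]⟩
  obtain ⟨t, hint, htt, hfut, hort, hiso⟩ :=
    (hs _ (h.mem_coneFaces hF₁) h1).exists_point hsmul
  have hle : Submodule.span ℝ (Φ F₀) ≤ Submodule.span ℝ (Φ (insert x F₀)) := hsup ▸ le_sup_right
  have htF₁ := intrinsicInterior_subset hint
  have htmem : t ∈ Submodule.span ℝ {u} ⊔ Submodule.span ℝ (Φ F₀) :=
    hsup ▸ Submodule.subset_span htF₁
  obtain ⟨y, hy, w, hw, hyw⟩ := Submodule.mem_sup.1 htmem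
  obtain ⟨c, rfl⟩ := Submodule.mem_span_singleton.1 hy
  -- moving from `t` a little in the direction `-u` does not leave `K`
  have hneg : m F₀ t < 0 := by
    have h0 : (0 : E (d + 1)) ∈ Φ (insert x F₀) := by simpa using hsmul u huF₁ 0 le_rfl
    have hev := eventually_add_smul_mem h0 hint
      (Submodule.neg_mem _ (Submodule.subset_span huF₁) : -u ∈ Submodule.span ℝ (Φ (insert x F₀)))
    obtain ⟨ε, hε, hmem⟩ :=
      (Filter.Eventually.and (self_mem_nhdsWithin : ∀ᶠ ε in nhdsWithin (0 : ℝ) (Set.Ioi 0), 0 < ε)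
        (nhdsWithin_le_nhds hev)).exists
    rw [h.eq _ hF₁] at hmem
    have h4 := h.nonpos F₀ hF₀ _ hmem.1
    rw [map_add, map_smul, map_neg, smul_eq_mul] at h4
    have h5 := mul_neg_of_pos_of_neg hε (huS F₀ hF₀ hx)
    linarith
  have hmt : ∀ S, IsFaceSet n 𝓕 S → F₀ ⊆ S → m S t = c * m S u := by
    intro S hS hsub
    have h4 := h.span_le_ker hS (Submodule.span_mono ((h.subset_iff _ _ hF₀ hS).2 hsub) hw)
    rw [← hyw, map_add, map_smul, h4, add_zero, smul_eq_mul]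
  have hcpos : 0 < c := by
    rw [hmt F₀ hF₀ subset_rfl] at hneg
    exact pos_of_mul_neg_left hneg (huS F₀ hF₀ hx).le
  refine ⟨t, htt, hfut, fun y hy => hort y (hle hy), fun y hy hyy => ?_, fun G hG hsub => ?_⟩
  · obtain ⟨r, rfl⟩ := hiso y (hle hy) hyy.le
    have h4 := h.span_le_ker hF₀ hy
    rw [LinearMap.mem_ker, map_smul, smul_eq_mul] at h4
    rw [(mul_eq_zero.1 h4).resolve_right hneg.ne, zero_smul]
  · have hfG : IsFaceSet n 𝓕 G := .inr ⟨G, hG, subset_rfl⟩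
    rw [hmt G hfG hsub]
    refine ⟨fun hxG => ?_, fun hxG => mul_neg_of_pos_of_neg hcpos (huS G hfG hxG)⟩
    have : u ∈ Φ G := (h.subset_iff _ _ hfx hfG).2 (Finset.singleton_subset_iff.2 hxG) hu
    rw [h.eq G hfG] at this
    rw [this.2, mul_zero]

end IsFaceMap

/-! ### A stacked polytope that is not scribable -/

/-- The complex obtained by stacking a vertex onto `m` of the facets of a simplex. -/
theorem exists_stackedComplex_stack_facets (d m : ℕ) (hm : m ≤ d + 1) :
    ∃ 𝓕, StackedComplex d (d + 1 + m) 𝓕 ∧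
      (∀ i ≤ d, m ≤ i → (Finset.range (d + 1)).erase i ∈ 𝓕) ∧
      ∀ i < m, ∀ j ≤ d, j ≠ i → insert (d + 1 + i) (((Finset.range (d + 1)).erase i).erase j) ∈ 𝓕 := by
  induction m with
  | zero =>
    refine ⟨_, .simplex, fun i hi _ => Finset.mem_image_of_mem _ (Finset.mem_range.2 (by omega)),
      by simp⟩
  | succ m ih =>
    obtain ⟨𝓕, h𝓕, hold, hnew⟩ := ih (by omega)
    refine ⟨_, .stack _ 𝓕 _ h𝓕 (hold m (by omega) le_rfl), ?_, ?_⟩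
    · intro i hi hmi
      refine mem_stackComplex.2 (.inl ⟨fun heq => ?_, hold i hi (by omega)⟩)
      have : m ∈ (Finset.range (d + 1)).erase i := by simp; omega
      rw [heq] at this
      simp at this
    · intro i hi j hj hji
      rw [mem_stackComplex]
      obtain rfl | him := eq_or_ne i m
      · exact .inr ⟨j, by simp; omega, rfl⟩
      · refine .inl ⟨fun heq => ?_, hnew i (by omega) j hj hji⟩
        have : d + 1 + i ∈ (Finset.range (d + 1)).erase m := heq ▸ Finset.mem_insert_self _ _
        simp at this
        omega

/-- If a vertex has been stacked onto at least four facets of a `d`-simplex, then the resulting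
polytope is not `k`-scribable for `k ≤ d - 3`: projecting along a face with `k` vertices, common to
all facets of the configuration, leaves the configuration in dimension `d - k ≥ 3` that is excluded
by `stacked_cone_contradiction`. -/
theorem not_isScribable_of_stacked_facets {d n k : ℕ} {𝓕 : Finset (Finset ℕ)}
    (hc : IsPseudomanifold d n 𝓕) (hkd : k + 3 ≤ d)
    (h𝓕 : ∀ i < 4, ∀ j ≤ d, j ≠ i →
      insert (d + 1 + i) (((Finset.range (d + 1)).erase i).erase j) ∈ 𝓕)
    {w : ℕ → E d} {l : Finset ℕ → E d × ℝ →ₗ[ℝ] ℝ}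
    (hw : Realizes n 𝓕 (fun i => (w i, (1 : ℝ))) l) :
    ¬ IsScribable k (convexHull ℝ (w '' (Finset.range n : Set ℕ))) := by
  rintro ⟨K, -, ⟨e⟩, hs⟩
  obtain ⟨e'⟩ := hw.nonempty_polytopeFaces_iso hc
  obtain ⟨Φ, m, h⟩ := exists_isFaceMap (e'.trans e)
  have hd : 2 ≤ d := by omega
  -- the vertices of the face that is projected away
  set F₀ : Finset ℕ := Finset.Ioc (d - k) d with hF₀
  have hk : F₀.card = k := by rw [hF₀, Nat.card_Ioc]; omega
  have hmemF₀ : ∀ {x}, x ∈ F₀ ↔ d - k < x ∧ x ≤ d := fun {x} => Finset.mem_Ioc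
  have hsub : ∀ i < 4, ∀ j ≤ d - k, j ≠ i →
      F₀ ⊆ insert (d + 1 + i) (((Finset.range (d + 1)).erase i).erase j) := by
    intro i hi j hj hji x hx
    rw [hmemF₀] at hx
    simp only [Finset.mem_insert, Finset.mem_erase, Finset.mem_range]
    omega
  have hold : ∀ a ≤ d - k, ∃ t, lorentz t t = 0 ∧ IsFuture t ∧
      (∀ y ∈ Submodule.span ℝ (Φ F₀), lorentz t y = 0) ∧
      (∀ y ∈ Submodule.span ℝ (Φ F₀), lorentz y y = 0 → y = 0) ∧
      ∀ G ∈ 𝓕, F₀ ⊆ G → (a ∈ G → m G t = 0) ∧ (a ∉ G → m G t < 0) := by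
    intro a ha
    obtain ⟨i, hi, j, hj, hji, hia, hja⟩ : ∃ i < 4, ∃ j ≤ d - k, j ≠ i ∧ i ≠ a ∧ j ≠ a := by
      by_cases h0 : a = 0
      · exact ⟨1, by omega, 2, by omega, by omega⟩
      · by_cases h1 : a = 1
        · exact ⟨0, by omega, 2, by omega, by omega⟩
        · exact ⟨0, by omega, 1, by omega, by omega⟩
    refine h.exists_tangent_point hc hd hs hk (fun hx => by rw [hmemF₀] at hx; omega)
      (h𝓕 i hi j (by omega) hji) (Finset.insert_subset ?_ (hsub i hi j hj hji))
    simp only [Finset.mem_insert, Finset.mem_erase, Finset.mem_range]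
    omega
  have hnew : ∀ i < 4, ∃ t, lorentz t t = 0 ∧ IsFuture t ∧
      (∀ y ∈ Submodule.span ℝ (Φ F₀), lorentz t y = 0) ∧
      (∀ y ∈ Submodule.span ℝ (Φ F₀), lorentz y y = 0 → y = 0) ∧
      ∀ G ∈ 𝓕, F₀ ⊆ G → (d + 1 + i ∈ G → m G t = 0) ∧ (d + 1 + i ∉ G → m G t < 0) := by
    intro i hi
    obtain ⟨j, hj, hji⟩ : ∃ j ≤ d - k, j ≠ i := by
      by_cases h0 : i = 0
      · exact ⟨1, by omega, by omega⟩
      · exact ⟨0, by omega, by omega⟩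
    exact h.exists_tangent_point hc hd hs hk (fun hx => by rw [hmemF₀] at hx; omega)
      (h𝓕 i hi j (by omega) hji)
      (Finset.insert_subset (Finset.mem_insert_self _ _) (hsub i hi j hj hji))
  choose! t ht using hold
  choose! s hs using hnew
  have hdim : Module.finrank ℝ (Submodule.span ℝ (Φ F₀)) = k := by
    rw [h.finrank_eq hc hd (h𝓕 0 (by omega) 1 (by omega) (by omega))
      (hsub 0 (by omega) 1 (by omega) (by omega)), hk]
  have hmem : ∀ i < 4, ∀ j ≤ d - k, j ≠ i →
      insert (d + 1 + i) (((Finset.range (d + 1)).erase i).erase j) ∈ 𝓕 :=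
    fun i hi j hj hji => h𝓕 i hi j (by omega) hji
  refine stacked_cone_contradiction (D := d - k) (by omega) (by omega)
    (ht 0 (by omega)).2.2.2.1 (fun a ha => ⟨(ht a ha).1, (ht a ha).2.1, (ht a ha).2.2.1⟩)
    (fun i hi => ⟨(hs i hi).1, (hs i hi).2.1, (hs i hi).2.2.1⟩)
    (m := fun i j => m (insert (d + 1 + i) (((Finset.range (d + 1)).erase i).erase j)))
    ?_ ?_ ?_ ?_ ?_ ?_
  · intro i hi j hj hji y hy
    have hG : IsFaceSet n 𝓕 (insert (d + 1 + i) (((Finset.range (d + 1)).erase i).erase j)) :=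
      .inr ⟨_, hmem i hi j hj hji, subset_rfl⟩
    have hF : IsFaceSet n 𝓕 F₀ := .inr ⟨_, hmem i hi j hj hji, hsub i hi j hj hji⟩
    exact h.span_le_ker hG
      (Submodule.span_mono ((h.subset_iff _ _ hF hG).2 (hsub i hi j hj hji)) hy)
  · intro i hi j hj hji a ha hai haj
    refine ((ht a ha).2.2.2.2 _ (hmem i hi j hj hji) (hsub i hi j hj hji)).1 ?_
    simp only [Finset.mem_insert, Finset.mem_erase, Finset.mem_range]
    omega
  · intro i hi j hj hji
    refine ((ht i (by omega)).2.2.2.2 _ (hmem i hi j hj hji) (hsub i hi j hj hji)).2 ?_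
    simp only [Finset.mem_insert, Finset.mem_erase, Finset.mem_range]
    omega
  · intro i hi j hj hji
    refine ((ht j hj).2.2.2.2 _ (hmem i hi j hj hji) (hsub i hi j hj hji)).2 ?_
    simp only [Finset.mem_insert, Finset.mem_erase, Finset.mem_range]
    omega
  · intro i hi j hj hji
    exact ((hs i hi).2.2.2.2 _ (hmem i hi j hj hji) (hsub i hi j hj hji)).1
      (Finset.mem_insert_self _ _)
  · intro i hi j hj hji r hr hri
    refine ((hs r hr).2.2.2.2 _ (hmem i hi j hj hji) (hsub i hi j hj hji)).2 ?_
    simp only [Finset.mem_insert, Finset.mem_erase, Finset.mem_range]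
    omega

end Scribability

theorem theorem1p1 (d : ℕ) (hd : 3 ≤ d) :
    (∀ k : ℕ, k ≤ d - 3 →
      ∃ P : Set (Scribability.E d), Scribability.IsStacked P ∧ ¬ Scribability.IsScribable k P) ∧
    (∀ P : Set (Scribability.E d), Scribability.IsStacked P →
      Scribability.IsScribable (d - 1) P ∧ Scribability.IsScribable (d - 2) P) := by
  have hd2 : 2 ≤ d := by omega
  refine ⟨fun k hk => ?_, fun P hP => ⟨hP.isScribable_facets hd2, hP.isScribable_ridges hd2⟩⟩
  obtain ⟨𝓕, hS, -, h𝓕⟩ := Scribability.exists_stackedComplex_stack_facets d 4 (by omega)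
  obtain ⟨w, l, hw, hP⟩ := hS.exists_isStacked hd2
  exact ⟨_, hP, Scribability.not_isScribable_of_stacked_facets (hS.isPseudomanifold hd2) (by omega)
    h𝓕 hw⟩
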